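/- Let $d\ge 1$ be an integer, $0<\alpha_1,\alpha_2\le 1$ and $1\le p<\infty$ with $\alpha_1+\alpha_2\ge 1+\frac1p$. Suppose $0\le\rho_1,\rho_2\le 1$ satisfy $$\rho_1\alpha_1+\rho_2\alpha_2=1+\tfrac1p,$$ and $0\le\sigma_1,\sigma_2<\infty$ satisfy $$\alpha_1(1-\rho_1\alpha_1)\sigma_2=\alpha_2(1-\rho_2\alpha_2)\sigma_1 .$$ For $j=1,2$ let $\mu_j$ be a compactly supported finite positive Borel measure on $\mathbb R^d$, and let $u_j:(0,\infty)\times\mathbb R^d\to[0,\infty)$ be a solution of the heat equation $$\partial_t u_j=\frac{\sigma_j}{4\pi}\Delta u_j$$ with initial data $\mu_j$. By this we mean that $u_j(t,\cdot)$ is integrable for every $t>0$, that the equation holds at every point of $(0,\infty)\times\mathbb R^d$, that $u_j(t,x)\,dx\to\mu_j$ weakly (against bounded continuous functions) as $t\to0^+$, and, when $\sigma_j>0$, that $u_j$ and $\Delta u_j$ are continuous on $(0,\infty)\times\mathbb R^d$ and $u_j(t,\cdot)\in C^2(\mathbb R^d)$ for each $t>0$. (When $\sigma_j=0$ the equation reads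 $\partial_tu_j=0$, no smoothness is required, and $u_j$ is constant in time and is a density of $\mu_j$.) With $*$ denoting convolution in space, put $$Q(t):=t^{d(\alpha_1+\alpha_2-1-1/p)/2}\,\bigl\|u_1(t,\cdot)^{\alpha_1}*u_2(t,\cdot)^{\alpha_2}\bigr\|_{L^p(\mathbb R^d)}\in[0,\infty]\qquad(t>0).$$ Then $Q$ is nondecreasing on $(0,\infty)$. Moreover, if $\mu_1,\mu_2\neq0$ and $(\sigma_1,\sigma_2)\ne(0,0)$, then $0<Q(t)<\infty$ for all $t>0$. The same conclusions hold if, for one index $j$ with $\sigma_j=0$ and $\alpha_j=1$, the factor $u_j(t,\cdot)^{\alpha_j}$ is replaced by the (time-independent, possibly singular) measure $\mu_j$ itself, provided that for the positivity and finiteness of $Q$ one assumes $\sigma_k>0$ for the other index $k$. -/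

import Mathlib

open MeasureTheory Filter Topology Set
open scoped BoundedContinuousFunction Convolution

namespace HeatYoung

/-- `u : (0,∞) × ℝᵈ → [0,∞)` (values at times `t ≤ 0` are irrelevant) is a finite-mass, nonnegative
classical solution of `∂ₜ u = (σ / 4π) Δ u`, with the finite Borel measure `μ` as initial data.

For `σ = 0` the equation reads `∂ₜ u = 0`; it does not involve the Laplacian, and no smoothness in
space is asked for: `u` is then constant in time and `μ` is the measure with density `u t`. -/
structure IsHeatSolution {d : ℕ} (σ : ℝ) (μ : Measure (EuclideanSpace ℝ (Fin d)))
    (u : ℝ → EuclideanSpace ℝ (Fin d) → ℝ) : Prop where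
  nonneg : ∀ t, 0 < t → ∀ x, 0 ≤ u t x
  integrable : ∀ t, 0 < t → Integrable (u t) volume
  continuousOn : σ ≠ 0 →
    ContinuousOn (fun z : ℝ × EuclideanSpace ℝ (Fin d) => u z.1 z.2) (Ioi 0 ×ˢ univ)
  contDiff : σ ≠ 0 → ∀ t, 0 < t → ContDiff ℝ 2 (u t)
  continuousOn_laplacian : σ ≠ 0 →
    ContinuousOn (fun z : ℝ × EuclideanSpace ℝ (Fin d) => Laplacian.laplacian (u z.1) z.2)
      (Ioi 0 ×ˢ univ)
  heat_equation : ∀ t, 0 < t → ∀ x,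
    HasDerivAt (fun s => u s x) (σ / (4 * Real.pi) * Laplacian.laplacian (u t) x) t
  /-- `u(t,x) dx` converges to `μ` weakly as `t → 0+`. -/
  initial_data : ∀ φ : EuclideanSpace ℝ (Fin d) →ᵇ ℝ,
    Tendsto (fun t => ∫ x, φ x * u t x) (𝓝[>] 0) (𝓝 (∫ x, φ x ∂μ))

/-- The factor `t ^ (d (α₁ + α₂ - 1 - 1/p) / 2)`. -/
noncomputable def weight (d : ℕ) (α₁ α₂ p t : ℝ) : ℝ :=
  t ^ ((d : ℝ) * (α₁ + α₂ - 1 - 1 / p) / 2)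

/-- `Q(t) = t ^ (d (α₁ + α₂ - 1 - 1/p) / 2) ‖u₁(t,·)^α₁ * u₂(t,·)^α₂‖_{Lᵖ(ℝᵈ)}`, in `[0,∞]`. -/
noncomputable def Q {d : ℕ} (α₁ α₂ p : ℝ) (u₁ u₂ : ℝ → EuclideanSpace ℝ (Fin d) → ℝ)
    (t : ℝ) : ENNReal :=
  ENNReal.ofReal (weight d α₁ α₂ p t) *
    eLpNorm ((fun x => u₁ t x ^ α₁) ⋆[ContinuousLinearMap.mul ℝ ℝ, volume] (fun x => u₂ t x ^ α₂))
      (ENNReal.ofReal p) volume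

/-- The same quantity with `u₁(t,·)^α₁` replaced by a measure `μ` that is constant in time
(a heat flow with `σ₁ = 0`, with the exponent `α₁ = 1`):
`t ^ (d (α - 1/p) / 2) ‖μ * u(t,·)^α‖_{Lᵖ(ℝᵈ)}`, in `[0,∞]`. -/
noncomputable def QMeasure {d : ℕ} (α p : ℝ) (μ : Measure (EuclideanSpace ℝ (Fin d)))
    (u : ℝ → EuclideanSpace ℝ (Fin d) → ℝ) (t : ℝ) : ENNReal :=
  ENNReal.ofReal (weight d 1 α p t) *
    eLpNorm (fun x => ∫ y, u t (x - y) ^ α ∂μ) (ENNReal.ofReal p) volume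

end HeatYoung

/-! Put `b_j = 1 - ρ_j α_j` for `j = 1, 2` and `b₃ = 1 / p`. Then `b₁ + b₂ + b₃ = 1` and `1 - b_j =
ρ_j α_j ≤ α_j`. In the main case `p > 1` and `b₁, b₂, σ₁, σ₂ > 0`. Uniqueness for the heat equation
makes each `u_j(t)` a superposition of translated Gaussians `exp(-π|x - a|²/(σ_j t))`, and the
relation between the `σ_j` says exactly that `π / σ_j = c / (α_j b_j)` with one common `c`.

By duality the `Lᵖ` norm of the convolution is governed by the trilinear form `∫∫ f₁(x)^α₁ f₂(y)^α₂
h(x + y)^(1 - 1/p)`. The core is a regularised Young inequality (`RegularizedYoung`) for this form: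
if `f_j` is the superposition of Gaussians of rate `lam / (α_j b_j)` weighted by `μ_j`, the form is
at most `C μ₁(univ)^α₁ μ₂(univ)^α₂ (∫ h)^(1 - 1/p)`. On the line this is proved by mass transport.
After normalisation, `f₁`, `f₂`, `h` are carried monotonically to centred Gaussians, and the three
maps are combined into one injective map of the plane. Its Jacobian is bounded below by weighted
AM-GM, and its values do not increase the quadratic form in the exponent. For `f₁` and `f₂` the
transport is a contraction, because a centred Gaussian dominates its superpositions at points of
equal distribution function; this is what allows `α_j > 1 - b_j`. Slicing then tensorises the
inequality to `ℝᵈ`.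

Monotonicity follows from a semigroup trick (`trilinear_mul_le`). The form at time `s` is multiplied
by the mass of an extremal Gaussian `K` and written as `∫∫ F(u) K(v - u)`. For fixed `v` the
Gaussian factors are absorbed into `f₁`, `f₂`, `h`; the products are again superpositions, whose
masses are the superpositions of time `s + r` evaluated at `v`. The regularised inequality, applied
for each `v`, compares time `s` with time `s + r`, and the constants collapse to the power of `s /
(s + r)` prescribed by the weight. The inequality also gives finiteness.

The remaining cases are separate. If `p = 1` then `α₁ = α₂ = 1` and `Q` is the product of the
masses. If exactly one `σ_j` vanishes, the relation forces `α_j = 1`, and Minkowski's inequality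
shows that suitable powers of a heat flow are supersolutions (`fixedNorm_le`). If both vanish, only
the weight depends on time. -/

namespace HeatYoung

/-! ### Monotone transport of densities on the line -/

section Transport

theorem hasDerivAt_integral_Iic {f : ℝ → ℝ} (hf : Continuous f) (hfi : Integrable f) (x : ℝ) :
    HasDerivAt (fun x => ∫ y in Iic x, f y) (f x) x := by
  have h1 : ∀ x, ∫ y in Iic x, f y = (∫ y in Iic 0, f y) + ∫ y in (0 : ℝ)..x, f y := by
    intro x
    rw [← intervalIntegral.integral_Iic_sub_Iic hfi.integrableOn hfi.integrableOn]
    ring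
  have h2 := (hf.integral_hasStrictDerivAt 0 x).hasDerivAt.const_add (∫ y in Iic 0, f y)
  exact h2.congr_of_eventuallyEq (Eventually.of_forall h1)

theorem strictMono_integral_Iic {f : ℝ → ℝ} (hf : Continuous f) (hfi : Integrable f)
    (hpos : ∀ x, 0 < f x) : StrictMono (fun x => ∫ y in Iic x, f y) := by
  apply strictMono_of_deriv_pos
  intro x
  rw [(hasDerivAt_integral_Iic hf hfi x).deriv]
  exact hpos x

theorem tendsto_integral_Iic_atTop {f : ℝ → ℝ} (hfi : Integrable f) :
    Tendsto (fun x => ∫ y in Iic x, f y) atTop (𝓝 (∫ y, f y)) := by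
  have := tendsto_setIntegral_of_monotone (μ := volume) (f := f) (s := fun x : ℝ => Iic x)
    (fun _ => measurableSet_Iic) (fun _ _ h => Iic_subset_Iic.2 h) hfi.integrableOn
  simpa [iUnion_Iic] using this

theorem tendsto_integral_Iic_atBot {f : ℝ → ℝ} (hfi : Integrable f) :
    Tendsto (fun x => ∫ y in Iic x, f y) atBot (𝓝 0) := by
  have := tendsto_setIntegral_of_antitone (μ := volume) (f := f) (s := fun x : ℝ => Iic (-x))
    (fun _ => measurableSet_Iic) (fun _ _ h => Iic_subset_Iic.2 (neg_le_neg h))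
    ⟨0, hfi.integrableOn⟩
  have h0 : (⋂ x : ℝ, Iic (-x)) = ∅ := by
    ext y
    simp only [mem_iInter, mem_Iic, mem_empty_iff_false, iff_false, not_forall, not_le]
    exact ⟨-y + 1, by linarith⟩
  rw [h0] at this
  simp only [Measure.restrict_empty, integral_zero_measure] at this
  have h2 := this.comp tendsto_neg_atBot_atTop
  refine h2.congr fun x => ?_
  simp

theorem exists_integral_Iic_eq {f : ℝ → ℝ} (hf : Continuous f) (hfi : Integrable f)
    {m : ℝ} (h0 : 0 < m) (h1 : m < ∫ y, f y) : ∃ x, ∫ y in Iic x, f y = m := by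
  have hc : Continuous (fun x => ∫ y in Iic x, f y) :=
    continuous_iff_continuousAt.2 fun x => (hasDerivAt_integral_Iic hf hfi x).continuousAt
  obtain ⟨a, ha⟩ := ((tendsto_integral_Iic_atBot hfi).eventually (gt_mem_nhds h0)).exists
  obtain ⟨b, hb⟩ := ((tendsto_integral_Iic_atTop hfi).eventually (lt_mem_nhds h1)).exists
  exact mem_range_of_exists_le_of_exists_ge hc ⟨a, ha.le⟩ ⟨b, hb.le⟩

theorem integral_Iic_pos {f : ℝ → ℝ} (hf : Continuous f) (hfi : Integrable f)
    (hpos : ∀ x, 0 < f x) (x : ℝ) : 0 < ∫ y in Iic x, f y :=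
  lt_of_le_of_lt (integral_nonneg fun y => (hpos y).le)
    (strictMono_integral_Iic hf hfi hpos (sub_one_lt x))

theorem integral_Iic_lt {f : ℝ → ℝ} (hf : Continuous f) (hfi : Integrable f)
    (hpos : ∀ x, 0 < f x) (x : ℝ) : ∫ y in Iic x, f y < ∫ y, f y :=
  lt_of_lt_of_le (strictMono_integral_Iic hf hfi hpos (lt_add_one x))
    (setIntegral_le_integral hfi (Eventually.of_forall fun y => (hpos y).le))

/-- Monotone transport between two continuous positive densities on the line. -/
theorem exists_transport {f g : ℝ → ℝ} (hf : Continuous f) (hg : Continuous g)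
    (hfi : Integrable f) (hgi : Integrable g) (hfp : ∀ x, 0 < f x) (hgp : ∀ x, 0 < g x)
    (h : ∫ x, f x = ∫ x, g x) :
    ∃ S : ℝ → ℝ, (∀ x, HasDerivAt S (f x / g (S x)) x) ∧
      ∀ x, ∫ y in Iic (S x), g y = ∫ y in Iic x, f y := by
  have hex : ∀ x, ∃ s, ∫ y in Iic s, g y = ∫ y in Iic x, f y := fun x =>
    exists_integral_Iic_eq hg hgi (integral_Iic_pos hf hfi hfp x)
      (h ▸ integral_Iic_lt hf hfi hfp x)
  choose S hS using hex
  have hF := strictMono_integral_Iic hf hfi hfp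
  have hG := strictMono_integral_Iic hg hgi hgp
  have hSm : StrictMono S := by
    intro x y hxy
    have := hF hxy
    simp only [← hS] at this
    exact hG.lt_iff_lt.1 this
  have hsurj : Function.Surjective S := by
    intro y
    obtain ⟨x, hx⟩ := exists_integral_Iic_eq hf hfi (integral_Iic_pos hg hgi hgp y)
      (h ▸ integral_Iic_lt hg hgi hgp y)
    refine ⟨x, hG.injective ?_⟩
    simp only [hS, hx]
  have hSc : Continuous S := hSm.monotone.continuous_of_surjective hsurj
  refine ⟨S, fun x => ?_, hS⟩
  -- The distribution functions satisfy `G ∘ S = F`, so the slope of `S` is the slope of `F` at `x`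
  -- divided by the slope of `G` at `S x`. Continuity of `S` lets the limit be taken in the
  -- denominator.
  have h1 := hasDerivAt_iff_tendsto_slope.1 (hasDerivAt_integral_Iic hf hfi x)
  have h2 := hasDerivAt_iff_tendsto_slope.1 (hasDerivAt_integral_Iic hg hgi (S x))
  have h3 : Tendsto S (𝓝[≠] x) (𝓝[≠] (S x)) :=
    tendsto_nhdsWithin_of_tendsto_nhds_of_eventually_within _
      (hSc.continuousAt.tendsto.mono_left nhdsWithin_le_nhds)
      (eventually_nhdsWithin_of_forall fun y hy => hSm.injective.ne hy)
  rw [hasDerivAt_iff_tendsto_slope]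
  refine (h1.div (h2.comp h3) (hgp _).ne').congr' ?_
  filter_upwards [self_mem_nhdsWithin] with y hy
  have hy' : y - x ≠ 0 := sub_ne_zero.2 hy
  have hSy : S y - S x ≠ 0 := sub_ne_zero.2 (hSm.injective.ne hy)
  have hFy : (∫ z in Iic y, f z) - ∫ z in Iic x, f z ≠ 0 := sub_ne_zero.2 (hF.injective.ne hy)
  simp only [Pi.div_apply, Function.comp, slope_def_field, hS]
  field_simp

end Transport

/-! ### Contraction of superposed Gaussians onto a single Gaussian -/

section GaussianComparison

/-- The Gaussian density is a concave function of its own distribution function `Φ`: its derivative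
with respect to `Φ` is `-2Au`, which decreases in `u`. The graph therefore lies below its tangent at
`v`. -/
theorem integral_Iic_exp_tangent {A : ℝ} (hA : 0 < A) (u v : ℝ) :
    Real.exp (-A * u ^ 2) ≤ Real.exp (-A * v ^ 2) -
      2 * A * v * ((∫ y in Iic u, Real.exp (-A * y ^ 2)) - ∫ y in Iic v, Real.exp (-A * y ^ 2)) := by
  set Φ : ℝ → ℝ := fun u => ∫ y in Iic u, Real.exp (-A * y ^ 2)
  have hΦ : ∀ u, HasDerivAt Φ (Real.exp (-A * u ^ 2)) u := fun u =>
    hasDerivAt_integral_Iic (f := fun y => Real.exp (-A * y ^ 2)) (by fun_prop)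
      (integrable_exp_neg_mul_sq hA) u
  let D : ℝ → ℝ := fun u => Real.exp (-A * v ^ 2) - 2 * A * v * (Φ u - Φ v) - Real.exp (-A * u ^ 2)
  have hD : ∀ u, HasDerivAt D (2 * A * (u - v) * Real.exp (-A * u ^ 2)) u := by
    intro u
    have h1 : HasDerivAt (fun u : ℝ => Real.exp (-A * u ^ 2))
        (Real.exp (-A * u ^ 2) * (-A * (2 * u))) u := by
      have := ((hasDerivAt_pow 2 u).const_mul (-A)).exp
      simpa using this
    have := ((((hΦ u).sub_const (Φ v)).const_mul (2 * A * v)).const_sub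
      (Real.exp (-A * v ^ 2))).sub h1
    refine this.congr_deriv ?_
    ring
  have hc : Continuous D := continuous_iff_continuousAt.2 fun u => (hD u).continuousAt
  have key : 0 ≤ D u := by
    have h0 : D v = 0 := by simp [D]
    rcases le_total v u with h | h
    · have : MonotoneOn D (Ici v) := monotoneOn_of_deriv_nonneg (convex_Ici v) hc.continuousOn
        (fun x _ => (hD x).differentiableAt.differentiableWithinAt) (fun x hx => by
          rw [interior_Ici] at hx
          rw [(hD x).deriv]
          have : 0 < x - v := sub_pos.2 hx
          positivity)
      simpa [h0] using this self_mem_Ici h h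
    · have : AntitoneOn D (Iic v) := antitoneOn_of_deriv_nonpos (convex_Iic v) hc.continuousOn
        (fun x _ => (hD x).differentiableAt.differentiableWithinAt) (fun x hx => by
          rw [interior_Iic] at hx
          rw [(hD x).deriv]
          have : 0 < v - x := sub_pos.2 hx
          have h2 : 0 ≤ 2 * A * (v - x) * Real.exp (-A * x ^ 2) := by positivity
          linarith)
      simpa [h0] using this h self_mem_Iic h
  simp only [D] at key
  linarith

theorem integrable_exp_sub {A : ℝ} (hA : 0 ≤ A) (μ : Measure ℝ) [IsFiniteMeasure μ] (x : ℝ) :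
    Integrable (fun a => Real.exp (-A * (x - a) ^ 2)) μ := by
  refine Integrable.of_bound (C := 1) (by fun_prop) (Eventually.of_forall fun a => ?_)
  rw [Real.norm_eq_abs, abs_of_pos (Real.exp_pos _), Real.exp_le_one_iff]
  have := mul_nonneg hA (sq_nonneg (x - a))
  linarith

theorem continuous_integral_exp_sub {A : ℝ} (hA : 0 ≤ A) (μ : Measure ℝ) [IsFiniteMeasure μ] :
    Continuous fun x => ∫ a, Real.exp (-A * (x - a) ^ 2) ∂μ := by
  refine continuous_of_dominated (bound := fun _ => 1) (fun x => by fun_prop) (fun x => ?_)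
    (integrable_const _) (Eventually.of_forall fun a => by fun_prop)
  refine Eventually.of_forall fun a => ?_
  rw [Real.norm_eq_abs, abs_of_pos (Real.exp_pos _), Real.exp_le_one_iff]
  have := mul_nonneg hA (sq_nonneg (x - a))
  linarith

theorem integrable_prod_exp_sub {A : ℝ} (hA : 0 < A) (μ : Measure ℝ) [IsFiniteMeasure μ] :
    Integrable (fun z : ℝ × ℝ => Real.exp (-A * (z.2 - z.1) ^ 2)) (μ.prod volume) := by
  rw [integrable_prod_iff (by fun_prop)]
  refine ⟨Eventually.of_forall fun a => (integrable_exp_neg_mul_sq hA).comp_sub_right a, ?_⟩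
  have : ∀ a : ℝ, ∫ y, ‖Real.exp (-A * (y - a) ^ 2)‖ = ∫ y, Real.exp (-A * y ^ 2) := by
    intro a
    simp only [Real.norm_eq_abs, Real.abs_exp]
    exact integral_sub_right_eq_self (fun y => Real.exp (-A * y ^ 2)) a
  simp only [this]
  exact integrable_const _

theorem integral_Iic_sub_exp {A : ℝ} (x a : ℝ) :
    ∫ y in Iic x, Real.exp (-A * (y - a) ^ 2) = ∫ y in Iic (x - a), Real.exp (-A * y ^ 2) := by
  have := (measurePreserving_sub_right (volume : Measure ℝ) a).setIntegral_preimage_emb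
    (MeasurableEquiv.subRight a).measurableEmbedding (fun y => Real.exp (-A * y ^ 2)) (Iic (x - a))
  rw [← this]
  congr 2
  ext y
  simp

/-- Among all superpositions of translates of a centred Gaussian, the Gaussian itself has the
largest density at points of equal distribution function. -/
theorem le_exp_of_integral_Iic_eq {A : ℝ} (hA : 0 < A) (μ : Measure ℝ) [IsProbabilityMeasure μ]
    {x v : ℝ} (h : ∫ y in Iic v, Real.exp (-A * y ^ 2) =
      ∫ y in Iic x, ∫ a, Real.exp (-A * (y - a) ^ 2) ∂μ) :
    ∫ a, Real.exp (-A * (x - a) ^ 2) ∂μ ≤ Real.exp (-A * v ^ 2) := by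
  have hsw : ∫ y in Iic x, ∫ a, Real.exp (-A * (y - a) ^ 2) ∂μ =
      ∫ a, (∫ y in Iic (x - a), Real.exp (-A * y ^ 2)) ∂μ := by
    rw [integral_integral_swap]
    · simp only [integral_Iic_sub_exp]
    · have := (integrable_prod_exp_sub hA μ).swap
      exact this.mono_measure (by
        gcongr
        exact Measure.restrict_le_self)
  have hint : Integrable (fun a => ∫ y in Iic (x - a), Real.exp (-A * y ^ 2)) μ := by
    refine Integrable.of_bound (C := ∫ y, Real.exp (-A * y ^ 2)) ?_ ?_
    · have hc : Continuous (fun x => ∫ y in Iic x, Real.exp (-A * y ^ 2)) :=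
        continuous_iff_continuousAt.2 fun x => (hasDerivAt_integral_Iic (by fun_prop)
          (integrable_exp_neg_mul_sq hA) x).continuousAt
      exact (hc.comp (continuous_const.sub continuous_id)).aestronglyMeasurable
    · refine Eventually.of_forall fun a => ?_
      rw [Real.norm_eq_abs, abs_of_nonneg (integral_nonneg fun y => (Real.exp_pos _).le)]
      exact setIntegral_le_integral (integrable_exp_neg_mul_sq hA)
        (Eventually.of_forall fun y => (Real.exp_pos _).le)
  -- The tangent inequality at `u = x - a` is averaged over `a`. The linear term averages to zero
  -- because, by `h`, the mean of `Φ (x - a)` is `Φ v`.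
  calc ∫ a, Real.exp (-A * (x - a) ^ 2) ∂μ
      ≤ ∫ a, (Real.exp (-A * v ^ 2) - 2 * A * v * ((∫ y in Iic (x - a), Real.exp (-A * y ^ 2)) -
          ∫ y in Iic v, Real.exp (-A * y ^ 2))) ∂μ :=
        integral_mono (integrable_exp_sub hA.le μ x)
          ((integrable_const _).sub ((hint.sub (integrable_const _)).const_mul _))
          fun a => integral_Iic_exp_tangent hA (x - a) v
    _ = Real.exp (-A * v ^ 2) := by
        have h2 : ∫ a, ((∫ y in Iic (x - a), Real.exp (-A * y ^ 2)) -
            ∫ y in Iic v, Real.exp (-A * y ^ 2)) ∂μ = 0 := by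
          rw [integral_sub hint (integrable_const _), ← hsw, ← h]
          simp
        have h3 := ((hint.sub (integrable_const
          (∫ y in Iic v, Real.exp (-A * y ^ 2)))).const_mul (2 * A * v))
        simp only [Pi.sub_apply] at h3
        rw [integral_sub (integrable_const _) h3, integral_const_mul, h2]
        simp

end GaussianComparison

/-! ### The planar change of variables and the transport inequality -/

section PlanarTransport

/-- The planar map `(x, y) ↦ ((1 - b₁) w₁ - b₁ w₂ + b₁ w₃, -b₂ w₁ + (1 - b₂) w₂ + b₂ w₃)` with
`w₁ = S₁ x`, `w₂ = S₂ y`, `w₃ = S₃ (x + y)`. -/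
def planarMap (b₁ b₂ : ℝ) (S₁ S₂ S₃ : ℝ → ℝ) (z : ℝ × ℝ) : ℝ × ℝ :=
  ((1 - b₁) * S₁ z.1 - b₁ * S₂ z.2 + b₁ * S₃ (z.1 + z.2),
    -b₂ * S₁ z.1 + (1 - b₂) * S₂ z.2 + b₂ * S₃ (z.1 + z.2))

/-- The derivative of `planarMap` as a matrix. -/
noncomputable def planarDeriv (b₁ b₂ s₁ s₂ s₃ : ℝ) : ℝ × ℝ →L[ℝ] ℝ × ℝ :=
  LinearMap.toContinuousLinearMap (Matrix.toLin (Module.Basis.finTwoProd ℝ)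
    (Module.Basis.finTwoProd ℝ)
    !![(1 - b₁) * s₁ + b₁ * s₃, -b₁ * s₂ + b₁ * s₃; -b₂ * s₁ + b₂ * s₃, (1 - b₂) * s₂ + b₂ * s₃])

/-- For `b₃ = 1 - b₁ - b₂` the determinant is a convex combination of the pairwise products, which
is the form needed for weighted AM-GM. -/
theorem det_planarDeriv (b₁ b₂ s₁ s₂ s₃ : ℝ) : (planarDeriv b₁ b₂ s₁ s₂ s₃).det =
    (1 - b₁ - b₂) * (s₁ * s₂) + b₂ * (s₁ * s₃) + b₁ * (s₂ * s₃) := by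
  simp only [planarDeriv, ContinuousLinearMap.det, LinearMap.coe_toContinuousLinearMap,
    LinearMap.det_toLin, Matrix.det_fin_two_of]
  ring

theorem hasFDerivAt_planarMap {b₁ b₂ : ℝ} {S₁ S₂ S₃ : ℝ → ℝ} {z : ℝ × ℝ} {s₁ s₂ s₃ : ℝ}
    (h₁ : HasDerivAt S₁ s₁ z.1) (h₂ : HasDerivAt S₂ s₂ z.2) (h₃ : HasDerivAt S₃ s₃ (z.1 + z.2)) :
    HasFDerivAt (planarMap b₁ b₂ S₁ S₂ S₃) (planarDeriv b₁ b₂ s₁ s₂ s₃) z := by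
  have e₁ := h₁.comp_hasFDerivAt z (hasFDerivAt_fst (𝕜 := ℝ) (E := ℝ) (F := ℝ))
  have e₂ := h₂.comp_hasFDerivAt z (hasFDerivAt_snd (𝕜 := ℝ) (E := ℝ) (F := ℝ))
  have e₃ := h₃.comp_hasFDerivAt z ((hasFDerivAt_fst (𝕜 := ℝ) (E := ℝ) (F := ℝ)).add
    (hasFDerivAt_snd (𝕜 := ℝ) (E := ℝ) (F := ℝ)))
  have := (((e₁.const_mul (1 - b₁)).sub (e₂.const_mul b₁)).add (e₃.const_mul b₁)).prodMk
    (((e₁.const_mul (-b₂)).add (e₂.const_mul (1 - b₂))).add (e₃.const_mul b₂))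
  refine this.congr_fderiv ?_
  ext <;> simp [planarDeriv, Matrix.toLin_finTwoProd_apply]

/-- If two points have the same image, the increments of `S₁, S₂, S₃` are `b₁ e, b₂ e, -b₃ e` for
one number `e`. Pairing them with the increments of the arguments, with weights `1 / b_j`, gives `e
(Δx + Δy - Δ(x + y)) = 0`. Each term of this sum is nonnegative by monotonicity, hence zero. -/
theorem injective_planarMap {b₁ b₂ b₃ : ℝ} (hb₁ : 0 < b₁) (hb₂ : 0 < b₂) (hb₃ : 0 < b₃)
    (hb : b₁ + b₂ + b₃ = 1) {S₁ S₂ S₃ : ℝ → ℝ} (h₁ : StrictMono S₁) (h₂ : StrictMono S₂)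
    (h₃ : StrictMono S₃) : Function.Injective (planarMap b₁ b₂ S₁ S₂ S₃) := by
  rintro ⟨x, y⟩ ⟨x', y'⟩ h
  simp only [planarMap, Prod.mk.injEq] at h
  obtain ⟨e₁, e₂⟩ := h
  have m : ∀ {S : ℝ → ℝ}, StrictMono S → ∀ u v, 0 ≤ (S u - S v) * (u - v) := by
    intro S hS u v
    rcases le_total u v with huv | huv
    · exact mul_nonneg_of_nonpos_of_nonpos (sub_nonpos.2 (hS.monotone huv)) (sub_nonpos.2 huv)
    · exact mul_nonneg (sub_nonneg.2 (hS.monotone huv)) (sub_nonneg.2 huv)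
  have m0 : ∀ {S : ℝ → ℝ}, StrictMono S → ∀ u v, (S u - S v) * (u - v) = 0 → u = v := by
    intro S hS u v huv
    rcases mul_eq_zero.1 huv with h | h
    · exact hS.injective (sub_eq_zero.1 h)
    · exact sub_eq_zero.1 h
  have hsum : (S₁ x - S₁ x') * (x - x') / b₁ + (S₂ y - S₂ y') * (y - y') / b₂ +
      (S₃ (x + y) - S₃ (x' + y')) * ((x + y) - (x' + y')) / b₃ = 0 := by
    have hE₁ : S₁ x - S₁ x' = b₁ * ((S₁ x - S₁ x') + (S₂ y - S₂ y') -
      (S₃ (x + y) - S₃ (x' + y'))) := by linear_combination e₁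
    have hE₂ : S₂ y - S₂ y' = b₂ * ((S₁ x - S₁ x') + (S₂ y - S₂ y') -
      (S₃ (x + y) - S₃ (x' + y'))) := by linear_combination e₂
    set e := (S₁ x - S₁ x') + (S₂ y - S₂ y') - (S₃ (x + y) - S₃ (x' + y')) with he
    have hE₃ : S₃ (x + y) - S₃ (x' + y') = -b₃ * e := by
      have : S₃ (x + y) - S₃ (x' + y') = (S₁ x - S₁ x') + (S₂ y - S₂ y') - e := by rw [he]; ring
      rw [this, hE₁, hE₂]
      linear_combination e * hb
    rw [hE₁, hE₂, hE₃]
    field_simp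
    ring
  have n₁ := div_nonneg (m h₁ x x') hb₁.le
  have n₂ := div_nonneg (m h₂ y y') hb₂.le
  have n₃ := div_nonneg (m h₃ (x + y) (x' + y')) hb₃.le
  have z₁ : (S₁ x - S₁ x') * (x - x') / b₁ = 0 := by linarith
  have z₂ : (S₂ y - S₂ y') * (y - y') / b₂ = 0 := by linarith
  rw [div_eq_zero_iff, or_iff_left hb₁.ne'] at z₁
  rw [div_eq_zero_iff, or_iff_left hb₂.ne'] at z₂
  rw [m0 h₁ _ _ z₁, m0 h₂ _ _ z₂]

/-- The vector of the two coordinates and their sum is the orthogonal projection of `(w₁, w₂, w₃)`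
onto the plane `w₃ = w₁ + w₂`, for the quadratic form with weights `1 / b_j`. The normal `(b₁, b₂,
-b₃)` has length one, so the loss is exactly `(w₁ + w₂ - w₃)²`. -/
theorem quadratic_planarMap_le {b₁ b₂ b₃ : ℝ} (hb₁ : 0 < b₁) (hb₂ : 0 < b₂) (hb₃ : 0 < b₃)
    (hb : b₁ + b₂ + b₃ = 1) (S₁ S₂ S₃ : ℝ → ℝ) (z : ℝ × ℝ) :
    (planarMap b₁ b₂ S₁ S₂ S₃ z).1 ^ 2 / b₁ + (planarMap b₁ b₂ S₁ S₂ S₃ z).2 ^ 2 / b₂ +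
      ((planarMap b₁ b₂ S₁ S₂ S₃ z).1 + (planarMap b₁ b₂ S₁ S₂ S₃ z).2) ^ 2 / b₃ ≤
    S₁ z.1 ^ 2 / b₁ + S₂ z.2 ^ 2 / b₂ + S₃ (z.1 + z.2) ^ 2 / b₃ := by
  simp only [planarMap]
  generalize S₁ z.1 = w₁
  generalize S₂ z.2 = w₂
  generalize S₃ (z.1 + z.2) = w₃
  obtain rfl : b₃ = 1 - b₁ - b₂ := by linarith
  have key : w₁ ^ 2 / b₁ + w₂ ^ 2 / b₂ + w₃ ^ 2 / (1 - b₁ - b₂) -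
      (((1 - b₁) * w₁ - b₁ * w₂ + b₁ * w₃) ^ 2 / b₁ +
        (-b₂ * w₁ + (1 - b₂) * w₂ + b₂ * w₃) ^ 2 / b₂ +
        ((1 - b₁) * w₁ - b₁ * w₂ + b₁ * w₃ + (-b₂ * w₁ + (1 - b₂) * w₂ + b₂ * w₃)) ^ 2 /
          (1 - b₁ - b₂)) = (w₁ + w₂ - w₃) ^ 2 := by
    field_simp
    ring
  have := sq_nonneg (w₁ + w₂ - w₃)
  linarith

theorem rpow_mul_rpow_mul_rpow_le {b₁ b₂ b₃ : ℝ} (hb₁ : 0 ≤ b₁) (hb₂ : 0 ≤ b₂) (hb₃ : 0 ≤ b₃)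
    (hb : b₁ + b₂ + b₃ = 1) {s₁ s₂ s₃ : ℝ} (h₁ : 0 < s₁) (h₂ : 0 < s₂) (h₃ : 0 < s₃) :
    s₁ ^ (1 - b₁) * s₂ ^ (1 - b₂) * s₃ ^ (1 - b₃) ≤
      b₃ * (s₁ * s₂) + b₂ * (s₁ * s₃) + b₁ * (s₂ * s₃) := by
  have := Real.geom_mean_le_arith_mean3_weighted hb₃ hb₂ hb₁ (mul_pos h₁ h₂).le (mul_pos h₁ h₃).le
    (mul_pos h₂ h₃).le (by linarith)
  refine le_of_eq_of_le ?_ this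
  rw [Real.mul_rpow h₁.le h₂.le, Real.mul_rpow h₁.le h₃.le, Real.mul_rpow h₂.le h₃.le,
    show 1 - b₁ = b₃ + b₂ by linarith, show 1 - b₂ = b₃ + b₁ by linarith,
    show 1 - b₃ = b₂ + b₁ by linarith, Real.rpow_add h₁, Real.rpow_add h₂, Real.rpow_add h₃]
  ring

/-- A regularised trilinear Young inequality on the line, for densities which are transported to
centred Gaussians by `S₁`, `S₂`, `S₃`, with `S₁` and `S₂` contracting. -/
theorem lintegral_transport_le {b₁ b₂ b₃ : ℝ} (hb₁ : 0 < b₁) (hb₂ : 0 < b₂) (hb₃ : 0 < b₃)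
    (hb : b₁ + b₂ + b₃ = 1) {lam α₁ α₂ : ℝ} (hlam : 0 ≤ lam) (hα₁ : 1 - b₁ ≤ α₁) (hα₂ : 1 - b₂ ≤ α₂)
    {f₁ f₂ f₃ S₁ S₂ S₃ : ℝ → ℝ}
    (p₁ : ∀ x, 0 < f₁ x) (p₂ : ∀ x, 0 < f₂ x) (p₃ : ∀ x, 0 < f₃ x)
    (d₁ : ∀ x, HasDerivAt S₁ (f₁ x / Real.exp (-(lam / (α₁ * b₁)) * S₁ x ^ 2)) x)
    (d₂ : ∀ x, HasDerivAt S₂ (f₂ x / Real.exp (-(lam / (α₂ * b₂)) * S₂ x ^ 2)) x)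
    (d₃ : ∀ x, HasDerivAt S₃ (f₃ x / Real.exp (-(lam / ((1 - b₃) * b₃)) * S₃ x ^ 2)) x)
    (c₁ : ∀ x, f₁ x ≤ Real.exp (-(lam / (α₁ * b₁)) * S₁ x ^ 2))
    (c₂ : ∀ x, f₂ x ≤ Real.exp (-(lam / (α₂ * b₂)) * S₂ x ^ 2)) :
    ∫⁻ z : ℝ × ℝ, ENNReal.ofReal (f₁ z.1 ^ α₁ * f₂ z.2 ^ α₂ * f₃ (z.1 + z.2) ^ (1 - b₃)) ≤
      ∫⁻ z : ℝ × ℝ, ENNReal.ofReal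
        (Real.exp (-lam * (z.1 ^ 2 / b₁ + z.2 ^ 2 / b₂ + (z.1 + z.2) ^ 2 / b₃))) := by
  have hα₁' : 0 < α₁ := by linarith
  have hα₂' : 0 < α₂ := by linarith
  have hb₃' : 0 < 1 - b₃ := by linarith
  have mono : ∀ {f S g : ℝ → ℝ}, (∀ x, 0 < f x) →
      (∀ x, HasDerivAt S (f x / Real.exp (g x)) x) → StrictMono S := by
    intro f S g hf hS
    refine strictMono_of_deriv_pos fun x => ?_
    rw [(hS x).deriv]
    exact div_pos (hf x) (Real.exp_pos _)
  have hinj := injective_planarMap hb₁ hb₂ hb₃ hb (mono p₁ d₁) (mono p₂ d₂) (mono p₃ d₃)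
  have hcv := lintegral_image_eq_lintegral_abs_det_fderiv_mul (μ := (volume : Measure (ℝ × ℝ)))
    MeasurableSet.univ
    (fun z _ => (hasFDerivAt_planarMap (b₁ := b₁) (b₂ := b₂) (d₁ z.1) (d₂ z.2)
      (d₃ (z.1 + z.2))).hasFDerivWithinAt) hinj.injOn
    (fun z => ENNReal.ofReal
        (Real.exp (-lam * (z.1 ^ 2 / b₁ + z.2 ^ 2 / b₂ + (z.1 + z.2) ^ 2 / b₃))))
  rw [Measure.restrict_univ] at hcv
  -- Surjectivity of the planar map is not needed: integrating over its image is at most integrating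
  -- over the plane.
  refine le_trans (le_trans (lintegral_mono fun z => ?_) hcv.ge) (setLIntegral_le_lintegral _ _)
  dsimp only
  rw [← ENNReal.ofReal_mul (abs_nonneg _), det_planarDeriv]
  apply ENNReal.ofReal_le_ofReal
  set g₁ := Real.exp (-(lam / (α₁ * b₁)) * S₁ z.1 ^ 2) with hg₁
  set g₂ := Real.exp (-(lam / (α₂ * b₂)) * S₂ z.2 ^ 2) with hg₂
  set g₃ := Real.exp (-(lam / ((1 - b₃) * b₃)) * S₃ (z.1 + z.2) ^ 2) with hg₃
  have q₁ : 0 < g₁ := Real.exp_pos _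
  have q₂ : 0 < g₂ := Real.exp_pos _
  have q₃ : 0 < g₃ := Real.exp_pos _
  set s₁ := f₁ z.1 / g₁ with hs₁
  set s₂ := f₂ z.2 / g₂ with hs₂
  set s₃ := f₃ (z.1 + z.2) / g₃ with hs₃
  have r₁ : 0 < s₁ := div_pos (p₁ _) q₁
  have r₂ : 0 < s₂ := div_pos (p₂ _) q₂
  have r₃ : 0 < s₃ := div_pos (p₃ _) q₃
  have l₁ : s₁ ≤ 1 := (div_le_one q₁).2 (c₁ _)
  have l₂ : s₂ ≤ 1 := (div_le_one q₂).2 (c₂ _)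
  have e₁ : f₁ z.1 = s₁ * g₁ := by rw [hs₁]; field_simp
  have e₂ : f₂ z.2 = s₂ * g₂ := by rw [hs₂]; field_simp
  have e₃ : f₃ (z.1 + z.2) = s₃ * g₃ := by rw [hs₃]; field_simp
  have hamgm := rpow_mul_rpow_mul_rpow_le hb₁.le hb₂.le hb₃.le hb r₁ r₂ r₃
  -- The Gaussian rates carry the factors `1 / α_j` and `1 / (1 - b₃)` so that these powers
  -- recombine into the single quadratic form with weights `1 / b_j`.
  have hG : g₁ ^ α₁ * g₂ ^ α₂ * g₃ ^ (1 - b₃) = Real.exp (-lam * (S₁ z.1 ^ 2 / b₁ +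
      S₂ z.2 ^ 2 / b₂ + S₃ (z.1 + z.2) ^ 2 / b₃)) := by
    rw [hg₁, hg₂, hg₃, ← Real.exp_mul, ← Real.exp_mul, ← Real.exp_mul, ← Real.exp_add,
      ← Real.exp_add]
    congr 1
    field_simp
    ring
  have hq := quadratic_planarMap_le hb₁ hb₂ hb₃ hb S₁ S₂ S₃ z
  have hdet : (1 - b₁ - b₂) = b₃ := by linarith
  rw [hdet, abs_of_nonneg (by positivity), e₁, e₂, e₃, Real.mul_rpow r₁.le q₁.le,
    Real.mul_rpow r₂.le q₂.le, Real.mul_rpow r₃.le q₃.le]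
  calc s₁ ^ α₁ * g₁ ^ α₁ * (s₂ ^ α₂ * g₂ ^ α₂) * (s₃ ^ (1 - b₃) * g₃ ^ (1 - b₃))
      = (s₁ ^ α₁ * s₂ ^ α₂ * s₃ ^ (1 - b₃)) * (g₁ ^ α₁ * g₂ ^ α₂ * g₃ ^ (1 - b₃)) := by ring
    _ ≤ _ := by
      refine mul_le_mul ?_ ?_ (by positivity) (by positivity)
      · refine le_trans ?_ hamgm
        -- The contraction bounds `s₁, s₂ ≤ 1` enter here: they allow the exponents `1 - b_j` to be
        -- raised to `α_j`. The third exponent is exactly `1 - b₃`, so nothing is asked of `S₃`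
        -- beyond monotonicity.
        gcongr ?_ * ?_ * _
        · exact Real.rpow_le_rpow_of_exponent_ge r₁ l₁ hα₁
        · exact Real.rpow_le_rpow_of_exponent_ge r₂ l₂ hα₂
      · rw [hG, Real.exp_le_exp]
        exact mul_le_mul_of_nonpos_left hq (by linarith)

end PlanarTransport

/-! ### Superpositions of Gaussians and the regularised Young inequality -/

section Superposition

/-- The superposition `∑ exp (-A q (x - a))` of translates of a Gaussian, weighted by `μ`. -/
noncomputable def superpose {E : Type*} [AddCommGroup E] [MeasurableSpace E] (q : E → ℝ) (A : ℝ)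
    (μ : Measure E) (x : E) : ENNReal :=
  ∫⁻ a, ENNReal.ofReal (Real.exp (-A * q (x - a))) ∂μ

theorem measurable_superpose {E : Type*} [AddCommGroup E] [MeasurableSpace E] [MeasurableSub₂ E]
    {q : E → ℝ} (hq : Measurable q) (A : ℝ) (μ : Measure E) [SFinite μ] :
    Measurable (superpose q A μ) := by
  unfold superpose
  refine Measurable.lintegral_prod_right' (f := fun z : E × E =>
    ENNReal.ofReal (Real.exp (-A * q (z.1 - z.2)))) ?_
  have : Measurable fun z : E × E => q (z.1 - z.2) := hq.comp measurable_sub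
  fun_prop

theorem superpose_smul {E : Type*} [AddCommGroup E] [MeasurableSpace E] (q : E → ℝ) (A : ℝ)
    (μ : Measure E) (c : ENNReal) (x : E) : superpose q A (c • μ) x = c * superpose q A μ x := by
  simp [superpose]

theorem superpose_zero {E : Type*} [AddCommGroup E] [MeasurableSpace E] (q : E → ℝ) (A : ℝ)
    (x : E) : superpose q A 0 x = 0 := by
  simp [superpose]

/-- A regularised trilinear Young inequality with constant `C`. -/
def RegularizedYoung (E : Type*) [AddCommGroup E] [MeasureSpace E] (q : E → ℝ)
    (A₁ A₂ α₁ α₂ κ : ℝ) (C : ENNReal) : Prop :=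
  ∀ (μ₁ μ₂ : Measure E) [IsFiniteMeasure μ₁] [IsFiniteMeasure μ₂] (h : E → ENNReal), Measurable h →
    ∫⁻ x, ∫⁻ y, superpose q A₁ μ₁ x ^ α₁ * superpose q A₂ μ₂ y ^ α₂ * h (x + y) ^ κ ≤
      C * μ₁ univ ^ α₁ * μ₂ univ ^ α₂ * (∫⁻ x, h x) ^ κ

end Superposition

/-! ### Gaussian integrals -/

section GaussianIntegrals

theorem complete_square {E : Type*} [NormedAddCommGroup E] [InnerProductSpace ℝ E] {a b : ℝ} (ha : 0 < a) (hb : 0 < b) (x y : E) :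
    ‖y‖ ^ 2 / a + ‖x + y‖ ^ 2 / b =
      (1 / a + 1 / b) * ‖y + (a / (a + b)) • x‖ ^ 2 + ‖x‖ ^ 2 / (a + b) := by
  rw [norm_add_sq_real, norm_add_sq_real, norm_smul, inner_smul_right, real_inner_comm y x,
    mul_pow, Real.norm_eq_abs, sq_abs]
  field_simp
  ring

variable {E : Type*} [NormedAddCommGroup E] [InnerProductSpace ℝ E] [FiniteDimensional ℝ E]
  [MeasurableSpace E] [BorelSpace E]

theorem integrable_exp_neg_mul_norm_sq {c : ℝ} (hc : 0 < c) :
    Integrable (fun x : E => Real.exp (-c * ‖x‖ ^ 2)) := by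
  have := GaussianFourier.integrable_cexp_neg_mul_sq_norm_add (V := E) (b := c) (by simpa) 0 0
  refine this.re.congr (Eventually.of_forall fun x => ?_)
  simp only [inner_zero_left, Complex.ofReal_zero, mul_zero, add_zero]
  rw [← Complex.ofReal_pow, ← Complex.ofReal_neg, ← Complex.ofReal_mul]
  exact Complex.exp_ofReal_re _

theorem lintegral_exp_neg_mul_norm_sq {c : ℝ} (hc : 0 < c) :
    ∫⁻ x : E, ENNReal.ofReal (Real.exp (-c * ‖x‖ ^ 2)) =
      ENNReal.ofReal ((Real.pi / c) ^ (Module.finrank ℝ E / 2 : ℝ)) := by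
  rw [← ofReal_integral_eq_lintegral_ofReal (integrable_exp_neg_mul_norm_sq hc)
    (Eventually.of_forall fun x => (Real.exp_pos _).le)]
  rw [GaussianFourier.integral_rexp_neg_mul_sq_norm hc]

/-- Completing the square in `y` leaves a Gaussian in `x` with weight `1 / b₁ + 1 / (b₂ + b₃)`; the
condition `b₁ + b₂ + b₃ = 1` then simplifies the product of the two integrals. -/
theorem lintegral_lintegral_exp_quadratic {b₁ b₂ b₃ : ℝ} (hb₁ : 0 < b₁) (hb₂ : 0 < b₂)
    (hb₃ : 0 < b₃) (hb : b₁ + b₂ + b₃ = 1) {lam : ℝ} (hlam : 0 < lam) :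
    ∫⁻ x : E, ∫⁻ y : E, ENNReal.ofReal
        (Real.exp (-lam * (‖x‖ ^ 2 / b₁ + ‖y‖ ^ 2 / b₂ + ‖x + y‖ ^ 2 / b₃))) =
      ENNReal.ofReal (((Real.pi / lam) ^ 2 * (b₁ * b₂ * b₃)) ^ (Module.finrank ℝ E / 2 : ℝ)) := by
  have h1 : ∀ x : E, ∫⁻ y : E, ENNReal.ofReal
      (Real.exp (-lam * (‖x‖ ^ 2 / b₁ + ‖y‖ ^ 2 / b₂ + ‖x + y‖ ^ 2 / b₃))) =
      ENNReal.ofReal (Real.exp (-(lam * (1 / b₁ + 1 / (b₂ + b₃))) * ‖x‖ ^ 2)) *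
        ENNReal.ofReal ((Real.pi / (lam * (1 / b₂ + 1 / b₃))) ^ (Module.finrank ℝ E / 2 : ℝ)) := by
    intro x
    rw [← lintegral_exp_neg_mul_norm_sq (E := E) (c := lam * (1 / b₂ + 1 / b₃)) (by positivity),
      ← lintegral_add_right_eq_self (fun y : E => ENNReal.ofReal
        (Real.exp (-(lam * (1 / b₂ + 1 / b₃)) * ‖y‖ ^ 2))) ((b₂ / (b₂ + b₃)) • x), ← lintegral_const_mul _ (by fun_prop)]
    refine lintegral_congr fun y => ?_
    rw [← ENNReal.ofReal_mul (Real.exp_pos _).le, ← Real.exp_add, add_assoc (‖x‖ ^ 2 / b₁),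
      complete_square hb₂ hb₃]
    congr 2
    ring
  simp only [h1]
  rw [lintegral_mul_const _ (by fun_prop), lintegral_exp_neg_mul_norm_sq (by positivity),
    ← ENNReal.ofReal_mul (by positivity), ← Real.mul_rpow (by positivity) (by positivity)]
  congr 2
  obtain rfl : b₁ = 1 - b₂ - b₃ := by linarith
  have : b₂ + b₃ ≠ 0 := by positivity
  field_simp
  ring

end GaussianIntegrals

/-! ### The inequality on the line for continuous positive functions -/

section Line

theorem superpose_sq_eq_ofReal {A : ℝ} (hA : 0 ≤ A) (μ : Measure ℝ) [IsFiniteMeasure μ] (x : ℝ) :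
    superpose (fun x => x ^ 2) A μ x = ENNReal.ofReal (∫ a, Real.exp (-A * (x - a) ^ 2) ∂μ) :=
  (ofReal_integral_eq_lintegral_ofReal (integrable_exp_sub hA μ x)
    (Eventually.of_forall fun _ => (Real.exp_pos _).le)).symm

theorem integral_integral_exp_sub {A : ℝ} (hA : 0 < A) (μ : Measure ℝ) [IsProbabilityMeasure μ] :
    Integrable (fun x => ∫ a, Real.exp (-A * (x - a) ^ 2) ∂μ) ∧
      ∫ x, ∫ a, Real.exp (-A * (x - a) ^ 2) ∂μ = ∫ x, Real.exp (-A * x ^ 2) := by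
  have h : Integrable (Function.uncurry fun x a : ℝ => Real.exp (-A * (x - a) ^ 2))
      (volume.prod μ) := (integrable_prod_exp_sub hA μ).swap
  refine ⟨h.integral_prod_left, ?_⟩
  rw [integral_integral_swap h]
  have : ∀ a : ℝ, ∫ y, Real.exp (-A * (y - a) ^ 2) = ∫ y, Real.exp (-A * y ^ 2) := fun a =>
    integral_sub_right_eq_self (fun y => Real.exp (-A * y ^ 2)) a
  simp only [this, integral_const, probReal_univ, one_smul]

/-- The sharp constant on the line. -/
noncomputable def youngConst (b₁ b₂ b₃ lam : ℝ) : ℝ :=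
  ((Real.pi / lam) ^ 2 * (b₁ * b₂ * b₃)) ^ (1 / 2 : ℝ) /
    ((Real.pi / (lam / ((1 - b₃) * b₃))) ^ (1 / 2 : ℝ)) ^ (1 - b₃)

theorem lintegral_superpose_of_continuous {b₁ b₂ b₃ : ℝ} (hb₁ : 0 < b₁) (hb₂ : 0 < b₂)
    (hb₃ : 0 < b₃) (hb : b₁ + b₂ + b₃ = 1) {lam α₁ α₂ : ℝ} (hlam : 0 < lam) (hα₁ : 1 - b₁ ≤ α₁)
    (hα₂ : 1 - b₂ ≤ α₂) (μ₁ μ₂ : Measure ℝ) [IsProbabilityMeasure μ₁] [IsProbabilityMeasure μ₂]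
    {h : ℝ → ℝ} (hc : Continuous h) (hp : ∀ x, 0 < h x) (hi : Integrable h) :
    ∫⁻ x, ∫⁻ y, superpose (fun x => x ^ 2) (lam / (α₁ * b₁)) μ₁ x ^ α₁ *
        superpose (fun x => x ^ 2) (lam / (α₂ * b₂)) μ₂ y ^ α₂ * 
        ENNReal.ofReal (h (x + y)) ^ (1 - b₃) ≤
      ENNReal.ofReal (youngConst b₁ b₂ b₃ lam) * (∫⁻ x, ENNReal.ofReal (h x)) ^ (1 - b₃) := by
  have hα₁' : 0 < α₁ := by linarith
  have hα₂' : 0 < α₂ := by linarith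
  have hb₃' : 0 < 1 - b₃ := by linarith
  set A₁ := lam / (α₁ * b₁) with hA₁
  set A₂ := lam / (α₂ * b₂) with hA₂
  set A₃ := lam / ((1 - b₃) * b₃) with hA₃
  have pA₁ : 0 < A₁ := by positivity
  have pA₂ : 0 < A₂ := by positivity
  have pA₃ : 0 < A₃ := by positivity
  set f₁ : ℝ → ℝ := fun x => ∫ a, Real.exp (-A₁ * (x - a) ^ 2) ∂μ₁ with hf₁
  set f₂ : ℝ → ℝ := fun x => ∫ a, Real.exp (-A₂ * (x - a) ^ 2) ∂μ₂ with hf₂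
  have p₁ : ∀ x, 0 < f₁ x := fun x => integral_exp_pos (integrable_exp_sub pA₁.le μ₁ x)
  have p₂ : ∀ x, 0 < f₂ x := fun x => integral_exp_pos (integrable_exp_sub pA₂.le μ₂ x)
  have gc : ∀ A : ℝ, Continuous fun x : ℝ => Real.exp (-A * x ^ 2) := fun A => by fun_prop
  obtain ⟨S₁, d₁, t₁⟩ := exists_transport (continuous_integral_exp_sub pA₁.le μ₁) (gc A₁)
    (integral_integral_exp_sub pA₁ μ₁).1 (integrable_exp_neg_mul_sq pA₁) p₁
    (fun x => Real.exp_pos _) (integral_integral_exp_sub pA₁ μ₁).2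
  obtain ⟨S₂, d₂, t₂⟩ := exists_transport (continuous_integral_exp_sub pA₂.le μ₂) (gc A₂)
    (integral_integral_exp_sub pA₂ μ₂).1 (integrable_exp_neg_mul_sq pA₂) p₂
    (fun x => Real.exp_pos _) (integral_integral_exp_sub pA₂ μ₂).2
  set G := ∫ x, Real.exp (-A₃ * x ^ 2) with hG
  have hGv : G = (Real.pi / A₃) ^ (1 / 2 : ℝ) := by
    rw [hG, integral_gaussian, Real.sqrt_eq_rpow]
  have hGp : 0 < G := by rw [hGv]; positivity
  set I := ∫ x, h x with hI
  have hIp : 0 < I := by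
    rw [hI, integral_pos_iff_support_of_nonneg (fun x => (hp x).le) hi]
    have : Function.support h = univ := by ext x; simp [(hp x).ne']
    simp [this]
  -- The function `h` is rescaled to the mass `G` of its target Gaussian; `hpt` undoes this scaling,
  -- and the power of `G` becomes the denominator of `youngConst`.
  obtain ⟨S₃, d₃, -⟩ := exists_transport (f := fun x => G / I * h x) (hc.const_mul _) (gc A₃)
    (hi.const_mul _) (integrable_exp_neg_mul_sq pA₃) (fun x => mul_pos (div_pos hGp hIp) (hp x))
    (fun x => Real.exp_pos _) (by rw [integral_const_mul, ← hI, ← hG]; field_simp)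
  have main := lintegral_transport_le hb₁ hb₂ hb₃ hb hlam.le hα₁ hα₂ p₁ p₂
    (fun x => mul_pos (div_pos hGp hIp) (hp x)) d₁ d₂ d₃
    (fun x => le_exp_of_integral_Iic_eq pA₁ μ₁ (t₁ x))
    (fun x => le_exp_of_integral_Iic_eq pA₂ μ₂ (t₂ x))
  have fc₁ : Continuous f₁ := continuous_integral_exp_sub pA₁.le μ₁
  have fc₂ : Continuous f₂ := continuous_integral_exp_sub pA₂.le μ₂
  have hgauss := lintegral_lintegral_exp_quadratic (E := ℝ) hb₁ hb₂ hb₃ hb hlam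
  simp only [Module.finrank_self, Nat.cast_one, Real.norm_eq_abs, sq_abs] at hgauss
  rw [Measure.volume_eq_prod, lintegral_prod _ (by fun_prop), lintegral_prod _ (by fun_prop),
    hgauss] at main
  have hpt : ∀ x y, superpose (fun x => x ^ 2) A₁ μ₁ x ^ α₁ *
      superpose (fun x => x ^ 2) A₂ μ₂ y ^ α₂ * ENNReal.ofReal (h (x + y)) ^ (1 - b₃) =
      ENNReal.ofReal ((I / G) ^ (1 - b₃)) *
        ENNReal.ofReal (f₁ x ^ α₁ * f₂ y ^ α₂ * (G / I * h (x + y)) ^ (1 - b₃)) := by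
    intro x y
    rw [superpose_sq_eq_ofReal pA₁.le, superpose_sq_eq_ofReal pA₂.le,
      ENNReal.ofReal_rpow_of_pos (p₁ x), ENNReal.ofReal_rpow_of_pos (p₂ y),
      ENNReal.ofReal_rpow_of_pos (hp _), ← ENNReal.ofReal_mul (Real.rpow_nonneg (p₁ x).le _),
      ← ENNReal.ofReal_mul (mul_nonneg (Real.rpow_nonneg (p₁ x).le _)
        (Real.rpow_nonneg (p₂ y).le _)), ← ENNReal.ofReal_mul (by positivity),
      Real.mul_rpow (by positivity) (hp _).le]
    congr 1
    have : (I / G) ^ (1 - b₃) * (G / I) ^ (1 - b₃) = 1 := by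
      rw [← Real.mul_rpow (by positivity) (by positivity)]
      have : I / G * (G / I) = 1 := by field_simp
      rw [this, Real.one_rpow]
    linear_combination (-f₁ x ^ α₁ * f₂ y ^ α₂ * h (x + y) ^ (1 - b₃)) * this
  simp only [hpt]
  simp_rw [lintegral_const_mul' _ _ ENNReal.ofReal_ne_top]
  refine (mul_le_mul_right main _).trans (le_of_eq ?_)
  rw [← ofReal_integral_eq_lintegral_ofReal hi (Eventually.of_forall fun x => (hp x).le), ← hI,
    ENNReal.ofReal_rpow_of_pos hIp, ← ENNReal.ofReal_mul (by positivity),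
    ← ENNReal.ofReal_mul (by unfold youngConst; positivity), youngConst, ← hA₃, ← hGv,
    Real.div_rpow hIp.le hGp.le]
  congr 1
  ring

end Line

/-! ### Extension to measurable functions by density -/

section Density

/-- A nonnegative integrable function on the line is an `L¹` and almost everywhere limit of
continuous positive integrable functions. -/
theorem exists_seq_continuous_pos_tendsto {h : ℝ → ℝ} (hi : Integrable h) (hn : ∀ x, 0 ≤ h x) :
    ∃ ψ : ℕ → ℝ → ℝ, (∀ n, Continuous (ψ n) ∧ (∀ x, 0 < ψ n x) ∧ Integrable (ψ n)) ∧
      (∀ᵐ x, Tendsto (fun n => ψ n x) atTop (𝓝 (h x))) ∧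
      Tendsto (fun n => ∫⁻ x, ENNReal.ofReal (ψ n x)) atTop (𝓝 (∫⁻ x, ENNReal.ofReal (h x))) := by
  have hg : Integrable (fun x : ℝ => Real.exp (-1 * x ^ 2)) := integrable_exp_neg_mul_sq one_pos
  have hex : ∀ n : ℕ, ∃ φ : ℝ → ℝ, HasCompactSupport φ ∧ ∫ x, ‖h x - φ x‖ ≤ 1 / (n + 1) ∧
      Continuous φ ∧ Integrable φ := fun n =>
    hi.exists_hasCompactSupport_integral_sub_le (by positivity)
  choose φ hφc hφ hφcont hφi using hex
  -- Since `h ≥ 0`, taking absolute values does not worsen the approximation; the small Gaussian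
  -- makes the approximant strictly positive.
  set ψ : ℕ → ℝ → ℝ := fun n x => |φ n x| + 1 / (n + 1) * Real.exp (-1 * x ^ 2) with hψ
  have hψi : ∀ n, Integrable (ψ n) := fun n => (hφi n).abs.add (hg.const_mul _)
  have hψc : ∀ n, Continuous (ψ n) := fun n => (hφcont n).abs.add (by fun_prop)
  have hψp : ∀ n x, 0 < ψ n x := fun n x => by positivity
  have hL1 : Tendsto (fun n => ∫ x, ‖ψ n x - h x‖) atTop (𝓝 0) := by
    have hb : Tendsto (fun n : ℕ => 1 / ((n : ℝ) + 1) + 1 / ((n : ℝ) + 1) *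
        ∫ x : ℝ, Real.exp (-1 * x ^ 2)) atTop (𝓝 0) := by
      have := tendsto_one_div_add_atTop_nhds_zero_nat (𝕜 := ℝ)
      simpa only [zero_mul, add_zero] using
        this.add (this.mul_const (∫ x : ℝ, Real.exp (-1 * x ^ 2)))
    refine squeeze_zero (fun n => integral_nonneg fun x => norm_nonneg _) (fun n => ?_) hb
    calc ∫ x, ‖ψ n x - h x‖
        ≤ ∫ x, (‖h x - φ n x‖ + 1 / ((n : ℝ) + 1) * Real.exp (-1 * x ^ 2)) := by
          refine integral_mono ((hψi n).sub hi).norm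
            ((hi.sub (hφi n)).norm.add (hg.const_mul _)) fun x => ?_
          have hq : 0 < 1 / ((n : ℝ) + 1) * Real.exp (-1 * x ^ 2) := by positivity
          have h1 : |(|φ n x|) - h x| ≤ |h x - φ n x| := by
            rw [abs_sub_comm (h x), ← abs_of_nonneg (hn x)]
            simpa [abs_of_nonneg (hn x)] using abs_abs_sub_abs_le_abs_sub (φ n x) (h x)
          simp only [hψ, Real.norm_eq_abs]
          calc |(|φ n x|) + 1 / ((n : ℝ) + 1) * Real.exp (-1 * x ^ 2) - h x|
              = |(|φ n x| - h x) + 1 / ((n : ℝ) + 1) * Real.exp (-1 * x ^ 2)| := by ring_nf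
            _ ≤ |(|φ n x| - h x)| + |1 / ((n : ℝ) + 1) * Real.exp (-1 * x ^ 2)| := abs_add_le _ _
            _ ≤ _ := by rw [abs_of_pos hq]; gcongr
      _ = (∫ x, ‖h x - φ n x‖) + 1 / ((n : ℝ) + 1) * ∫ x, Real.exp (-1 * x ^ 2) := by
          have h1 : Integrable fun x => ‖h x - φ n x‖ := (hi.sub (hφi n)).norm
          rw [integral_add h1 (hg.const_mul _), integral_const_mul]
      _ ≤ _ := by gcongr; exact hφ n
  have hL1' : Tendsto (fun n => eLpNorm (ψ n - h) 1 volume) atTop (𝓝 0) := by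
    have : ∀ n, eLpNorm (ψ n - h) 1 volume = ENNReal.ofReal (∫ x, ‖ψ n x - h x‖) := fun n => by
      rw [eLpNorm_one_eq_lintegral_enorm, ← ofReal_integral_norm_eq_lintegral_enorm
        ((hψi n).sub hi)]
      rfl
    simp only [this]
    simpa using ENNReal.tendsto_ofReal hL1
  obtain ⟨ns, hns, hae⟩ := (tendstoInMeasure_of_tendsto_eLpNorm one_ne_zero
    (fun n => (hψi n).aestronglyMeasurable) hi.aestronglyMeasurable hL1').exists_seq_tendsto_ae
  refine ⟨fun n => ψ (ns n), fun n => ⟨hψc _, hψp _, hψi _⟩, hae, ?_⟩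
  have hint : Tendsto (fun n => ∫ x, ψ n x) atTop (𝓝 (∫ x, h x)) :=
    tendsto_integral_of_L1' h hi.aestronglyMeasurable (Eventually.of_forall hψi) hL1'
  have := ENNReal.tendsto_ofReal (hint.comp hns.tendsto_atTop)
  rw [ofReal_integral_eq_lintegral_ofReal hi (Eventually.of_forall hn)] at this
  refine this.congr fun n => ?_
  exact ofReal_integral_eq_lintegral_ofReal (hψi _) (Eventually.of_forall fun x => (hψp _ x).le)

/-- Fatou's lemma along the approximating sequence transfers the bound. The condition `C ≠ 0`
settles the case of infinite `∫ h`, where the right side is infinite. -/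
theorem lintegral_mul_rpow_le_of_continuous {F : ℝ → ENNReal} (hF : Measurable F) {κ : ℝ}
    (hκ : 0 < κ) {C : ENNReal} (hC : C ≠ 0) (hC' : C ≠ ⊤)
    (H : ∀ h : ℝ → ℝ, Continuous h → (∀ x, 0 < h x) → Integrable h →
      ∫⁻ x, F x * ENNReal.ofReal (h x) ^ κ ≤ C * (∫⁻ x, ENNReal.ofReal (h x)) ^ κ)
    {h : ℝ → ENNReal} (hm : Measurable h) :
    ∫⁻ x, F x * h x ^ κ ≤ C * (∫⁻ x, h x) ^ κ := by
  by_cases htop : ∫⁻ x, h x = ⊤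
  · simp [htop, ENNReal.top_rpow_of_pos hκ, ENNReal.mul_top hC]
  have hfin := ae_lt_top hm htop
  have hae : ∀ᵐ x, ENNReal.ofReal (h x).toReal = h x := by
    filter_upwards [hfin] with x hx using ENNReal.ofReal_toReal hx.ne
  have hi : Integrable (fun x => (h x).toReal) := integrable_toReal_of_lintegral_ne_top
    hm.aemeasurable htop
  obtain ⟨ψ, hψ, hlim, hint⟩ := exists_seq_continuous_pos_tendsto hi
    (fun x => ENNReal.toReal_nonneg)
  rw [lintegral_congr_ae hae] at hint
  calc ∫⁻ x, F x * h x ^ κ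
      ≤ ∫⁻ x, liminf (fun n => F x * ENNReal.ofReal (ψ n x) ^ κ) atTop := by
        refine lintegral_mono_ae ?_
        filter_upwards [hlim, hae] with x hx hx'
        have h1 : Tendsto (fun n => ENNReal.ofReal (ψ n x) ^ κ) atTop (𝓝 (h x ^ κ)) := by
          have := ENNReal.tendsto_ofReal hx
          rw [hx'] at this
          exact (ENNReal.continuous_rpow_const.tendsto _).comp this
        -- `F x` may be infinite, and then multiplication by it is continuous only at a nonzero
        -- limit; at a zero limit the left side is zero.
        by_cases h0 : h x ^ κ = 0
        · simp [h0]
        · exact (ENNReal.Tendsto.const_mul h1 (Or.inl h0)).liminf_eq.ge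
    _ ≤ liminf (fun n => ∫⁻ x, F x * ENNReal.ofReal (ψ n x) ^ κ) atTop :=
        lintegral_liminf_le fun n => hF.mul ((hψ n).1.measurable.ennreal_ofReal.pow_const _)
    _ ≤ liminf (fun n => C * (∫⁻ x, ENNReal.ofReal (ψ n x)) ^ κ) atTop :=
        liminf_le_liminf (Eventually.of_forall fun n => H _ (hψ n).1 (hψ n).2.1 (hψ n).2.2)
    _ = C * (∫⁻ x, h x) ^ κ := by
        refine (ENNReal.Tendsto.const_mul
          ((ENNReal.continuous_rpow_const.tendsto _).comp hint) (Or.inr hC')).liminf_eq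

end Density

/-! ### Tensorisation of the regularised inequality -/

section Tensor

theorem lintegral_lintegral_comp_add {E : Type*} [AddCommGroup E] [MeasurableSpace E]
    [MeasurableAdd₂ E] [MeasurableSub₂ E] {ν : Measure E} [SFinite ν] [ν.IsAddRightInvariant]
    {a b h : E → ENNReal} (ha : Measurable a) (hb : Measurable b) (hh : Measurable h) :
    ∫⁻ x, ∫⁻ y, a x * b y * h (x + y) ∂ν ∂ν = ∫⁻ z, (∫⁻ x, a x * b (z - x) ∂ν) * h z ∂ν := by
  have h1 : ∀ x, ∫⁻ y, a x * b y * h (x + y) ∂ν = ∫⁻ z, a x * b (z - x) * h z ∂ν := by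
    intro x
    rw [← lintegral_add_right_eq_self (fun z => a x * b (z - x) * h z) x]
    simp [add_comm x]
  simp only [h1]
  rw [lintegral_lintegral_swap (by fun_prop)]
  refine lintegral_congr fun z => ?_
  rw [lintegral_mul_const _ (by fun_prop)]

theorem youngConst_pos {b₁ b₂ b₃ : ℝ} (hb₁ : 0 < b₁) (hb₂ : 0 < b₂) (hb₃ : 0 < b₃)
    (hb : b₁ + b₂ + b₃ = 1) {lam : ℝ} (hlam : 0 < lam) : 0 < youngConst b₁ b₂ b₃ lam := by
  have : 0 < 1 - b₃ := by linarith
  unfold youngConst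
  positivity

/-- Both sides are homogeneous of degree `α_j` in `μ_j`, so probability measures suffice. After the
substitution `z = x + y` the form is linear in `h ^ (1 - b₃)`, as the density argument requires. -/
theorem regularizedYoung_line {b₁ b₂ b₃ : ℝ} (hb₁ : 0 < b₁) (hb₂ : 0 < b₂) (hb₃ : 0 < b₃)
    (hb : b₁ + b₂ + b₃ = 1) {lam α₁ α₂ : ℝ} (hlam : 0 < lam) (hα₁ : 1 - b₁ ≤ α₁)
    (hα₂ : 1 - b₂ ≤ α₂) :
    RegularizedYoung ℝ (fun x => x ^ 2) (lam / (α₁ * b₁)) (lam / (α₂ * b₂)) α₁ α₂ (1 - b₃)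
      (ENNReal.ofReal (youngConst b₁ b₂ b₃ lam)) := by
  intro μ₁ μ₂ _ _ h hm
  have hα₁' : 0 < α₁ := by linarith
  have hα₂' : 0 < α₂ := by linarith
  have hκ : 0 < 1 - b₃ := by linarith
  by_cases h₁ : μ₁ = 0
  · simp [h₁, superpose_zero, ENNReal.zero_rpow_of_pos hα₁']
  by_cases h₂ : μ₂ = 0
  · simp [h₂, superpose_zero, ENNReal.zero_rpow_of_pos hα₂']
  have : NeZero μ₁ := ⟨h₁⟩
  have : NeZero μ₂ := ⟨h₂⟩
  have split : ∀ (A : ℝ) (μ : Measure ℝ) [IsFiniteMeasure μ], μ ≠ 0 → ∀ x,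
      superpose (fun x => x ^ 2) A μ x =
        μ univ * superpose (fun x => x ^ 2) A ((μ univ)⁻¹ • μ) x := by
    intro A μ _ hμ x
    rw [← superpose_smul, smul_smul, ENNReal.mul_inv_cancel (by simpa using hμ)
      (measure_ne_top _ _), one_smul]
  set ν₁ := (μ₁ univ)⁻¹ • μ₁ with hν₁
  set ν₂ := (μ₂ univ)⁻¹ • μ₂ with hν₂
  have : IsProbabilityMeasure ν₁ := isProbabilityMeasureSMul
  have : IsProbabilityMeasure ν₂ := isProbabilityMeasureSMul
  have hq : Measurable fun x : ℝ => x ^ 2 := by fun_prop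
  have hpt : ∀ x y, superpose (fun x => x ^ 2) (lam / (α₁ * b₁)) μ₁ x ^ α₁ *
      superpose (fun x => x ^ 2) (lam / (α₂ * b₂)) μ₂ y ^ α₂ * h (x + y) ^ (1 - b₃) =
      (μ₁ univ ^ α₁ * μ₂ univ ^ α₂) * (superpose (fun x => x ^ 2) (lam / (α₁ * b₁)) ν₁ x ^ α₁ *
      superpose (fun x => x ^ 2) (lam / (α₂ * b₂)) ν₂ y ^ α₂ * h (x + y) ^ (1 - b₃)) := by
    intro x y
    rw [split _ μ₁ h₁, split _ μ₂ h₂, ENNReal.mul_rpow_of_nonneg _ _ hα₁'.le,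
      ENNReal.mul_rpow_of_nonneg _ _ hα₂'.le]
    ring
  have hm₁ := (measurable_superpose hq (lam / (α₁ * b₁)) ν₁).pow_const α₁
  have hm₂ := (measurable_superpose hq (lam / (α₂ * b₂)) ν₂).pow_const α₂
  have hctop : μ₁ univ ^ α₁ * μ₂ univ ^ α₂ ≠ ⊤ := by
    finiteness [hα₁'.le, hα₂'.le]
  simp only [hpt]
  simp_rw [lintegral_const_mul' _ _ hctop]
  rw [lintegral_lintegral_comp_add hm₁ hm₂ (h := fun z => h z ^ (1 - b₃)) (hm.pow_const _)]
  have hF : Measurable fun z => ∫⁻ x, superpose (fun x => x ^ 2) (lam / (α₁ * b₁)) ν₁ x ^ α₁ *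
      superpose (fun x => x ^ 2) (lam / (α₂ * b₂)) ν₂ (z - x) ^ α₂ :=
    Measurable.lintegral_prod_right' (f := fun w : ℝ × ℝ =>
      superpose (fun x => x ^ 2) (lam / (α₁ * b₁)) ν₁ w.2 ^ α₁ *
      superpose (fun x => x ^ 2) (lam / (α₂ * b₂)) ν₂ (w.1 - w.2) ^ α₂)
      ((hm₁.comp measurable_snd).mul (hm₂.comp (measurable_fst.sub measurable_snd)))
  have key := lintegral_mul_rpow_le_of_continuous hF hκ
    (C := ENNReal.ofReal (youngConst b₁ b₂ b₃ lam))
    (by simpa using youngConst_pos hb₁ hb₂ hb₃ hb hlam) ENNReal.ofReal_ne_top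
    (fun k hk hkp hki => by
      have := lintegral_superpose_of_continuous hb₁ hb₂ hb₃ hb hlam hα₁ hα₂ ν₁ ν₂ hk hkp hki
      rwa [lintegral_lintegral_comp_add hm₁ hm₂
        (h := fun z => ENNReal.ofReal (k z) ^ (1 - b₃)) (by fun_prop)] at this) hm
  calc _ ≤ μ₁ univ ^ α₁ * μ₂ univ ^ α₂ * (ENNReal.ofReal (youngConst b₁ b₂ b₃ lam) *
      (∫⁻ x, h x) ^ (1 - b₃)) := by gcongr
    _ = _ := by ring

/-- Superpositions are stable under slicing: for fixed `x` the Gaussian in the first variable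
becomes a weight on `μ`. -/
theorem superpose_prod_apply {E F : Type*} [AddCommGroup E] [MeasurableSpace E] [AddCommGroup F]
    [MeasurableSpace F] [MeasurableSub₂ E] [MeasurableSub₂ F] {q : E → ℝ} {r : F → ℝ}
    (hq : Measurable q) (hr : Measurable r)
    (A : ℝ) (μ : Measure (E × F)) (x : E) (y : F) :
    superpose (fun z : E × F => q z.1 + r z.2) A μ (x, y) =
      superpose r A ((μ.withDensity fun z =>
        ENNReal.ofReal (Real.exp (-A * q (x - z.1)))).map Prod.snd) y := by
  unfold superpose
  rw [lintegral_map (by fun_prop) measurable_snd, lintegral_withDensity_eq_lintegral_mul _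
    (by fun_prop) (by fun_prop)]
  refine lintegral_congr fun z => ?_
  simp only [Pi.mul_apply, Prod.fst_sub, Prod.snd_sub]
  rw [← ENNReal.ofReal_mul (Real.exp_pos _).le, ← Real.exp_add]
  congr 2
  ring

/-- The mass of a slice measure is the superposition of the first marginal, so applying the
inequality on `F` slicewise produces the input for the inequality on `E`. -/
theorem map_snd_withDensity_univ {E F : Type*} [AddCommGroup E] [MeasurableSpace E]
    [MeasurableSpace F] [MeasurableSub₂ E] {q : E → ℝ} (hq : Measurable q)
    (A : ℝ) (μ : Measure (E × F)) (x : E) :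
    ((μ.withDensity fun z => ENNReal.ofReal (Real.exp (-A * q (x - z.1)))).map Prod.snd) univ =
      superpose q A (μ.map Prod.fst) x := by
  rw [Measure.map_apply measurable_snd MeasurableSet.univ, preimage_univ,
    withDensity_apply _ MeasurableSet.univ, Measure.restrict_univ, superpose,
    lintegral_map (by fun_prop) measurable_fst]

instance measurableSub₂_prod {E F : Type*} [AddCommGroup E] [MeasurableSpace E] [AddCommGroup F]
    [MeasurableSpace F] [MeasurableSub₂ E] [MeasurableSub₂ F] : MeasurableSub₂ (E × F) :=
  ⟨by
    have h₁ : Measurable fun p : (E × F) × (E × F) => p.1.1 - p.2.1 := by fun_prop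
    have h₂ : Measurable fun p : (E × F) × (E × F) => p.1.2 - p.2.2 := by fun_prop
    exact h₁.prodMk h₂⟩

instance measurableAdd₂_prod {E F : Type*} [AddCommGroup E] [MeasurableSpace E] [AddCommGroup F]
    [MeasurableSpace F] [MeasurableAdd₂ E] [MeasurableAdd₂ F] : MeasurableAdd₂ (E × F) :=
  ⟨by
    have h₁ : Measurable fun p : (E × F) × (E × F) => p.1.1 + p.2.1 := by fun_prop
    have h₂ : Measurable fun p : (E × F) × (E × F) => p.1.2 + p.2.2 := by fun_prop
    exact h₁.prodMk h₂⟩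

theorem lintegral_prod_lintegral_prod_comp_add {E F : Type*} [AddCommGroup E] [MeasureSpace E]
    [AddCommGroup F] [MeasureSpace F] [MeasurableAdd₂ E] [MeasurableAdd₂ F]
    [SFinite (volume : Measure E)] [SFinite (volume : Measure F)] {a b h : E × F → ENNReal}
    (ha : Measurable a) (hb : Measurable b) (hh : Measurable h) :
    ∫⁻ x, ∫⁻ y, a x * b y * h (x + y) = ∫⁻ x₁ : E, ∫⁻ y₁ : E, ∫⁻ x₂ : F, ∫⁻ y₂ : F,
      a (x₁, x₂) * b (y₁, y₂) * h (x₁ + y₁, x₂ + y₂) := by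
  have hm : Measurable fun x => ∫⁻ y, a x * b y * h (x + y) :=
    Measurable.lintegral_prod_right' (f := fun w : (E × F) × (E × F) =>
      a w.1 * b w.2 * h (w.1 + w.2)) (by fun_prop)
  have h1 : ∀ x, ∫⁻ y, a x * b y * h (x + y) = ∫⁻ y₁ : E, ∫⁻ y₂ : F,
      a x * b (y₁, y₂) * h (x.1 + y₁, x.2 + y₂) := fun x => by
    rw [Measure.volume_eq_prod, lintegral_prod _ (by fun_prop)]
    rfl
  simp only [h1] at hm ⊢
  rw [Measure.volume_eq_prod, lintegral_prod _ hm.aemeasurable]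
  refine lintegral_congr fun x₁ => ?_
  rw [lintegral_lintegral_swap]
  exact (Measurable.lintegral_prod_right' (f := fun w : (F × E) × F =>
      a (x₁, w.1.1) * b (w.1.2, w.2) * h (x₁ + w.1.2, w.1.1 + w.2)) (by fun_prop)).aemeasurable

/-- Tensorisation of the regularised Young inequality. -/
theorem RegularizedYoung.prod {E F : Type*} [AddCommGroup E] [MeasureSpace E] [AddCommGroup F]
    [MeasureSpace F] [MeasurableAdd₂ E] [MeasurableAdd₂ F] [MeasurableSub₂ E] [MeasurableSub₂ F]
    [SFinite (volume : Measure E)] [SFinite (volume : Measure F)]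
    {q : E → ℝ} {r : F → ℝ} (hq : Measurable q) (hr : Measurable r)
    (hq0 : ∀ x, 0 ≤ q x) {A₁ A₂ α₁ α₂ κ : ℝ}
    (hA₁ : 0 ≤ A₁) (hA₂ : 0 ≤ A₂) {C D : ENNReal} (hD : D ≠ ⊤)
    (hE : RegularizedYoung E q A₁ A₂ α₁ α₂ κ C) (hF : RegularizedYoung F r A₁ A₂ α₁ α₂ κ D) :
    RegularizedYoung (E × F) (fun z => q z.1 + r z.2) A₁ A₂ α₁ α₂ κ (C * D) := by
  intro μ₁ μ₂ _ _ h hm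
  have hqr : Measurable fun z : E × F => q z.1 + r z.2 := by fun_prop
  have hm₁ := (measurable_superpose hqr A₁ μ₁).pow_const α₁
  have hm₂ := (measurable_superpose hqr A₂ μ₂).pow_const α₂
  have fin : ∀ (A : ℝ) (_ : 0 ≤ A) (μ : Measure (E × F)) [IsFiniteMeasure μ] (x : E),
      IsFiniteMeasure ((μ.withDensity fun z =>
        ENNReal.ofReal (Real.exp (-A * q (x - z.1)))).map Prod.snd) := by
    intro A hA μ _ x
    have : IsFiniteMeasure (μ.withDensity fun z =>
        ENNReal.ofReal (Real.exp (-A * q (x - z.1)))) := by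
      refine isFiniteMeasure_withDensity (ne_top_of_le_ne_top (measure_ne_top μ univ) ?_)
      calc _ ≤ ∫⁻ _, 1 ∂μ := lintegral_mono fun z => by
            rw [ENNReal.ofReal_le_one, Real.exp_le_one_iff]
            have := mul_nonneg hA (hq0 (x - z.1))
            linarith
        _ = _ := by simp
    infer_instance
  calc ∫⁻ x, ∫⁻ y, superpose (fun z : E × F => q z.1 + r z.2) A₁ μ₁ x ^ α₁ *
        superpose (fun z : E × F => q z.1 + r z.2) A₂ μ₂ y ^ α₂ * h (x + y) ^ κ
      = ∫⁻ x₁ : E, ∫⁻ y₁ : E, ∫⁻ x₂ : F, ∫⁻ y₂ : F,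
        superpose (fun z : E × F => q z.1 + r z.2) A₁ μ₁ (x₁, x₂) ^ α₁ *
        superpose (fun z : E × F => q z.1 + r z.2) A₂ μ₂ (y₁, y₂) ^ α₂ *
          h (x₁ + y₁, x₂ + y₂) ^ κ :=
        lintegral_prod_lintegral_prod_comp_add hm₁ hm₂ (hm.pow_const κ)
    _ ≤ ∫⁻ x₁ : E, ∫⁻ y₁ : E, D * (superpose q A₁ (μ₁.map Prod.fst) x₁ ^ α₁ *
          superpose q A₂ (μ₂.map Prod.fst) y₁ ^ α₂ * (∫⁻ z, h (x₁ + y₁, z)) ^ κ) := by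
        -- With `x₁, y₁` frozen this is the inequality on `F` for the slice measures. What remains
        -- is the form on `E` for the marginals of `μ₁, μ₂` and for the partial integral of `h`.
        refine lintegral_mono fun x₁ => lintegral_mono fun y₁ => ?_
        have := fin A₁ hA₁ μ₁ x₁
        have := fin A₂ hA₂ μ₂ y₁
        simp only [superpose_prod_apply hq hr, ← map_snd_withDensity_univ hq, ← mul_assoc]
        exact hF _ _ (fun z => h (x₁ + y₁, z)) (by fun_prop)
    _ = D * ∫⁻ x₁ : E, ∫⁻ y₁ : E, superpose q A₁ (μ₁.map Prod.fst) x₁ ^ α₁ *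
          superpose q A₂ (μ₂.map Prod.fst) y₁ ^ α₂ * (∫⁻ z, h (x₁ + y₁, z)) ^ κ := by
        simp_rw [lintegral_const_mul' _ _ hD]
    _ ≤ D * (C * (μ₁.map Prod.fst) univ ^ α₁ * (μ₂.map Prod.fst) univ ^ α₂ *
          (∫⁻ x, ∫⁻ z, h (x, z)) ^ κ) := by
        gcongr
        exact hE _ _ (fun x => ∫⁻ z, h (x, z)) hm.lintegral_prod_right'
    _ = _ := by
        rw [Measure.map_apply measurable_fst MeasurableSet.univ, preimage_univ,
          Measure.map_apply measurable_fst MeasurableSet.univ, preimage_univ,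
          Measure.volume_eq_prod, lintegral_prod _ hm.aemeasurable]
        ring

/-- Transport of the regularised Young inequality along a measure preserving isomorphism. -/
theorem RegularizedYoung.congr {E F : Type*} [AddCommGroup E] [MeasureSpace E] [AddCommGroup F]
    [MeasureSpace F] [MeasurableSub₂ E] [MeasurableSub₂ F] [MeasurableAdd₂ E]
    (e : F ≃ᵐ E) (hadd : ∀ x y, e (x + y) = e x + e y)
    (he : MeasurePreserving e) {q : E → ℝ} {r : F → ℝ} (hq : Measurable q)
    (hqr : ∀ x, q (e x) = r x) {A₁ A₂ α₁ α₂ κ : ℝ} {C : ENNReal}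
    (hE : RegularizedYoung E q A₁ A₂ α₁ α₂ κ C) : RegularizedYoung F r A₁ A₂ α₁ α₂ κ C := by
  intro μ₁ μ₂ _ _ h hm
  have hsub : ∀ x y, e (x - y) = e x - e y := fun x y => by
    rw [eq_sub_iff_add_eq, ← hadd, sub_add_cancel]
  have hs : ∀ (A : ℝ) (μ : Measure F) (x : F), superpose r A μ x = superpose q A (μ.map e) (e x) := by
    intro A μ x
    unfold superpose
    rw [lintegral_map (by fun_prop) e.measurable]
    simp only [← hsub, hqr]
  have hfin₁ : IsFiniteMeasure (μ₁.map e) := inferInstance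
  have hfin₂ : IsFiniteMeasure (μ₂.map e) := inferInstance
  have hint : ∀ Φ : E → ENNReal, ∫⁻ x, Φ (e x) = ∫⁻ x, Φ x := fun Φ =>
    he.lintegral_comp_emb e.measurableEmbedding Φ
  have := hE (μ₁.map e) (μ₂.map e) (h ∘ e.symm) (hm.comp e.symm.measurable)
  rw [Measure.map_apply e.measurable MeasurableSet.univ, preimage_univ,
    Measure.map_apply e.measurable MeasurableSet.univ, preimage_univ,
    ← hint (h ∘ e.symm), ← hint] at this
  simp only [Function.comp, e.symm_apply_apply] at this
  refine le_of_eq_of_le (lintegral_congr fun x => ?_) this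
  rw [← hint]
  refine lintegral_congr fun y => ?_
  rw [← hadd, e.symm_apply_apply, hs, hs]

end Tensor

/-! ### The regularised inequality on Euclidean space -/

section Euclidean

theorem regularizedYoung_pi {b₁ b₂ b₃ : ℝ} (hb₁ : 0 < b₁) (hb₂ : 0 < b₂) (hb₃ : 0 < b₃)
    (hb : b₁ + b₂ + b₃ = 1) {lam α₁ α₂ : ℝ} (hlam : 0 < lam) (hα₁ : 1 - b₁ ≤ α₁)
    (hα₂ : 1 - b₂ ≤ α₂) (d : ℕ) :
    RegularizedYoung (Fin d → ℝ) (fun x => ∑ i, x i ^ 2) (lam / (α₁ * b₁)) (lam / (α₂ * b₂)) α₁ α₂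
      (1 - b₃) (ENNReal.ofReal (youngConst b₁ b₂ b₃ lam) ^ d) := by
  have hα₁' : 0 < α₁ := by linarith
  have hα₂' : 0 < α₂ := by linarith
  induction d with
  | zero =>
    intro μ₁ μ₂ _ _ h _
    have hs : ∀ (A : ℝ) (μ : Measure (Fin 0 → ℝ)) (x : Fin 0 → ℝ),
        superpose (fun x => ∑ i, x i ^ 2) A μ x = μ univ := by
      intro A μ x
      simp [superpose]
    have hv : (volume : Measure (Fin 0 → ℝ)) = Measure.dirac default := by
      rw [volume_pi, Measure.pi_of_empty _ default]
    simp only [hs, hv, lintegral_dirac, pow_zero, one_mul]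
    rw [Subsingleton.elim ((default : Fin 0 → ℝ) + default) default]
  | succ n ih =>
    have := RegularizedYoung.prod (E := ℝ) (F := Fin n → ℝ) (q := fun x => x ^ 2)
      (r := fun x => ∑ i, x i ^ 2) (by fun_prop) (by fun_prop) (fun x => sq_nonneg x)
      (by positivity) (by positivity) (by finiteness)
      (regularizedYoung_line hb₁ hb₂ hb₃ hb hlam hα₁ hα₂) ih
    rw [pow_succ']
    refine this.congr (MeasurableEquiv.piFinSuccAbove (fun _ => ℝ) 0) (fun x y => rfl)
      (volume_preserving_piFinSuccAbove (fun _ => ℝ) 0) (by fun_prop) fun x => ?_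
    rw [Fin.sum_univ_succ]
    rfl

theorem regularizedYoung_euclidean {b₁ b₂ b₃ : ℝ} (hb₁ : 0 < b₁) (hb₂ : 0 < b₂) (hb₃ : 0 < b₃)
    (hb : b₁ + b₂ + b₃ = 1) {lam α₁ α₂ : ℝ} (hlam : 0 < lam) (hα₁ : 1 - b₁ ≤ α₁)
    (hα₂ : 1 - b₂ ≤ α₂) (d : ℕ) :
    RegularizedYoung (EuclideanSpace ℝ (Fin d)) (fun x => ‖x‖ ^ 2) (lam / (α₁ * b₁))
      (lam / (α₂ * b₂)) α₁ α₂ (1 - b₃) (ENNReal.ofReal (youngConst b₁ b₂ b₃ lam) ^ d) := by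
  refine (regularizedYoung_pi hb₁ hb₂ hb₃ hb hlam hα₁ hα₂ d).congr
    (MeasurableEquiv.toLp 2 (Fin d → ℝ)).symm (fun x y => rfl)
    (EuclideanSpace.volume_preserving_symm_measurableEquiv_toLp (Fin d)) (by fun_prop) fun x => ?_
  rw [EuclideanSpace.norm_sq_eq]
  simp

end Euclidean

/-! ### Comparison of the trilinear form at two times -/

section SemigroupArgument

theorem norm_sq_div_add_norm_sq_div {E : Type*} [NormedAddCommGroup E] [InnerProductSpace ℝ E]
    {s r : ℝ} (hs : 0 < s) (hr : 0 < r) (x a ξ : E) :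
    ‖x - a‖ ^ 2 / s + ‖ξ - x‖ ^ 2 / r =
      (1 / s + 1 / r) * ‖x - (a + (s / (s + r)) • (ξ - a))‖ ^ 2 + ‖ξ - a‖ ^ 2 / (s + r) := by
  have h1 : ξ - x = (ξ - a) - (x - a) := by abel
  have h2 : x - (a + (s / (s + r)) • (ξ - a)) = (x - a) - (s / (s + r)) • (ξ - a) := by abel
  rw [h1, h2]
  generalize x - a = X
  generalize ξ - a = Y
  rw [norm_sub_sq_real, norm_sub_sq_real, norm_smul, inner_smul_right, real_inner_comm X Y,
    mul_pow, Real.norm_eq_abs, sq_abs]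
  field_simp
  ring

variable {E : Type*} [NormedAddCommGroup E] [InnerProductSpace ℝ E] [FiniteDimensional ℝ E]
  [MeasurableSpace E] [BorelSpace E]

/-- The superposition of translated Gaussians at scale `s`, multiplied by a Gaussian at scale `r`
centred at `ξ`, is again a superposition of translated Gaussians. -/
theorem exists_superpose_mul_exp {s r A : ℝ} (hs : 0 < s) (hr : 0 < r) (hA : 0 ≤ A)
    (μ : Measure E) [IsFiniteMeasure μ] (ξ : E) :
    ∃ ν : Measure E, IsFiniteMeasure ν ∧
      ν univ = superpose (fun x => ‖x‖ ^ 2) (A / (s + r)) μ ξ ∧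
      ∀ x, superpose (fun x => ‖x‖ ^ 2) (A / s) μ x *
        ENNReal.ofReal (Real.exp (-(A / r) * ‖ξ - x‖ ^ 2)) =
        superpose (fun x => ‖x‖ ^ 2) (A * (1 / s + 1 / r)) ν x := by
  -- By `norm_sq_div_add_norm_sq_div`, a Gaussian centred at `a` times one centred at `ξ` is a
  -- Gaussian centred at a weighted mean of `a` and `ξ`, with a constant depending on `ξ - a`. That
  -- constant is the weight `w`, and `m` moves `a` to the mean.
  let w : E → ENNReal := fun a => ENNReal.ofReal (Real.exp (-(A / (s + r)) * ‖ξ - a‖ ^ 2))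
  have hw : Measurable w := by fun_prop
  let m : E → E := fun a => a + (s / (s + r)) • (ξ - a)
  have hm : Measurable m := by fun_prop
  have huniv : ((μ.withDensity w).map m) univ =
      superpose (fun x => ‖x‖ ^ 2) (A / (s + r)) μ ξ := by
    rw [Measure.map_apply hm MeasurableSet.univ, preimage_univ,
      withDensity_apply _ MeasurableSet.univ, Measure.restrict_univ, superpose]
  refine ⟨(μ.withDensity w).map m, ⟨?_⟩, huniv, fun x => ?_⟩
  · rw [huniv]
    calc superpose (fun x => ‖x‖ ^ 2) (A / (s + r)) μ ξ ≤ ∫⁻ _, 1 ∂μ := lintegral_mono fun a => by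
          rw [ENNReal.ofReal_le_one, Real.exp_le_one_iff, neg_mul, Left.neg_nonpos_iff]
          positivity
      _ < ⊤ := by simp
  · unfold superpose
    rw [lintegral_map (by fun_prop) hm, lintegral_withDensity_eq_lintegral_mul _ hw (by fun_prop),
      ← lintegral_mul_const' _ _ ENNReal.ofReal_ne_top]
    refine lintegral_congr fun a => ?_
    simp only [Pi.mul_apply, w, m]
    rw [← ENNReal.ofReal_mul (Real.exp_pos _).le, ← ENNReal.ofReal_mul (Real.exp_pos _).le,
      ← Real.exp_add, ← Real.exp_add]
    congr 2
    have := norm_sq_div_add_norm_sq_div hs hr x a ξ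
    linear_combination (-A) * this

/-- The trilinear form of the regularised Young inequality. -/
noncomputable def trilinear (A₁ A₂ α₁ α₂ κ : ℝ) (μ₁ μ₂ : Measure E) (h : E → ENNReal) : ENNReal :=
  ∫⁻ x, ∫⁻ y, superpose (fun x => ‖x‖ ^ 2) A₁ μ₁ x ^ α₁ *
    superpose (fun x => ‖x‖ ^ 2) A₂ μ₂ y ^ α₂ * h (x + y) ^ κ

/-- The mass of the Gaussian `K` on the left turns the form into `∫∫ F(u) K(v - u)`. Since `K`
splits into Gaussians raised to the powers `α₁`, `α₂`, `1 - b₃`, these can be absorbed into the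
three bases for each fixed `v = (ξ, η)`. The first two bases stay superpositions, with masses equal
to the superpositions of time `s + r` at `ξ` and `η`. Applying `H` for every `v` and integrating
gives the form at time `s + r`, with `h` convolved with a Gaussian. -/
theorem trilinear_mul_le {b₁ b₂ b₃ : ℝ} (hb₁ : 0 < b₁) (hb₂ : 0 < b₂)
    (hb₃ : 0 < b₃) (hb : b₁ + b₂ + b₃ = 1) {c α₁ α₂ : ℝ} (hc : 0 < c) (hα₁ : 0 < α₁)
    (hα₂ : 0 < α₂) {s r : ℝ} (hs : 0 < s) (hr : 0 < r) {C : ENNReal} (hC : C ≠ ⊤)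
    (H : RegularizedYoung E (fun x => ‖x‖ ^ 2) ((c / (α₁ * b₁)) * (1 / s + 1 / r))
      ((c / (α₂ * b₂)) * (1 / s + 1 / r)) α₁ α₂ (1 - b₃) C)
    (μ₁ μ₂ : Measure E) [IsFiniteMeasure μ₁] [IsFiniteMeasure μ₂] {h : E → ENNReal}
    (hm : Measurable h) :
    trilinear ((c / (α₁ * b₁)) / s) ((c / (α₂ * b₂)) / s) α₁ α₂ (1 - b₃) μ₁ μ₂ h *
      ENNReal.ofReal (((Real.pi / (c / r)) ^ 2 * (b₁ * b₂ * b₃)) ^ (Module.finrank ℝ E / 2 : ℝ)) ≤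
    C * trilinear ((c / (α₁ * b₁)) / (s + r)) ((c / (α₂ * b₂)) / (s + r)) α₁ α₂ (1 - b₃) μ₁ μ₂
      (fun z => ∫⁻ y, h y * ENNReal.ofReal (Real.exp (-(c / ((1 - b₃) * b₃) / r) * ‖z - y‖ ^ 2))) :=
  by
  have hκ : 0 < 1 - b₃ := by linarith
  have hq : Measurable fun x : E => ‖x‖ ^ 2 := by fun_prop
  have hm₁ := (measurable_superpose hq ((c / (α₁ * b₁)) / s) μ₁).pow_const α₁
  have hm₂ := (measurable_superpose hq ((c / (α₂ * b₂)) / s) μ₂).pow_const α₂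
  let F : E × E → ENNReal := fun w => superpose (fun x => ‖x‖ ^ 2) ((c / (α₁ * b₁)) / s) μ₁ w.1 ^ α₁ *
    superpose (fun x => ‖x‖ ^ 2) ((c / (α₂ * b₂)) / s) μ₂ w.2 ^ α₂ * h (w.1 + w.2) ^ (1 - b₃)
  have hF : Measurable F := ((hm₁.comp measurable_fst).mul (hm₂.comp measurable_snd)).mul
    ((hm.comp (measurable_fst.add measurable_snd)).pow_const _)
  let K : E × E → ENNReal := fun w => ENNReal.ofReal
    (Real.exp (-(c / r) * (‖w.1‖ ^ 2 / b₁ + ‖w.2‖ ^ 2 / b₂ + ‖w.1 + w.2‖ ^ 2 / b₃)))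
  have hK : Measurable K := by fun_prop
  have hKint : ∫⁻ v, K v = ENNReal.ofReal
      (((Real.pi / (c / r)) ^ 2 * (b₁ * b₂ * b₃)) ^ (Module.finrank ℝ E / 2 : ℝ)) := by
    rw [← lintegral_lintegral_exp_quadratic (E := E) hb₁ hb₂ hb₃ hb (div_pos hc hr),
      Measure.volume_eq_prod, lintegral_prod _ hK.aemeasurable]
  have hT : trilinear ((c / (α₁ * b₁)) / s) ((c / (α₂ * b₂)) / s) α₁ α₂ (1 - b₃) μ₁ μ₂ h =
      ∫⁻ w, F w := by
    rw [Measure.volume_eq_prod, lintegral_prod _ hF.aemeasurable]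
    rfl
  have hsplit : ∀ u v : E × E, F u * K (v - u) =
      (superpose (fun x => ‖x‖ ^ 2) ((c / (α₁ * b₁)) / s) μ₁ u.1 *
        ENNReal.ofReal (Real.exp (-((c / (α₁ * b₁)) / r) * ‖v.1 - u.1‖ ^ 2))) ^ α₁ *
      (superpose (fun x => ‖x‖ ^ 2) ((c / (α₂ * b₂)) / s) μ₂ u.2 *
        ENNReal.ofReal (Real.exp (-((c / (α₂ * b₂)) / r) * ‖v.2 - u.2‖ ^ 2))) ^ α₂ *
      (h (u.1 + u.2) * ENNReal.ofReal (Real.exp (-(c / ((1 - b₃) * b₃) / r) *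
        ‖v.1 + v.2 - (u.1 + u.2)‖ ^ 2))) ^ (1 - b₃) := by
    intro u v
    have hKs : K (v - u) =
        ENNReal.ofReal (Real.exp (-((c / (α₁ * b₁)) / r) * ‖v.1 - u.1‖ ^ 2)) ^ α₁ *
        ENNReal.ofReal (Real.exp (-((c / (α₂ * b₂)) / r) * ‖v.2 - u.2‖ ^ 2)) ^ α₂ *
        ENNReal.ofReal (Real.exp (-(c / ((1 - b₃) * b₃) / r) *
          ‖v.1 + v.2 - (u.1 + u.2)‖ ^ 2)) ^ (1 - b₃) := by
      rw [ENNReal.ofReal_rpow_of_pos (Real.exp_pos _), ENNReal.ofReal_rpow_of_pos (Real.exp_pos _),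
        ENNReal.ofReal_rpow_of_pos (Real.exp_pos _), ← Real.exp_mul, ← Real.exp_mul,
        ← Real.exp_mul, ← ENNReal.ofReal_mul (Real.exp_pos _).le, ← Real.exp_add,
        ← ENNReal.ofReal_mul (Real.exp_pos _).le, ← Real.exp_add]
      simp only [K, Prod.fst_sub, Prod.snd_sub]
      rw [show v.1 - u.1 + (v.2 - u.2) = v.1 + v.2 - (u.1 + u.2) by abel]
      congr 2
      field_simp
      ring
    rw [hKs, ENNReal.mul_rpow_of_nonneg _ _ hα₁.le, ENNReal.mul_rpow_of_nonneg _ _ hα₂.le,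
      ENNReal.mul_rpow_of_nonneg _ _ hκ.le]
    simp only [F]
    ring
  have hFK : Measurable fun w : (E × E) × (E × E) => F w.1 * K (w.2 - w.1) :=
    (hF.comp measurable_fst).mul (hK.comp (measurable_snd.sub measurable_fst))
  calc _ = ∫⁻ u, ∫⁻ v, F u * K (v - u) := by
        have : (volume : Measure (E × E)).IsAddRightInvariant := by
          rw [Measure.volume_eq_prod]
          infer_instance
        rw [hT, ← lintegral_mul_const _ hF, ← hKint]
        refine lintegral_congr fun u => ?_
        rw [lintegral_const_mul (F u) (f := fun v => K (v - u))
          (hK.comp (measurable_id.sub_const u)), lintegral_sub_right_eq_self K u]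
    _ = ∫⁻ v, ∫⁻ u, F u * K (v - u) := lintegral_lintegral_swap hFK.aemeasurable
    _ = ∫⁻ ξ, ∫⁻ η, ∫⁻ x, ∫⁻ y, F (x, y) * K ((ξ, η) - (x, y)) := by
        rw [Measure.volume_eq_prod, lintegral_prod]
        · refine lintegral_congr fun ξ => lintegral_congr fun η => ?_
          rw [lintegral_prod]
          exact (hF.mul (hK.comp (measurable_const.sub measurable_id))).aemeasurable
        · exact (Measurable.lintegral_prod_left' hFK).aemeasurable
    _ ≤ ∫⁻ ξ, ∫⁻ η, C * (superpose (fun x => ‖x‖ ^ 2) ((c / (α₁ * b₁)) / (s + r)) μ₁ ξ ^ α₁ *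
          superpose (fun x => ‖x‖ ^ 2) ((c / (α₂ * b₂)) / (s + r)) μ₂ η ^ α₂ *
          (∫⁻ y, h y * ENNReal.ofReal (Real.exp (-(c / ((1 - b₃) * b₃) / r) *
            ‖ξ + η - y‖ ^ 2))) ^ (1 - b₃)) := by
        refine lintegral_mono fun ξ => lintegral_mono fun η => ?_
        obtain ⟨ν₁, _, hν₁, e₁⟩ := exists_superpose_mul_exp hs hr
          (A := c / (α₁ * b₁)) (by positivity) μ₁ ξ
        obtain ⟨ν₂, _, hν₂, e₂⟩ := exists_superpose_mul_exp hs hr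
          (A := c / (α₂ * b₂)) (by positivity) μ₂ η
        simp only [hsplit, e₁, e₂]
        refine (H ν₁ ν₂ (fun z => h z * ENNReal.ofReal
          (Real.exp (-(c / ((1 - b₃) * b₃) / r) * ‖ξ + η - z‖ ^ 2))) (by fun_prop)).trans_eq ?_
        rw [hν₁, hν₂]
        ring
    _ = _ := by
        simp_rw [lintegral_const_mul' _ _ hC]
        rfl

end SemigroupArgument

/-! ### Duality for `Lᵖ` norms -/

section Duality

/-- The extremal test function is `h = F ^ p`. It is truncated both in size and to a set of finite
measure, so that `∫ h` is finite and a power of it can be cancelled; monotone convergence removes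
the truncation. At `p = 1` the exponent `1 - 1 / p` is zero and the argument is unchanged. -/
theorem lintegral_rpow_le_of_forall_lintegral_mul_le {X : Type*} [MeasurableSpace X]
    {ν : Measure X} [SigmaFinite ν] {F : X → ENNReal} (hF : Measurable F) {p : ℝ} (hp : 1 ≤ p)
    {C : ENNReal} (H : ∀ h : X → ENNReal, Measurable h →
      ∫⁻ x, F x * h x ^ (1 - 1 / p) ∂ν ≤ C * (∫⁻ x, h x ∂ν) ^ (1 - 1 / p)) :
    (∫⁻ x, F x ^ p ∂ν) ^ (1 / p) ≤ C := by
  have hp0 : 0 < p := by linarith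
  have hκ : 0 ≤ 1 - 1 / p := by
    rw [sub_nonneg, div_le_one hp0]; exact hp
  let h : ℕ → X → ENNReal := fun k =>
    (spanningSets ν k).indicator fun x => (min (F x) k) ^ p
  have hm : ∀ k, Measurable (h k) := fun k =>
    ((hF.min measurable_const).pow_const p).indicator (measurableSet_spanningSets ν k)
  have hle : ∀ k x, h k x ≤ F x * h k x ^ (1 - 1 / p) := by
    intro k x
    by_cases hx : x ∈ spanningSets ν k
    · simp only [h, indicator_of_mem hx]
      rw [← ENNReal.rpow_mul, show p * (1 - 1 / p) = p - 1 by field_simp]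
      calc min (F x) (k : ENNReal) ^ p = min (F x) (k : ENNReal) ^ (1 + (p - 1)) := by ring_nf
        _ = min (F x) (k : ENNReal) * min (F x) (k : ENNReal) ^ (p - 1) := by
          rw [ENNReal.rpow_add_of_nonneg _ _ zero_le_one (by linarith), ENNReal.rpow_one]
        _ ≤ _ := by gcongr; exact min_le_left _ _
    · simp [h, indicator_of_notMem hx]
  have hfin : ∀ k, ∫⁻ x, h k x ∂ν ≠ ⊤ := by
    intro k
    refine ne_top_of_le_ne_top (b := (k : ENNReal) ^ p * ν (spanningSets ν k)) ?_ ?_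
    · exact ENNReal.mul_ne_top (ENNReal.rpow_ne_top_of_nonneg hp0.le (by simp))
        (measure_spanningSets_lt_top ν k).ne
    · rw [lintegral_indicator (measurableSet_spanningSets ν k), ← setLIntegral_const]
      refine lintegral_mono fun x => ?_
      gcongr
      exact min_le_right _ _
  have hb : ∀ k, ∫⁻ x, h k x ∂ν ≤ C ^ p := by
    intro k
    set I := ∫⁻ x, h k x ∂ν with hI
    by_cases h0 : I = 0
    · simp [h0]
    have h1 : I ≤ C * I ^ (1 - 1 / p) := (lintegral_mono (hle k)).trans (H _ (hm k))
    have h2 : I ^ (1 / p) * I ^ (1 - 1 / p) = I := by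
      rw [← ENNReal.rpow_add _ _ h0 (hfin k)]
      simp
    have h3 : I ^ (1 - 1 / p) ≠ 0 := (ENNReal.rpow_pos (pos_iff_ne_zero.2 h0) (hfin k)).ne'
    have h4 : I ^ (1 - 1 / p) ≠ ⊤ := ENNReal.rpow_ne_top_of_nonneg hκ (hfin k)
    have h5 : I ^ (1 / p) ≤ C := by
      rw [← ENNReal.mul_le_mul_iff_left h3 h4, h2]
      exact h1
    calc I = (I ^ (1 / p)) ^ p := by
          rw [← ENNReal.rpow_mul, one_div_mul_cancel hp0.ne', ENNReal.rpow_one]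
      _ ≤ C ^ p := by gcongr
  have hmono : Monotone h := by
    intro k l hkl x
    by_cases hx : x ∈ spanningSets ν k
    · have hx' := monotone_spanningSets ν hkl hx
      simp only [h, indicator_of_mem hx, indicator_of_mem hx']
      gcongr
    · simp [h, indicator_of_notMem hx]
  have hsup : ∀ x, F x ^ p = ⨆ k, h k x := by
    intro x
    have h1 : Tendsto (fun k : ℕ => min (F x) (k : ENNReal)) atTop (𝓝 (F x)) := by
      simpa using (tendsto_const_nhds (x := F x)).min ENNReal.tendsto_nat_nhds_top
    have h2 : Tendsto (fun k => h k x) atTop (𝓝 (F x ^ p)) := by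
      refine ((ENNReal.continuous_rpow_const.tendsto _).comp h1).congr' ?_
      filter_upwards [eventually_ge_atTop (spanningSetsIndex ν x)] with k hk
      simp only [h, Function.comp]
      rw [indicator_of_mem (monotone_spanningSets ν hk (mem_spanningSetsIndex ν x))]
    exact tendsto_nhds_unique h2 (tendsto_atTop_iSup fun k l hkl => hmono hkl x)
  have : ∫⁻ x, F x ^ p ∂ν ≤ C ^ p := by
    simp only [hsup]
    rw [lintegral_iSup hm hmono]
    exact iSup_le hb
  calc (∫⁻ x, F x ^ p ∂ν) ^ (1 / p) ≤ (C ^ p) ^ (1 / p) := by gcongr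
    _ = C := by rw [← ENNReal.rpow_mul, mul_one_div_cancel hp0.ne', ENNReal.rpow_one]

theorem lintegral_mul_rpow_le {X : Type*} [MeasurableSpace X]
    {ν : Measure X} {F h : X → ENNReal} (hF : Measurable F) (hh : Measurable h) {p : ℝ}
    (hp : 1 < p) : ∫⁻ x, F x * h x ^ (1 - 1 / p) ∂ν ≤
      (∫⁻ x, F x ^ p ∂ν) ^ (1 / p) * (∫⁻ x, h x ∂ν) ^ (1 - 1 / p) := by
  have hpq := Real.HolderConjugate.conjExponent hp
  have := ENNReal.lintegral_mul_le_Lp_mul_Lq ν hpq hF.aemeasurable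
    (hh.pow_const (1 - 1 / p)).aemeasurable
  have hq : 1 - 1 / p = 1 / p.conjExponent := by
    have := hpq.inv_add_inv_eq_one
    rw [one_div, one_div]; linarith
  have h1 : ∀ x, (h x ^ (1 - 1 / p)) ^ p.conjExponent = h x := fun x => by
    rw [← ENNReal.rpow_mul, hq, one_div_mul_cancel hpq.symm.ne_zero, ENNReal.rpow_one]
  simp only [h1] at this
  rw [← hq] at this
  exact this

end Duality

/-! ### Monotonicity and finiteness for superpositions -/

section Monotonicity

variable {E : Type*} [NormedAddCommGroup E] [InnerProductSpace ℝ E] [FiniteDimensional ℝ E]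
  [MeasurableSpace E] [BorelSpace E]

/-- The convolution of the powers of two superpositions of Gaussians. -/
noncomputable def superposeConv (A₁ A₂ α₁ α₂ : ℝ) (μ₁ μ₂ : Measure E) (z : E) : ENNReal :=
  ∫⁻ x, superpose (fun x => ‖x‖ ^ 2) A₁ μ₁ x ^ α₁ *
    superpose (fun x => ‖x‖ ^ 2) A₂ μ₂ (z - x) ^ α₂

theorem measurable_superposeConv (A₁ A₂ α₁ α₂ : ℝ) (μ₁ μ₂ : Measure E) [SFinite μ₁] [SFinite μ₂] :
    Measurable (superposeConv A₁ A₂ α₁ α₂ μ₁ μ₂) := by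
  have hq : Measurable fun x : E => ‖x‖ ^ 2 := by fun_prop
  have hm₁ := (measurable_superpose hq A₁ μ₁).pow_const α₁
  have hm₂ := (measurable_superpose hq A₂ μ₂).pow_const α₂
  exact Measurable.lintegral_prod_right' (f := fun w : E × E =>
    superpose (fun x => ‖x‖ ^ 2) A₁ μ₁ w.2 ^ α₁ *
    superpose (fun x => ‖x‖ ^ 2) A₂ μ₂ (w.1 - w.2) ^ α₂)
    ((hm₁.comp measurable_snd).mul (hm₂.comp (measurable_fst.sub measurable_snd)))

theorem trilinear_eq_lintegral_superposeConv (A₁ A₂ α₁ α₂ κ : ℝ) (μ₁ μ₂ : Measure E) [SFinite μ₁]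
    [SFinite μ₂] {h : E → ENNReal} (hm : Measurable h) :
    trilinear A₁ A₂ α₁ α₂ κ μ₁ μ₂ h = ∫⁻ z, superposeConv A₁ A₂ α₁ α₂ μ₁ μ₂ z * h z ^ κ := by
  have hq : Measurable fun x : E => ‖x‖ ^ 2 := by fun_prop
  exact lintegral_lintegral_comp_add ((measurable_superpose hq A₁ μ₁).pow_const α₁)
    ((measurable_superpose hq A₂ μ₂).pow_const α₂) (hm.pow_const κ)

/-- At `lam = c (1 / s + 1 / r)` one has `π / lam = (s / (s + r)) (π r / c)`. The constants in the
`b_j` cancel between the two sides, and only a power of `s / (s + r)` survives: `d` from the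
numerator of `youngConst` less `d (1 - b₃) / 2` from its denominator. -/
theorem youngConst_pow_mul {b₁ b₂ b₃ : ℝ} (hb₁ : 0 < b₁) (hb₂ : 0 < b₂) (hb₃ : 0 < b₃)
    (hb : b₁ + b₂ + b₃ = 1) {c s r : ℝ} (hc : 0 < c) (hs : 0 < s) (hr : 0 < r) (d : ℕ) :
    youngConst b₁ b₂ b₃ (c * (1 / s + 1 / r)) ^ d *
        ((Real.pi / (c / ((1 - b₃) * b₃) / r)) ^ (d / 2 : ℝ)) ^ (1 - b₃) =
      (s / (s + r)) ^ (d * (1 + b₃) / 2) *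
        ((Real.pi / (c / r)) ^ 2 * (b₁ * b₂ * b₃)) ^ (d / 2 : ℝ) := by
  have hκ : 0 < 1 - b₃ := by linarith
  set X := (Real.pi / (c / r)) ^ 2 * (b₁ * b₂ * b₃) with hX
  set g := Real.pi / (c / ((1 - b₃) * b₃) / r) with hg
  set u := s / (s + r) with hu
  have pX : 0 < X := by positivity
  have pg : 0 < g := by positivity
  have pu : 0 < u := by positivity
  have e₁ : (Real.pi / (c * (1 / s + 1 / r))) ^ 2 * (b₁ * b₂ * b₃) = u ^ (2 : ℝ) * X := by
    rw [hX, hu, Real.rpow_two]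
    field_simp
    ring
  have e₂ : Real.pi / (c * (1 / s + 1 / r) / ((1 - b₃) * b₃)) = u * g := by
    rw [hg, hu]
    field_simp
    ring
  clear_value X g u
  have a₁ : (u ^ (2 : ℝ) * X) ^ (1 / 2 : ℝ) = u * X ^ (1 / 2 : ℝ) := by
    rw [Real.mul_rpow (by positivity) pX.le, ← Real.rpow_mul pu.le]
    norm_num
  have a₂ : ((u * g) ^ (1 / 2 : ℝ)) ^ (1 - b₃) = u ^ ((1 - b₃) / 2) * g ^ ((1 - b₃) / 2) := by
    rw [← Real.rpow_mul (by positivity), Real.mul_rpow pu.le pg.le]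
    ring_nf
  have a₃ : (X ^ (1 / 2 : ℝ)) ^ d = X ^ (d / 2 : ℝ) := by
    rw [← Real.rpow_natCast, ← Real.rpow_mul pX.le]
    ring_nf
  have a₄ : ∀ v : ℝ, 0 < v → (v ^ ((1 - b₃) / 2)) ^ d = v ^ (d / 2 * (1 - b₃)) := by
    intro v hv
    rw [← Real.rpow_natCast, ← Real.rpow_mul hv.le]
    ring_nf
  rw [youngConst, e₁, e₂, a₁, a₂, div_pow, mul_pow, mul_pow, a₃, a₄ u pu, a₄ g pg,
    ← Real.rpow_mul pg.le, show d * (1 + b₃) / 2 = d - d / 2 * (1 - b₃) by ring, Real.rpow_sub pu,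
    Real.rpow_natCast]
  have := Real.rpow_pos_of_pos pg (d / 2 * (1 - b₃))
  field_simp

/-- Duality at time `s` is followed by `trilinear_mul_le` and by Hölder at time `s + r`. Convolving
`h` with a Gaussian only multiplies its integral by a constant, so the factor `(∫ h)^(1 - 1/p)`
required by duality reappears. -/
theorem lintegral_superposeConv_le {d : ℕ} {p b₁ b₂ : ℝ} (hp : 1 < p) (hb₁ : 0 < b₁) (hb₂ : 0 < b₂)
    (hb : b₁ + b₂ + 1 / p = 1) {c α₁ α₂ : ℝ} (hc : 0 < c) (hα₁ : 1 - b₁ ≤ α₁)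
    (hα₂ : 1 - b₂ ≤ α₂) {s r : ℝ} (hs : 0 < s) (hr : 0 < r)
    (μ₁ μ₂ : Measure (EuclideanSpace ℝ (Fin d))) [IsFiniteMeasure μ₁] [IsFiniteMeasure μ₂] :
    (∫⁻ z, superposeConv (c / (α₁ * b₁) / s) (c / (α₂ * b₂) / s) α₁ α₂ μ₁ μ₂ z ^ p) ^ (1 / p) ≤
      ENNReal.ofReal ((s / (s + r)) ^ (d * (1 + 1 / p) / 2)) *
      (∫⁻ z, superposeConv (c / (α₁ * b₁) / (s + r)) (c / (α₂ * b₂) / (s + r)) α₁ α₂ μ₁ μ₂ z ^ p)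
        ^ (1 / p) := by
  have hp0 : 0 < p := by linarith
  have hb₃ : 0 < 1 / p := by positivity
  have hκ : 0 < 1 - 1 / p := by linarith
  have hα₁' : 0 < α₁ := by linarith
  have hα₂' : 0 < α₂ := by linarith
  set lam := c * (1 / s + 1 / r) with hlam
  have plam : 0 < lam := by positivity
  have H := regularizedYoung_euclidean hb₁ hb₂ hb₃ hb plam hα₁ hα₂ d
  -- The rates are rewritten as `c / (α_j b_j) * (1 / s + 1 / r)`, the rate of a product of
  -- Gaussians at scales `s` and `r`.
  rw [hlam, ← div_mul_eq_mul_div, ← div_mul_eq_mul_div, ← hlam] at H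
  refine lintegral_rpow_le_of_forall_lintegral_mul_le (measurable_superposeConv _ _ _ _ μ₁ μ₂)
    hp.le fun h hm => ?_
  have key := trilinear_mul_le hb₁ hb₂ hb₃ hb hc hα₁' hα₂' hs hr (by finiteness) H μ₁ μ₂ hm
  set g : EuclideanSpace ℝ (Fin d) → EuclideanSpace ℝ (Fin d) → ENNReal := fun z y =>
    h y * ENNReal.ofReal (Real.exp (-(c / ((1 - 1 / p) * (1 / p)) / r) * ‖z - y‖ ^ 2)) with hg
  have hgm : Measurable fun w : EuclideanSpace ℝ (Fin d) × EuclideanSpace ℝ (Fin d) =>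
      g w.1 w.2 := by fun_prop
  have hgi : Measurable fun z => ∫⁻ y, g z y :=
    Measurable.lintegral_prod_right' (f := fun w => g w.1 w.2) hgm
  rw [trilinear_eq_lintegral_superposeConv _ _ _ _ _ _ _ hm,
    trilinear_eq_lintegral_superposeConv _ _ _ _ _ _ _ hgi] at key
  set N := (∫⁻ z, superposeConv (c / (α₁ * b₁) / (s + r)) (c / (α₂ * b₂) / (s + r)) α₁ α₂ μ₁ μ₂ z
    ^ p) ^ (1 / p) with hN
  have hint : ∫⁻ z, ∫⁻ y, g z y = (∫⁻ y, h y) * ENNReal.ofReal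
      ((Real.pi / (c / ((1 - 1 / p) * (1 / p)) / r)) ^ (d / 2 : ℝ)) := by
    rw [lintegral_lintegral_swap hgm.aemeasurable, ← lintegral_mul_const _ hm]
    refine lintegral_congr fun y => ?_
    simp only [hg]
    rw [lintegral_const_mul _ (by fun_prop), lintegral_sub_right_eq_self (fun z => ENNReal.ofReal
      (Real.exp (-(c / ((1 - 1 / p) * (1 / p)) / r) * ‖z‖ ^ 2))) y,
      lintegral_exp_neg_mul_norm_sq (by positivity), finrank_euclideanSpace_fin]
  have hold := lintegral_mul_rpow_le (ν := volume)
    (measurable_superposeConv (c / (α₁ * b₁) / (s + r)) (c / (α₂ * b₂) / (s + r)) α₁ α₂ μ₁ μ₂)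
    hgi hp
  rw [← hN, hint, ENNReal.mul_rpow_of_nonneg _ _ hκ.le,
    ENNReal.ofReal_rpow_of_pos (by positivity)] at hold
  have hX : 0 < ((Real.pi / (c / r)) ^ 2 * (b₁ * b₂ * (1 / p))) ^ (d / 2 : ℝ) := by positivity
  rw [finrank_euclideanSpace_fin] at key
  rw [← ENNReal.mul_le_mul_iff_left (ENNReal.ofReal_pos.2 hX).ne' ENNReal.ofReal_ne_top]
  refine (key.trans (mul_le_mul_right hold _)).trans_eq ?_
  rw [← ENNReal.ofReal_pow (youngConst_pos hb₁ hb₂ hb₃ hb plam).le]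
  have e := congrArg ENNReal.ofReal (youngConst_pow_mul hb₁ hb₂ hb₃ hb hc hs hr d)
  rw [ENNReal.ofReal_mul (pow_nonneg (youngConst_pos hb₁ hb₂ hb₃ hb plam).le _),
    ENNReal.ofReal_mul (by positivity)] at e
  calc _ = (ENNReal.ofReal (youngConst b₁ b₂ (1 / p) lam ^ d) * ENNReal.ofReal
      (((Real.pi / (c / ((1 - 1 / p) * (1 / p)) / r)) ^ (d / 2 : ℝ)) ^ (1 - 1 / p))) *
        (N * (∫⁻ y, h y) ^ (1 - 1 / p)) := by ring
    _ = _ := by rw [e]; ring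

/-- Finiteness of the norm of the convolution. -/
theorem lintegral_superposeConv_lt_top {d : ℕ} {p b₁ b₂ : ℝ} (hp : 1 < p) (hb₁ : 0 < b₁)
    (hb₂ : 0 < b₂) (hb : b₁ + b₂ + 1 / p = 1) {lam α₁ α₂ : ℝ} (hlam : 0 < lam) (hα₁ : 1 - b₁ ≤ α₁)
    (hα₂ : 1 - b₂ ≤ α₂)
    (μ₁ μ₂ : Measure (EuclideanSpace ℝ (Fin d))) [IsFiniteMeasure μ₁] [IsFiniteMeasure μ₂] :
    (∫⁻ z, superposeConv (lam / (α₁ * b₁)) (lam / (α₂ * b₂)) α₁ α₂ μ₁ μ₂ z ^ p) ^ (1 / p) < ⊤ := by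
  have hb₃ : 0 < 1 / p := by positivity
  have hα₁' : 0 < α₁ := by linarith
  have hα₂' : 0 < α₂ := by linarith
  have H := regularizedYoung_euclidean hb₁ hb₂ hb₃ hb hlam hα₁ hα₂ d
  refine lt_of_le_of_lt (lintegral_rpow_le_of_forall_lintegral_mul_le
    (measurable_superposeConv _ _ _ _ μ₁ μ₂) hp.le (C := ENNReal.ofReal
      (youngConst b₁ b₂ (1 / p) lam) ^ d * μ₁ univ ^ α₁ * μ₂ univ ^ α₂) fun h hm => ?_) ?_
  · rw [← trilinear_eq_lintegral_superposeConv _ _ _ _ _ _ _ hm]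
    exact H μ₁ μ₂ h hm
  · finiteness [hα₁'.le, hα₂'.le]

end Monotonicity

/-! ### Integration by parts against compactly supported functions -/

section IntegrationByParts

theorem laplacian_eq_sum_fderiv {E : Type*} [NormedAddCommGroup E] [InnerProductSpace ℝ E]
    [FiniteDimensional ℝ E] {ι : Type*} [Fintype ι] (e : OrthonormalBasis ι ℝ E) (u : E → ℝ)
    (x : E) : Laplacian.laplacian u x = ∑ i, fderiv ℝ (fderiv ℝ u) x (e i) (e i) := by
  rw [InnerProductSpace.laplacian_eq_iteratedFDeriv_orthonormalBasis u e]
  simp [iteratedFDeriv_two_apply]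

variable {E : Type*} [NormedAddCommGroup E] [InnerProductSpace ℝ E] [FiniteDimensional ℝ E]
  [MeasurableSpace E] [BorelSpace E]

theorem integral_fderiv_fderiv_mul {u ψ ψ' ψ'' : E → ℝ} {v : E} (hu : ContDiff ℝ 2 u)
    (h : ∀ x, HasLineDerivAt ℝ ψ (ψ' x) x v) (h' : ∀ x, HasLineDerivAt ℝ ψ' (ψ'' x) x v)
    (c : Continuous ψ) (c' : Continuous ψ') (c'' : Continuous ψ'')
    (s : HasCompactSupport ψ) (s' : HasCompactSupport ψ') (s'' : HasCompactSupport ψ'') :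
    ∫ x, fderiv ℝ (fderiv ℝ u) x v v * ψ x = ∫ x, u x * ψ'' x := by
  have hu1 : ContDiff ℝ 1 (fderiv ℝ u) := hu.fderiv_right (by norm_num)
  have hu2 : Continuous (fderiv ℝ (fderiv ℝ u)) := hu1.continuous_fderiv (by norm_num)
  have d1 : ∀ x, HasLineDerivAt ℝ u (fderiv ℝ u x v) x v := fun x =>
    ((hu.differentiable (by norm_num)) x).hasFDerivAt.hasLineDerivAt v
  have d2 : ∀ x, HasLineDerivAt ℝ (fun y => fderiv ℝ u y v) (fderiv ℝ (fderiv ℝ u) x v v) x v := by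
    intro x
    have := ((hu1.differentiable (by norm_num)) x).hasFDerivAt.clm_apply (hasFDerivAt_const v x)
    simpa using this.hasLineDerivAt v
  have k0 : Continuous u := hu.continuous
  have k1 : Continuous fun x => fderiv ℝ u x v := hu1.continuous.clm_apply continuous_const
  have k2 : Continuous fun x => fderiv ℝ (fderiv ℝ u) x v v :=
    (hu2.clm_apply continuous_const).clm_apply continuous_const
  have int : ∀ {f g : E → ℝ}, Continuous f → Continuous g → HasCompactSupport g →
      Integrable (fun x => f x * g x) := fun hf hg hs =>
    (hf.mul hg).integrable_of_hasCompactSupport hs.mul_left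
  have e1 := integral_bilinear_hasLineDerivAt_right_eq_neg_left_of_integrable (μ := volume)
    (B := ContinuousLinearMap.mul ℝ ℝ)
    (int k2 c s) (int k1 c' s') (int k1 c s) (fun x _ => d2 x) (fun x _ => h x)
  have e2 := integral_bilinear_hasLineDerivAt_right_eq_neg_left_of_integrable (μ := volume)
    (B := ContinuousLinearMap.mul ℝ ℝ)
    (int k1 c' s') (int k0 c'' s'') (int k0 c' s') (fun x _ => d1 x) (fun x _ => h' x)
  simp only [ContinuousLinearMap.mul_apply'] at e1 e2
  rw [e2, e1, neg_neg]

theorem integral_laplacian_mul {ι : Type*} [Fintype ι] (e : OrthonormalBasis ι ℝ E)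
    {u ψ : E → ℝ} {ψ' ψ'' : ι → E → ℝ} (hu : ContDiff ℝ 2 u)
    (h : ∀ i x, HasLineDerivAt ℝ ψ (ψ' i x) x (e i))
    (h' : ∀ i x, HasLineDerivAt ℝ (ψ' i) (ψ'' i x) x (e i))
    (c : Continuous ψ) (c' : ∀ i, Continuous (ψ' i)) (c'' : ∀ i, Continuous (ψ'' i))
    (s : HasCompactSupport ψ) (s' : ∀ i, HasCompactSupport (ψ' i))
    (s'' : ∀ i, HasCompactSupport (ψ'' i)) :
    ∫ x, Laplacian.laplacian u x * ψ x = ∫ x, u x * ∑ i, ψ'' i x := by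
  have hu1 : ContDiff ℝ 1 (fderiv ℝ u) := hu.fderiv_right (by norm_num)
  have hu2 : Continuous (fderiv ℝ (fderiv ℝ u)) := hu1.continuous_fderiv (by norm_num)
  simp only [laplacian_eq_sum_fderiv e, Finset.sum_mul, Finset.mul_sum]
  rw [integral_finsetSum, integral_finsetSum]
  · exact Finset.sum_congr rfl fun i _ => integral_fderiv_fderiv_mul hu (h i) (h' i) c (c' i)
      (c'' i) s (s' i) (s'' i)
  · exact fun i _ => (hu.continuous.mul (c'' i)).integrable_of_hasCompactSupport (s'' i).mul_left
  · exact fun i _ => (((hu2.clm_apply continuous_const).clm_apply continuous_const).mul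
      c).integrable_of_hasCompactSupport s.mul_left

end IntegrationByParts

/-! ### Cutoff functions and truncated plane waves -/

section Cutoff

theorem hasDerivAt_max_zero_pow (n : ℕ) (t : ℝ) :
    HasDerivAt (fun t : ℝ => max t 0 ^ (n + 2)) ((n + 2) * max t 0 ^ (n + 1)) t := by
  rcases lt_trichotomy t 0 with h | rfl | h
  · have h0 : (fun t : ℝ => max t 0 ^ (n + 2)) =ᶠ[𝓝 t] fun _ => 0 := by
      filter_upwards [gt_mem_nhds h] with y hy
      simp [max_eq_right hy.le]
    rw [max_eq_right h.le]
    simpa using (hasDerivAt_const t (0 : ℝ)).congr_of_eventuallyEq h0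
  · have h0 : (fun t : ℝ => max t 0 ^ (n + 2)) =O[𝓝 0] fun x => ‖x - 0‖ ^ (n + 2) := by
      refine Asymptotics.IsBigO.of_bound 1 (Eventually.of_forall fun x => ?_)
      rw [one_mul, sub_zero, norm_pow, norm_pow, norm_norm]
      gcongr
      rw [Real.norm_eq_abs, Real.norm_eq_abs, abs_of_nonneg (le_max_right _ _)]
      exact max_le (le_abs_self x) (abs_nonneg x)
    simpa using (h0.hasFDerivAt (𝕜 := ℝ) (by omega)).hasDerivAt
  · have h0 : (fun t : ℝ => max t 0 ^ (n + 2)) =ᶠ[𝓝 t] fun t => t ^ (n + 2) := by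
      filter_upwards [lt_mem_nhds h] with y hy
      rw [max_eq_left hy.le]
    rw [max_eq_left h.le]
    have := (hasDerivAt_pow (n + 2) t).congr_of_eventuallyEq h0
    simpa using this

variable {E : Type*} [NormedAddCommGroup E]

/-- The truncated paraboloid `(1 - ε² |x|²)₊`, whose powers serve as cutoff functions. -/
noncomputable def cap (ε : ℝ) (x : E) : ℝ := max (1 - ε ^ 2 * ‖x‖ ^ 2) 0

theorem cap_nonneg (ε : ℝ) (x : E) : 0 ≤ cap ε x := le_max_right _ _

theorem cap_le_one (ε : ℝ) (x : E) : cap ε x ≤ 1 :=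
  max_le (by have := mul_nonneg (sq_nonneg ε) (sq_nonneg ‖x‖); linarith) zero_le_one

theorem continuous_cap (ε : ℝ) : Continuous (cap ε : E → ℝ) := by
  unfold cap
  fun_prop

theorem cap_eq_of_pos {ε : ℝ} {x : E} (h : 0 < cap ε x) : cap ε x = 1 - ε ^ 2 * ‖x‖ ^ 2 :=
  max_eq_left (by
    by_contra hc
    rw [cap, max_eq_right (not_le.1 hc).le] at h
    exact lt_irrefl _ h)

theorem hasCompactSupport_of_cap_pow_mul [InnerProductSpace ℝ E] [FiniteDimensional ℝ E] {ε : ℝ} (hε : 0 < ε) {n : ℕ}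
    (hn : n ≠ 0) {f g : E → ℝ} (h : ∀ x, f x = cap ε x ^ n * g x) : HasCompactSupport f := by
  refine HasCompactSupport.intro (isCompact_closedBall (0 : E) (1 / ε)) fun x hx => ?_
  have hx' : 1 / ε < ‖x‖ := by simpa using hx
  rw [div_lt_iff₀ hε] at hx'
  have : cap ε x = 0 := max_eq_right (by nlinarith)
  rw [h, this, zero_pow hn, zero_mul]

theorem tendsto_cap (x : E) : Tendsto (fun n : ℕ => cap (1 / ((n : ℝ) + 1)) x) atTop (𝓝 1) := by
  have h := tendsto_one_div_add_atTop_nhds_zero_nat (𝕜 := ℝ)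
  have := (((h.pow 2).mul_const (‖x‖ ^ 2)).const_sub 1).max (tendsto_const_nhds (x := (0 : ℝ)))
  simpa [cap] using this

/-- The right side is the Laplacian of `cap ε ^ 4` in dimension `d`. On the support `ε²‖x‖² = 1 -
cap ε x`, so the claim is a quadratic inequality in `cap ε x`, settled by completing a square. A
lower bound by a multiple of the cutoff itself allows a Grönwall argument with no prior control of
the mass in time. -/
theorem neg_le_cutoff_laplacian (ε : ℝ) (x : E) (d : ℕ) :
    -(ε ^ 2 * (48 + 8 * d) ^ 2) * cap ε x ^ 4 ≤ 48 * ε ^ 4 * cap ε x ^ 2 * ‖x‖ ^ 2 -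
      8 * ε ^ 2 * cap ε x ^ 3 * d := by
  rcases (cap_nonneg ε x).eq_or_lt with h0 | h0
  · rw [← h0]; simp
  have h1 := cap_eq_of_pos h0
  have h2 : ε ^ 2 * ‖x‖ ^ 2 = 1 - cap ε x := by linarith
  have h3 : 48 * ε ^ 4 * cap ε x ^ 2 * ‖x‖ ^ 2 =
      48 * ε ^ 2 * cap ε x ^ 2 * (1 - cap ε x) := by rw [← h2]; ring
  rw [h3]
  have key : 0 ≤ ε ^ 2 * cap ε x ^ 2 *
      ((48 + 8 * d) ^ 2 * cap ε x ^ 2 - (48 + 8 * d) * cap ε x + 48) := by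
    have : 0 ≤ (48 + 8 * d) ^ 2 * cap ε x ^ 2 - (48 + 8 * d) * cap ε x + 48 := by
      nlinarith [sq_nonneg ((48 + 8 * d) * cap ε x - 1 / 2)]
    positivity
  linarith

variable [InnerProductSpace ℝ E]

theorem hasLineDerivAt_cap_pow (ε : ℝ) (n : ℕ) (x v : E) :
    HasLineDerivAt ℝ (fun x => cap ε x ^ (n + 2))
      ((n + 2) * cap ε x ^ (n + 1) * (-(2 * ε ^ 2 * inner ℝ x v))) x v := by
  have h1 : HasFDerivAt (fun x : E => 1 - ε ^ 2 * ‖x‖ ^ 2)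
      (-(ε ^ 2 • (2 • innerSL ℝ x))) x :=
    ((hasStrictFDerivAt_norm_sq x).hasFDerivAt.const_mul (ε ^ 2)).const_sub 1
  have h2 := (hasDerivAt_max_zero_pow n (1 - ε ^ 2 * ‖x‖ ^ 2)).comp_hasFDerivAt x h1
  have h3 := h2.hasLineDerivAt v
  convert! h3 using 1
  simp [cap]
  left
  ring

theorem hasLineDerivAt_cos_inner (ξ : E) (θ : ℝ) (x v : E) :
    HasLineDerivAt ℝ (fun x => Real.cos (inner ℝ ξ x + θ))
      (-(Real.sin (inner ℝ ξ x + θ) * inner ℝ ξ v)) x v := by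
  have h1 : HasFDerivAt (fun x : E => inner ℝ ξ x + θ) (innerSL ℝ ξ) x :=
    (innerSL ℝ ξ).hasFDerivAt.add_const θ
  have := ((Real.hasDerivAt_cos _).comp_hasFDerivAt x h1).hasLineDerivAt v
  simpa [Function.comp_def] using this

theorem hasLineDerivAt_sin_inner (ξ : E) (θ : ℝ) (x v : E) :
    HasLineDerivAt ℝ (fun x => Real.sin (inner ℝ ξ x + θ))
      (Real.cos (inner ℝ ξ x + θ) * inner ℝ ξ v) x v := by
  have h1 : HasFDerivAt (fun x : E => inner ℝ ξ x + θ) (innerSL ℝ ξ) x :=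
    (innerSL ℝ ξ).hasFDerivAt.add_const θ
  have := ((Real.hasDerivAt_sin _).comp_hasFDerivAt x h1).hasLineDerivAt v
  simpa [Function.comp_def] using this

/-- The truncated plane wave. -/
noncomputable def wave (ε θ : ℝ) (ξ x : E) : ℝ := Real.cos (inner ℝ ξ x + θ) * cap ε x ^ 4

/-- First directional derivatives of `wave`. -/
noncomputable def waveDeriv (ε θ : ℝ) (ξ v x : E) : ℝ :=
  -(Real.sin (inner ℝ ξ x + θ) * inner ℝ ξ v) * cap ε x ^ 4 -
    8 * ε ^ 2 * (Real.cos (inner ℝ ξ x + θ) * (cap ε x ^ 3 * inner ℝ x v))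

/-- Second directional derivatives of `wave`. -/
noncomputable def waveDeriv₂ (ε θ : ℝ) (ξ v x : E) : ℝ :=
  -(Real.cos (inner ℝ ξ x + θ) * inner ℝ ξ v ^ 2) * cap ε x ^ 4 +
    16 * ε ^ 2 * (Real.sin (inner ℝ ξ x + θ) * cap ε x ^ 3 * (inner ℝ ξ v * inner ℝ x v)) +
    Real.cos (inner ℝ ξ x + θ) * (48 * ε ^ 4 * cap ε x ^ 2 * inner ℝ x v ^ 2 -
      8 * ε ^ 2 * cap ε x ^ 3 * ‖v‖ ^ 2)

theorem hasLineDerivAt_mul {f g : E → ℝ} {f' g' : ℝ} {x v : E} (hf : HasLineDerivAt ℝ f f' x v)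
    (hg : HasLineDerivAt ℝ g g' x v) :
    HasLineDerivAt ℝ (fun x => f x * g x) (f' * g x + f x * g') x v := by
  have h := HasDerivAt.fun_mul hf hg
  rw [zero_smul, add_zero] at h
  exact h

theorem hasLineDerivAt_wave (ε θ : ℝ) (ξ v x : E) :
    HasLineDerivAt ℝ (wave ε θ ξ) (waveDeriv ε θ ξ v x) x v := by
  have := hasLineDerivAt_mul (hasLineDerivAt_cos_inner ξ θ x v) (hasLineDerivAt_cap_pow ε 2 x v)
  convert! this using 1
  simp only [waveDeriv]
  push_cast
  ring

theorem hasLineDerivAt_waveDeriv (ε θ : ℝ) (ξ v x : E) :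
    HasLineDerivAt ℝ (waveDeriv ε θ ξ v) (waveDeriv₂ ε θ ξ v x) x v := by
  have hin : HasLineDerivAt ℝ (fun x : E => inner ℝ x v) (‖v‖ ^ 2) x v := by
    have := ((innerSL ℝ v).hasFDerivAt (x := x)).hasLineDerivAt v
    simpa [real_inner_comm, real_inner_self_eq_norm_sq] using this
  have hs := hasLineDerivAt_mul (hasLineDerivAt_sin_inner ξ θ x v) (hasLineDerivAt_cap_pow ε 2 x v)
  have hc := hasLineDerivAt_mul (hasLineDerivAt_cos_inner ξ θ x v)
    (hasLineDerivAt_mul (hasLineDerivAt_cap_pow ε 1 x v) hin)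
  have := (HasDerivAt.const_mul (-inner ℝ ξ v) hs).sub (HasDerivAt.const_mul (8 * ε ^ 2) hc)
  have h2 : HasLineDerivAt ℝ (fun x => -inner ℝ ξ v * (Real.sin (inner ℝ ξ x + θ) * cap ε x ^ 4) -
    8 * ε ^ 2 * (Real.cos (inner ℝ ξ x + θ) * (cap ε x ^ 3 * inner ℝ x v))) _ x v := this
  convert! h2 using 1
  · funext x
    simp only [waveDeriv]
    ring
  · simp only [waveDeriv₂]
    push_cast
    ring

/-- The part of the Laplacian of the truncated plane wave which comes from the truncation. -/
noncomputable def waveError (d : ℕ) (ε θ : ℝ) (ξ x : E) : ℝ :=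
  16 * ε ^ 2 * (Real.sin (inner ℝ ξ x + θ) * cap ε x ^ 3 * inner ℝ ξ x) +
    Real.cos (inner ℝ ξ x + θ) * (48 * ε ^ 4 * cap ε x ^ 2 * ‖x‖ ^ 2 -
      8 * ε ^ 2 * cap ε x ^ 3 * d)

theorem sum_waveDeriv₂ [FiniteDimensional ℝ E] {ι : Type*} [Fintype ι] (e : OrthonormalBasis ι ℝ E)
    (ε θ : ℝ) (ξ x : E) : ∑ i, waveDeriv₂ ε θ ξ (e i) x = -‖ξ‖ ^ 2 * wave ε θ ξ x +
      waveError (Fintype.card ι) ε θ ξ x := by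
  have h1 : ∑ i, inner ℝ ξ (e i) ^ 2 = ‖ξ‖ ^ 2 := by
    rw [← e.sum_sq_norm_inner_left ξ]; simp
  have h2 : ∑ i, inner ℝ x (e i) ^ 2 = ‖x‖ ^ 2 := by
    rw [← e.sum_sq_norm_inner_left x]; simp
  have h3 : ∑ i, inner ℝ ξ (e i) * inner ℝ x (e i) = inner ℝ ξ x := by
    rw [← e.sum_inner_mul_inner ξ x]
    simp [real_inner_comm]
  have h4 : ∑ i, ‖e i‖ ^ 2 = (Fintype.card ι : ℝ) := by simp
  simp only [waveDeriv₂, wave, waveError, Finset.sum_add_distrib, Finset.sum_sub_distrib, ← Finset.mul_sum,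
    ← Finset.sum_mul, Finset.sum_neg_distrib, h1, h2, h3, h4]
  ring

/-- On the support `ε‖x‖ ≤ 1`, which turns each factor `‖x‖` into `1 / ε` and leaves at least one
power of `ε` in every term. -/
theorem abs_wave_error_le [FiniteDimensional ℝ E] {ε : ℝ} (hε : 0 < ε) (hε1 : ε ≤ 1) (θ : ℝ)
    (ξ x : E) (d : ℕ) :
    |waveError d ε θ ξ x| ≤ ε * (16 * ‖ξ‖ + 48 + 8 * d) := by
  rw [waveError]
  rcases (cap_nonneg ε x).eq_or_lt with h0 | h0
  · rw [← h0]
    simp only [ne_eq, OfNat.ofNat_ne_zero, not_false_eq_true, zero_pow, mul_zero, zero_mul, sub_zero,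
      add_zero, abs_zero]
    positivity
  have h1 := cap_eq_of_pos h0
  have h2 := cap_le_one ε x
  have hx2 : ε ^ 2 * ‖x‖ ^ 2 ≤ 1 := by linarith
  have hx : ε * ‖x‖ ≤ 1 := by
    rw [← mul_pow] at hx2
    exact (sq_le_one_iff₀ (by positivity)).1 hx2
  have hs := Real.abs_sin_le_one (inner ℝ ξ x + θ)
  have hc := Real.abs_cos_le_one (inner ℝ ξ x + θ)
  have hin := abs_real_inner_le_norm ξ x
  have c2 : cap ε x ^ 2 ≤ 1 := pow_le_one₀ h0.le h2
  have c3 : cap ε x ^ 3 ≤ 1 := pow_le_one₀ h0.le h2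
  refine (abs_add_le _ _).trans ?_
  have t1 : |16 * ε ^ 2 * (Real.sin (inner ℝ ξ x + θ) * cap ε x ^ 3 * inner ℝ ξ x)| ≤
      16 * ε * ‖ξ‖ := by
    rw [abs_mul (16 * ε ^ 2), abs_mul (_ * _) (inner ℝ ξ x), abs_mul (Real.sin _),
      abs_of_pos (by positivity : 0 < 16 * ε ^ 2),
      abs_of_pos (by positivity : 0 < cap ε x ^ 3)]
    calc 16 * ε ^ 2 * (|Real.sin (inner ℝ ξ x + θ)| * cap ε x ^ 3 * |inner ℝ ξ x|)
        ≤ 16 * ε ^ 2 * (1 * 1 * (‖ξ‖ * ‖x‖)) := by gcongr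
      _ = 16 * ε * ‖ξ‖ * (ε * ‖x‖) := by ring
      _ ≤ 16 * ε * ‖ξ‖ * 1 := by gcongr
      _ = _ := by ring
  have t2 : |Real.cos (inner ℝ ξ x + θ) * (48 * ε ^ 4 * cap ε x ^ 2 * ‖x‖ ^ 2 -
      8 * ε ^ 2 * cap ε x ^ 3 * d)| ≤ ε * (48 + 8 * d) := by
    have e1 : 48 * ε ^ 4 * cap ε x ^ 2 * ‖x‖ ^ 2 ≤ 48 * ε := by
      calc 48 * ε ^ 4 * cap ε x ^ 2 * ‖x‖ ^ 2 = 48 * ε * ε * cap ε x ^ 2 * (ε ^ 2 * ‖x‖ ^ 2) := by ring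
        _ ≤ 48 * ε * 1 * 1 * 1 := by gcongr
        _ = _ := by ring
    have e2 : 8 * ε ^ 2 * cap ε x ^ 3 * d ≤ ε * (8 * d) := by
      calc 8 * ε ^ 2 * cap ε x ^ 3 * d = 8 * ε * ε * cap ε x ^ 3 * d := by ring
        _ ≤ 8 * ε * 1 * 1 * d := by gcongr
        _ = _ := by ring
    have e3 : 0 ≤ 48 * ε ^ 4 * cap ε x ^ 2 * ‖x‖ ^ 2 := by positivity
    have e4 : 0 ≤ 8 * ε ^ 2 * cap ε x ^ 3 * d := by positivity
    rw [abs_mul]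
    calc _ ≤ 1 * |48 * ε ^ 4 * cap ε x ^ 2 * ‖x‖ ^ 2 - 8 * ε ^ 2 * cap ε x ^ 3 * d| := by gcongr
      _ ≤ _ := by
        rw [one_mul, abs_le]
        have : 0 ≤ ε * (8 * d) := by positivity
        constructor <;> linarith
  linarith

end Cutoff

/-! ### Fourier transforms of nonnegative heat solutions -/

section HeatSolution

variable {d : ℕ} {σ : ℝ} {μ : Measure (EuclideanSpace ℝ (Fin d))}
  {u : ℝ → EuclideanSpace ℝ (Fin d) → ℝ}

theorem IsHeatSolution.continuous (h : IsHeatSolution σ μ u) (hσ : σ ≠ 0) {t : ℝ} (ht : 0 < t) :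
    Continuous (u t) := (h.contDiff hσ t ht).continuous

/-- Differentiation under the integral is dominated by the maximum of the Laplacian on the compact
set `[t/2, 2t] × tsupport ψ`. -/
theorem IsHeatSolution.hasDerivAt_integral_mul (h : IsHeatSolution σ μ u) (hσ : σ ≠ 0)
    {ψ : EuclideanSpace ℝ (Fin d) → ℝ} (hψ : Continuous ψ) (hs : HasCompactSupport ψ)
    {t : ℝ} (ht : 0 < t) :
    HasDerivAt (fun s => ∫ x, u s x * ψ x)
      (∫ x, σ / (4 * Real.pi) * Laplacian.laplacian (u t) x * ψ x) t := by
  have hpos : ∀ s ∈ Icc (t / 2) (2 * t), 0 < s := fun s hs => by linarith [hs.1]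
  have hcK : ContinuousOn (fun z : ℝ × EuclideanSpace ℝ (Fin d) =>
      Laplacian.laplacian (u z.1) z.2) (Icc (t / 2) (2 * t) ×ˢ tsupport ψ) :=
    (h.continuousOn_laplacian hσ).mono (prod_mono hpos (subset_univ _))
  obtain ⟨C, hC⟩ := (isCompact_Icc.prod hs.isCompact).exists_bound_of_continuousOn hcK
  have hL : Continuous fun x => Laplacian.laplacian (u t) x := by
    have hpair : Continuous fun x : EuclideanSpace ℝ (Fin d) => (t, x) := by fun_prop
    have hmem : ∀ x : EuclideanSpace ℝ (Fin d), (t, x) ∈ Ioi (0 : ℝ) ×ˢ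
      (univ : Set (EuclideanSpace ℝ (Fin d))) := fun x => ⟨ht, mem_univ _⟩
    have hcomp := ContinuousOn.comp_continuous (h.continuousOn_laplacian hσ) hpair hmem
    exact hcomp
  have m1 : ∀ᶠ s in 𝓝 t, AEStronglyMeasurable (fun x => u s x * ψ x) volume := by
    filter_upwards [lt_mem_nhds ht] with s hs
    exact ((h.continuous hσ hs).mul hψ).aestronglyMeasurable
  have m2 : Integrable (fun x => u t x * ψ x) :=
    ((h.continuous hσ ht).mul hψ).integrable_of_hasCompactSupport hs.mul_left
  have m3 : AEStronglyMeasurable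
      (fun x => σ / (4 * Real.pi) * Laplacian.laplacian (u t) x * ψ x) volume :=
    ((continuous_const.mul hL).mul hψ).aestronglyMeasurable
  have m4 : ∀ᵐ x ∂(volume : Measure (EuclideanSpace ℝ (Fin d))), ∀ s ∈ Icc (t / 2) (2 * t),
      ‖σ / (4 * Real.pi) * Laplacian.laplacian (u s) x * ψ x‖ ≤
        |σ / (4 * Real.pi)| * C * |ψ x| := by
    refine Eventually.of_forall fun x s hs' => ?_
    by_cases hx : x ∈ tsupport ψ
    · rw [norm_mul, norm_mul, Real.norm_eq_abs, Real.norm_eq_abs (ψ x)]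
      exact mul_le_mul_of_nonneg_right (mul_le_mul_of_nonneg_left (hC (s, x) ⟨hs', hx⟩)
        (abs_nonneg _)) (abs_nonneg _)
    · simp [image_eq_zero_of_notMem_tsupport hx]
  have m5 : Integrable (fun x => |σ / (4 * Real.pi)| * C * |ψ x|) :=
    (continuous_const.mul hψ.abs).integrable_of_hasCompactSupport hs.norm.mul_left
  have m6 : ∀ᵐ x ∂(volume : Measure (EuclideanSpace ℝ (Fin d))), ∀ s ∈ Icc (t / 2) (2 * t),
      HasDerivAt (fun s => u s x * ψ x) (σ / (4 * Real.pi) * Laplacian.laplacian (u s) x * ψ x) s :=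
    Eventually.of_forall fun x s hs' => (h.heat_equation s (hpos s hs') x).mul_const _
  exact (hasDerivAt_integral_of_dominated_loc_of_deriv_le
    (Icc_mem_nhds (by linarith) (by linarith)) m1 m2 m3 m4 m5 m6).2

theorem continuous_wave (ε θ : ℝ) (ξ : EuclideanSpace ℝ (Fin d)) : Continuous (wave ε θ ξ) := by
  have := continuous_cap (E := EuclideanSpace ℝ (Fin d)) ε
  unfold wave
  fun_prop

theorem continuous_waveError (ε θ : ℝ) (ξ : EuclideanSpace ℝ (Fin d)) :
    Continuous (waveError d ε θ ξ) := by
  have := continuous_cap (E := EuclideanSpace ℝ (Fin d)) ε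
  unfold waveError
  fun_prop

theorem abs_wave_le (ε θ : ℝ) (ξ x : EuclideanSpace ℝ (Fin d)) : |wave ε θ ξ x| ≤ 1 := by
  rw [wave, abs_mul, abs_of_nonneg (pow_nonneg (cap_nonneg ε x) 4)]
  exact mul_le_one₀ (Real.abs_cos_le_one _) (pow_nonneg (cap_nonneg ε x) 4)
    (pow_le_one₀ (cap_nonneg ε x) (cap_le_one ε x))

theorem IsHeatSolution.integrable_mul (h : IsHeatSolution σ μ u) {t : ℝ} (ht : 0 < t)
    {f : EuclideanSpace ℝ (Fin d) → ℝ} (hf : Continuous f) {C : ℝ} (hC : ∀ x, |f x| ≤ C) :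
    Integrable (fun x => u t x * f x) :=
  (h.integrable t ht).mul_bdd (c := C) hf.aestronglyMeasurable (Eventually.of_forall hC)

theorem IsHeatSolution.hasDerivAt_integral_wave (h : IsHeatSolution σ μ u) (hσ : σ ≠ 0)
    {ε : ℝ} (hε : 0 < ε) (hε1 : ε ≤ 1) (θ : ℝ) (ξ : EuclideanSpace ℝ (Fin d))
    {t : ℝ} (ht : 0 < t) :
    HasDerivAt (fun s => ∫ x, u s x * wave ε θ ξ x)
      (σ / (4 * Real.pi) * (-‖ξ‖ ^ 2 * (∫ x, u t x * wave ε θ ξ x) +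
        ∫ x, u t x * waveError d ε θ ξ x)) t := by
  let e := EuclideanSpace.basisFun (Fin d) ℝ
  have hcap := continuous_cap (E := EuclideanSpace ℝ (Fin d)) ε
  have hs : HasCompactSupport (wave ε θ ξ) :=
    hasCompactSupport_of_cap_pow_mul hε (n := 4) (by norm_num) (g := fun x =>
      Real.cos (inner ℝ ξ x + θ)) fun x => by rw [wave]; ring
  have hs' : ∀ v, HasCompactSupport (waveDeriv ε θ ξ v) := fun v =>
    hasCompactSupport_of_cap_pow_mul hε (n := 3) (by norm_num) (g := fun x =>
      -(Real.sin (inner ℝ ξ x + θ) * inner ℝ ξ v) * cap ε x -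
        8 * ε ^ 2 * (Real.cos (inner ℝ ξ x + θ) * inner ℝ x v)) fun x => by rw [waveDeriv]; ring
  have hs'' : ∀ v, HasCompactSupport (waveDeriv₂ ε θ ξ v) := fun v =>
    hasCompactSupport_of_cap_pow_mul hε (n := 2) (by norm_num) (g := fun x =>
      -(Real.cos (inner ℝ ξ x + θ) * inner ℝ ξ v ^ 2) * cap ε x ^ 2 +
        16 * ε ^ 2 * (Real.sin (inner ℝ ξ x + θ) * cap ε x * (inner ℝ ξ v * inner ℝ x v)) +
        Real.cos (inner ℝ ξ x + θ) * (48 * ε ^ 4 * inner ℝ x v ^ 2 -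
          8 * ε ^ 2 * cap ε x * ‖v‖ ^ 2)) fun x => by rw [waveDeriv₂]; ring
  have hc' : ∀ v, Continuous (waveDeriv ε θ ξ v) := fun v => by unfold waveDeriv; fun_prop
  have hc'' : ∀ v, Continuous (waveDeriv₂ ε θ ξ v) := fun v => by unfold waveDeriv₂; fun_prop
  have key := integral_laplacian_mul e (h.contDiff hσ t ht)
    (fun i x => hasLineDerivAt_wave ε θ ξ (e i) x)
    (fun i x => hasLineDerivAt_waveDeriv ε θ ξ (e i) x) (continuous_wave ε θ ξ)
    (fun i => hc' _) (fun i => hc'' _) hs (fun i => hs' _) (fun i => hs'' _)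
  refine (h.hasDerivAt_integral_mul hσ (continuous_wave ε θ ξ) hs ht).congr_deriv ?_
  simp only [mul_assoc (σ / (4 * Real.pi))]
  rw [integral_const_mul, key]
  congr 1
  rw [← integral_const_mul, ← integral_add
    ((h.integrable_mul ht (continuous_wave ε θ ξ) (abs_wave_le ε θ ξ)).const_mul _)
    (h.integrable_mul ht (continuous_waveError ε θ ξ)
      fun x => abs_wave_error_le hε hε1 θ ξ x d)]
  refine integral_congr_ae (Eventually.of_forall fun x => ?_)
  simp only [sum_waveDeriv₂ e, Fintype.card_fin]
  ring

theorem IsHeatSolution.tendsto_integral_wave (h : IsHeatSolution σ μ u) {t : ℝ} (ht : 0 < t)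
    (θ : ℝ) (ξ : EuclideanSpace ℝ (Fin d)) :
    Tendsto (fun n : ℕ => ∫ x, u t x * wave (1 / ((n : ℝ) + 1)) θ ξ x) atTop
      (𝓝 (∫ x, u t x * Real.cos (inner ℝ ξ x + θ))) := by
  refine tendsto_integral_of_dominated_convergence (fun x => |u t x|)
    (fun n => (h.integrable_mul ht (continuous_wave _ θ ξ)
      (abs_wave_le _ θ ξ)).aestronglyMeasurable) (h.integrable t ht).abs (fun n => ?_) ?_
  · refine Eventually.of_forall fun x => ?_
    rw [Real.norm_eq_abs, abs_mul]
    exact mul_le_of_le_one_right (abs_nonneg _) (abs_wave_le _ θ ξ x)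
  · refine Eventually.of_forall fun x => ?_
    have := (((tendsto_cap x).pow 4).const_mul (Real.cos (inner ℝ ξ x + θ))).const_mul (u t x)
    simpa [wave] using this

/-- The mass of a nonnegative solution does not decrease. -/
theorem IsHeatSolution.integral_mono (h : IsHeatSolution σ μ u) (hσ : 0 < σ) {s t : ℝ} (hs : 0 < s)
    (hst : s ≤ t) : ∫ x, u s x ≤ ∫ x, u t x := by
  have ht : 0 < t := hs.trans_le hst
  have hκ : 0 < σ / (4 * Real.pi) := by positivity
  set κ := σ / (4 * Real.pi)
  have hw : ∀ (ε : ℝ) (x : EuclideanSpace ℝ (Fin d)), wave ε 0 0 x = cap ε x ^ 4 := by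
    intro ε x; simp [wave]
  have key : ∀ ε : ℝ, 0 < ε → ε ≤ 1 → ∫ x, u s x * wave ε 0 0 x ≤
      Real.exp (κ * (ε ^ 2 * (48 + 8 * d) ^ 2) * (t - s)) * ∫ x, u t x := by
    intro ε hε hε1
    -- This Grönwall rate offsets any loss of truncated mass allowed by `neg_le_cutoff_laplacian`,
    -- and it tends to zero with `ε`.
    set c := κ * (ε ^ 2 * (48 + 8 * d) ^ 2) with hc
    have hd : ∀ r, 0 < r → HasDerivAt (fun r => Real.exp (c * r) * ∫ x, u r x * wave ε 0 0 x)
        (Real.exp (c * r) * c * (∫ x, u r x * wave ε 0 0 x) + Real.exp (c * r) *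
          (κ * (-‖(0 : EuclideanSpace ℝ (Fin d))‖ ^ 2 * (∫ x, u r x * wave ε 0 0 x) +
            ∫ x, u r x * waveError d ε 0 0 x))) r := by
      intro r hr
      have h1 : HasDerivAt (fun r : ℝ => Real.exp (c * r)) (Real.exp (c * r) * c) r := by
        simpa using ((hasDerivAt_id r).const_mul c).exp
      exact h1.mul (h.hasDerivAt_integral_wave hσ.ne' hε hε1 0 0 hr)
    have hmono : MonotoneOn (fun r => Real.exp (c * r) * ∫ x, u r x * wave ε 0 0 x) (Icc s t) := by
      refine monotoneOn_of_deriv_nonneg (convex_Icc s t)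
        (fun r hr => (hd r (hs.trans_le hr.1)).continuousAt.continuousWithinAt)
        (fun r hr => ?_) fun r hr => ?_
      · rw [interior_Icc] at hr
        exact (hd r (hs.trans hr.1)).differentiableAt.differentiableWithinAt
      · rw [interior_Icc] at hr
        have hr0 := hs.trans hr.1
        rw [(hd r hr0).deriv]
        have hle : -(ε ^ 2 * (48 + 8 * (d : ℝ)) ^ 2) * ∫ x, u r x * wave ε 0 0 x ≤
            ∫ x, u r x * waveError d ε 0 0 x := by
          rw [← integral_const_mul]
          refine MeasureTheory.integral_mono
            ((h.integrable_mul hr0 (continuous_wave ε 0 0) (abs_wave_le ε 0 0)).const_mul _)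
            (h.integrable_mul hr0 (continuous_waveError ε 0 0)
              fun x => abs_wave_error_le hε hε1 0 0 x d) fun x => ?_
          have := neg_le_cutoff_laplacian ε x d
          have e : waveError d ε 0 0 x = 48 * ε ^ 4 * cap ε x ^ 2 * ‖x‖ ^ 2 -
              8 * ε ^ 2 * cap ε x ^ 3 * d := by simp [waveError]
          simp only [e, hw]
          nlinarith [h.nonneg r hr0 x]
        have hexp := Real.exp_pos (c * r)
        have h2 : 0 ≤ Real.exp (c * r) * κ * ((∫ x, u r x * waveError d ε 0 0 x) -
            -(ε ^ 2 * (48 + 8 * (d : ℝ)) ^ 2) * ∫ x, u r x * wave ε 0 0 x) :=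
          mul_nonneg (by positivity) (by linarith)
        rw [norm_zero]
        refine h2.trans_eq ?_
        rw [hc]
        ring
    have h1 := hmono (left_mem_Icc.2 hst) (right_mem_Icc.2 hst) hst
    have h2 : ∫ x, u t x * wave ε 0 0 x ≤ ∫ x, u t x :=
      MeasureTheory.integral_mono (h.integrable_mul ht (continuous_wave ε 0 0) (abs_wave_le ε 0 0))
        (h.integrable t ht) fun x => mul_le_of_le_one_right (h.nonneg t ht x)
          ((le_abs_self _).trans (abs_wave_le ε 0 0 x))
    have h3 : Real.exp (c * t) = Real.exp (c * s) * Real.exp (c * (t - s)) := by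
      rw [← Real.exp_add]; ring_nf
    have h4 := h1.trans (mul_le_mul_of_nonneg_left h2 (Real.exp_pos (c * t)).le)
    simp only [h3, mul_assoc] at h4
    exact le_of_mul_le_mul_left h4 (Real.exp_pos _)
  have l1 := h.tendsto_integral_wave hs 0 0
  simp only [inner_zero_left, add_zero, Real.cos_zero, mul_one] at l1
  have l2 : Tendsto (fun n : ℕ => Real.exp (κ * ((1 / ((n : ℝ) + 1)) ^ 2 * (48 + 8 * d) ^ 2) *
      (t - s)) * ∫ x, u t x) atTop (𝓝 (∫ x, u t x)) := by
    have h0 := tendsto_one_div_add_atTop_nhds_zero_nat (𝕜 := ℝ)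
    have h1 := ((((h0.pow 2).mul_const ((48 + 8 * (d : ℝ)) ^ 2)).const_mul κ).mul_const (t - s))
    have h2 := ((Real.continuous_exp.tendsto _).comp h1).mul_const (∫ x, u t x)
    simpa using h2
  refine le_of_tendsto_of_tendsto' l1 l2 fun n => key _ (by positivity) ?_
  rw [div_le_one (by positivity)]
  have : (0 : ℝ) ≤ n := n.cast_nonneg
  linarith

/-- With the integrating factor, only the truncation error contributes to the time derivative of the
truncated wave integral. It is at most a constant times `ε` times the mass at time `r ≤ t`, and that
mass is at most the mass at `t`; so it vanishes as `ε → 0`. -/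
theorem IsHeatSolution.exp_mul_integral_cos_eq (h : IsHeatSolution σ μ u) (hσ : 0 < σ) (θ : ℝ)
    (ξ : EuclideanSpace ℝ (Fin d)) {s t : ℝ} (hs : 0 < s) (hst : s ≤ t) :
    Real.exp (σ / (4 * Real.pi) * ‖ξ‖ ^ 2 * t) * ∫ x, u t x * Real.cos (inner ℝ ξ x + θ) =
      Real.exp (σ / (4 * Real.pi) * ‖ξ‖ ^ 2 * s) * ∫ x, u s x * Real.cos (inner ℝ ξ x + θ) := by
  have ht : 0 < t := hs.trans_le hst
  have hκ : 0 < σ / (4 * Real.pi) := by positivity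
  set κ := σ / (4 * Real.pi)
  set c := κ * ‖ξ‖ ^ 2 with hc
  have hc0 : 0 ≤ c := by positivity
  set K := Real.exp (c * t) * (κ * ((16 * ‖ξ‖ + 48 + 8 * d) * ∫ x, u t x)) with hK
  have key : ∀ ε : ℝ, 0 < ε → ε ≤ 1 →
      ‖Real.exp (c * t) * (∫ x, u t x * wave ε θ ξ x) -
        Real.exp (c * s) * ∫ x, u s x * wave ε θ ξ x‖ ≤ ε * K * ‖t - s‖ := by
    intro ε hε hε1
    refine (convex_Icc s t).norm_image_sub_le_of_norm_hasDerivWithin_le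
      (f := fun r => Real.exp (c * r) * ∫ x, u r x * wave ε θ ξ x)
      (f' := fun r => Real.exp (c * r) * (κ * ∫ x, u r x * waveError d ε θ ξ x))
      (fun r hr => ?_) (fun r hr => ?_) (left_mem_Icc.2 hst) (right_mem_Icc.2 hst)
    · have h1 : HasDerivAt (fun r : ℝ => Real.exp (c * r)) (Real.exp (c * r) * c) r := by
        simpa using ((hasDerivAt_id r).const_mul c).exp
      refine ((h1.mul (h.hasDerivAt_integral_wave hσ.ne' hε hε1 θ ξ
        (hs.trans_le hr.1))).congr_deriv ?_).hasDerivWithinAt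
      simp only [hc]
      ring
    · have hr0 := hs.trans_le hr.1
      have h1 : |∫ x, u r x * waveError d ε θ ξ x| ≤ ε * (16 * ‖ξ‖ + 48 + 8 * d) * ∫ x, u t x := by
        calc |∫ x, u r x * waveError d ε θ ξ x| ≤ ∫ x, u r x * (ε * (16 * ‖ξ‖ + 48 + 8 * d)) := by
              rw [← Real.norm_eq_abs]
              refine norm_integral_le_of_norm_le ((h.integrable r hr0).mul_const _)
                (Eventually.of_forall fun x => ?_)
              rw [norm_mul, Real.norm_eq_abs, Real.norm_eq_abs, abs_of_nonneg (h.nonneg r hr0 x)]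
              exact mul_le_mul_of_nonneg_left (abs_wave_error_le hε hε1 θ ξ x d) (h.nonneg r hr0 x)
          _ = ε * (16 * ‖ξ‖ + 48 + 8 * d) * ∫ x, u r x := by rw [integral_mul_const]; ring
          _ ≤ _ := by
              exact mul_le_mul_of_nonneg_left (h.integral_mono hσ hr0 hr.2) (by positivity)
      rw [norm_mul, norm_mul, Real.norm_eq_abs, Real.norm_eq_abs, Real.norm_eq_abs, Real.abs_exp,
        abs_of_pos hκ, hK]
      calc Real.exp (c * r) * (κ * |∫ x, u r x * waveError d ε θ ξ x|)
          ≤ Real.exp (c * t) * (κ * (ε * (16 * ‖ξ‖ + 48 + 8 * d) * ∫ x, u t x)) := by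
            gcongr
            exact hr.2
        _ = _ := by ring
  have l1 := ((h.tendsto_integral_wave ht θ ξ).const_mul (Real.exp (c * t))).sub
    ((h.tendsto_integral_wave hs θ ξ).const_mul (Real.exp (c * s)))
  have l2 : Tendsto (fun n : ℕ => 1 / ((n : ℝ) + 1) * K * ‖t - s‖) atTop (𝓝 0) := by
    have := ((tendsto_one_div_add_atTop_nhds_zero_nat (𝕜 := ℝ)).mul_const K).mul_const ‖t - s‖
    simpa using this
  have l3 := squeeze_zero_norm (fun n : ℕ => key (1 / ((n : ℝ) + 1)) (by positivity) (by
    rw [div_le_one (by positivity)]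
    have : (0 : ℝ) ≤ n := n.cast_nonneg
    linarith)) l2
  exact sub_eq_zero.1 (tendsto_nhds_unique l1 l3)

/-- The quantity conserved on `(0, t]` is evaluated in the limit `s → 0`; cosines are bounded and
continuous, so weak convergence applies. -/
theorem IsHeatSolution.integral_cos_eq (h : IsHeatSolution σ μ u) (hσ : 0 < σ) (θ : ℝ)
    (ξ : EuclideanSpace ℝ (Fin d)) {t : ℝ} (ht : 0 < t) :
    ∫ x, u t x * Real.cos (inner ℝ ξ x + θ) =
      Real.exp (-(σ / (4 * Real.pi) * ‖ξ‖ ^ 2 * t)) * ∫ x, Real.cos (inner ℝ ξ x + θ) ∂μ := by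
  let φ : EuclideanSpace ℝ (Fin d) →ᵇ ℝ := BoundedContinuousFunction.ofNormedAddCommGroup
    (fun x => Real.cos (inner ℝ ξ x + θ)) (by fun_prop) 1 fun x => Real.abs_cos_le_one _
  have l1 : Tendsto (fun s => ∫ x, u s x * Real.cos (inner ℝ ξ x + θ)) (𝓝[>] 0)
      (𝓝 (∫ x, Real.cos (inner ℝ ξ x + θ) ∂μ)) := by
    refine (h.initial_data φ).congr fun s => ?_
    exact integral_congr_ae (Eventually.of_forall fun x => mul_comm _ _)
  have l2 : Tendsto (fun s => Real.exp (σ / (4 * Real.pi) * ‖ξ‖ ^ 2 * s)) (𝓝[>] 0) (𝓝 1) := by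
    have hc : Continuous fun s => Real.exp (σ / (4 * Real.pi) * ‖ξ‖ ^ 2 * s) := by fun_prop
    have := (hc.tendsto 0).mono_left (nhdsWithin_le_nhds (s := Ioi (0 : ℝ)))
    simpa using this
  have l3 : Tendsto (fun s => Real.exp (σ / (4 * Real.pi) * ‖ξ‖ ^ 2 * s) *
      ∫ x, u s x * Real.cos (inner ℝ ξ x + θ)) (𝓝[>] 0) (𝓝
      (Real.exp (σ / (4 * Real.pi) * ‖ξ‖ ^ 2 * t) *
        ∫ x, u t x * Real.cos (inner ℝ ξ x + θ))) := by
    refine tendsto_const_nhds.congr' ?_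
    filter_upwards [Ioc_mem_nhdsGT ht] with s hs
    exact h.exp_mul_integral_cos_eq hσ θ ξ hs.1 hs.2
  have := tendsto_nhds_unique l3 (l2.mul l1)
  rw [one_mul] at this
  rw [← this, ← mul_assoc, ← Real.exp_add]
  simp

end HeatSolution

/-! ### The heat kernel and uniqueness -/

section HeatDensity

variable {d : ℕ}

/-- The convolution of `μ` with the heat kernel of `∂ₜ = (σ / 4π) Δ` at time `t`. -/
noncomputable def heatDensity (σ t : ℝ) (μ : Measure (EuclideanSpace ℝ (Fin d)))
    (x : EuclideanSpace ℝ (Fin d)) : ENNReal :=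
  ENNReal.ofReal ((σ * t) ^ (-(d / 2 : ℝ))) * superpose (fun x => ‖x‖ ^ 2) (Real.pi / (σ * t)) μ x

theorem measurable_heatDensity (σ t : ℝ) (μ : Measure (EuclideanSpace ℝ (Fin d))) [SFinite μ] :
    Measurable (heatDensity σ t μ) :=
  (measurable_superpose (by fun_prop) _ μ).const_mul _

theorem heatDensity_pos {σ t : ℝ} (h : 0 < σ * t) {μ : Measure (EuclideanSpace ℝ (Fin d))}
    (hμ : μ ≠ 0) (x : EuclideanSpace ℝ (Fin d)) : 0 < heatDensity σ t μ x := by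
  refine ENNReal.mul_pos (ENNReal.ofReal_pos.2 (by positivity)).ne' ?_
  rw [superpose, ← pos_iff_ne_zero, lintegral_pos_iff_support (by fun_prop)]
  have : (Function.support fun a => ENNReal.ofReal (Real.exp (-(Real.pi / (σ * t)) * ‖x - a‖ ^ 2)))
      = univ := by
    ext a
    simp [Real.exp_pos]
  rw [this]
  exact Measure.measure_univ_pos.2 hμ

theorem withDensity_heatDensity {σ t : ℝ} (h : 0 < σ * t)
    (μ : Measure (EuclideanSpace ℝ (Fin d))) [IsFiniteMeasure μ] :
    volume.withDensity (heatDensity σ t μ) = μ.conv (volume.withDensity fun x =>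
      ENNReal.ofReal ((σ * t) ^ (-(d / 2 : ℝ)) * Real.exp (-(Real.pi / (σ * t)) * ‖x‖ ^ 2))) := by
  refine Measure.ext_of_lintegral _ fun f hf => ?_
  rw [Measure.lintegral_conv hf, lintegral_withDensity_eq_lintegral_mul _
    (measurable_heatDensity σ t μ) hf]
  have h1 : ∀ a : EuclideanSpace ℝ (Fin d), ∫⁻ y, f (a + y) ∂(volume.withDensity fun x =>
      ENNReal.ofReal ((σ * t) ^ (-(d / 2 : ℝ)) * Real.exp (-(Real.pi / (σ * t)) * ‖x‖ ^ 2))) =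
      ∫⁻ x, ENNReal.ofReal ((σ * t) ^ (-(d / 2 : ℝ)) *
        Real.exp (-(Real.pi / (σ * t)) * ‖x - a‖ ^ 2)) * f x := by
    intro a
    rw [lintegral_withDensity_eq_lintegral_mul _ (by fun_prop) (by fun_prop),
      ← lintegral_add_left_eq_self (fun x => ENNReal.ofReal ((σ * t) ^ (-(d / 2 : ℝ)) *
        Real.exp (-(Real.pi / (σ * t)) * ‖x - a‖ ^ 2)) * f x) a]
    simp
  simp only [h1]
  rw [lintegral_lintegral_swap (by fun_prop)]
  refine lintegral_congr fun x => ?_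
  rw [lintegral_mul_const _ (by fun_prop), Pi.mul_apply, heatDensity, superpose,
    ← lintegral_const_mul _ (by fun_prop)]
  congr 1
  refine lintegral_congr fun a => ?_
  rw [ENNReal.ofReal_mul (by positivity)]

theorem lintegral_heatKernel {σ t : ℝ} (h : 0 < σ * t) :
    ∫⁻ x : EuclideanSpace ℝ (Fin d), ENNReal.ofReal ((σ * t) ^ (-(d / 2 : ℝ)) *
      Real.exp (-(Real.pi / (σ * t)) * ‖x‖ ^ 2)) = 1 := by
  have hpi := Real.pi_pos
  simp_rw [ENNReal.ofReal_mul (Real.rpow_nonneg h.le _)]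
  rw [lintegral_const_mul _ (by fun_prop), lintegral_exp_neg_mul_norm_sq (by positivity),
    finrank_euclideanSpace_fin, ← ENNReal.ofReal_mul (by positivity)]
  have : Real.pi / (Real.pi / (σ * t)) = σ * t := by field_simp
  rw [this, ← Real.rpow_add h]
  simp

theorem lintegral_heatDensity {σ t : ℝ} (h : 0 < σ * t)
    (μ : Measure (EuclideanSpace ℝ (Fin d))) [IsFiniteMeasure μ] :
    ∫⁻ x, heatDensity σ t μ x = μ univ := by
  have := congrArg (fun ν => ν univ) (withDensity_heatDensity h μ)
  simp only [withDensity_apply _ MeasurableSet.univ, Measure.restrict_univ] at this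
  rw [this, ← lintegral_one, Measure.lintegral_conv measurable_const]
  simp only [lintegral_one, withDensity_apply _ MeasurableSet.univ, Measure.restrict_univ,
    lintegral_heatKernel h]

theorem charFun_heatKernel {σ t : ℝ} (h : 0 < σ * t) (ξ : EuclideanSpace ℝ (Fin d)) :
    charFun (volume.withDensity fun x : EuclideanSpace ℝ (Fin d) =>
      ENNReal.ofReal ((σ * t) ^ (-(d / 2 : ℝ)) * Real.exp (-(Real.pi / (σ * t)) * ‖x‖ ^ 2))) ξ =
    Real.exp (-(σ / (4 * Real.pi) * ‖ξ‖ ^ 2 * t)) := by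
  have hpi := Real.pi_pos
  rw [charFun_apply, integral_withDensity_eq_integral_toReal_smul (by fun_prop)
    (Eventually.of_forall fun x => ENNReal.ofReal_lt_top)]
  have h1 : ∀ x : EuclideanSpace ℝ (Fin d), (ENNReal.ofReal ((σ * t) ^ (-(d / 2 : ℝ)) *
      Real.exp (-(Real.pi / (σ * t)) * ‖x‖ ^ 2))).toReal • Complex.exp (inner ℝ x ξ * Complex.I) =
      (((σ * t) ^ (-(d / 2 : ℝ)) : ℝ) : ℂ) * Complex.exp (-((Real.pi / (σ * t) : ℝ) : ℂ) * ‖x‖ ^ 2 +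
        Complex.I * inner ℝ ξ x) := by
    intro x
    rw [ENNReal.toReal_ofReal (by positivity), Complex.exp_add, Complex.real_smul,
      real_inner_comm ξ x]
    push_cast
    ring_nf
  simp only [h1]
  rw [integral_const_mul, GaussianFourier.integral_cexp_neg_mul_sq_norm_add
    (by rw [Complex.ofReal_re]; positivity), finrank_euclideanSpace_fin]
  have h2 : (Real.pi : ℂ) / ((Real.pi / (σ * t) : ℝ) : ℂ) = ((σ * t : ℝ) : ℂ) := by
    rw [← Complex.ofReal_div]
    congr 1
    field_simp
  have h3 : ((σ * t : ℝ) : ℂ) ^ ((d : ℂ) / 2) = (((σ * t) ^ (d / 2 : ℝ) : ℝ) : ℂ) := by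
    rw [Complex.ofReal_cpow h.le]
    push_cast
    rfl
  rw [h2, h3, ← mul_assoc, ← Complex.ofReal_mul, ← Real.rpow_add h]
  simp only [neg_add_cancel, Real.rpow_zero, Complex.ofReal_one, one_mul]
  rw [Complex.ofReal_exp]
  congr 1
  have hσt : (σ * t : ℂ) ≠ 0 := by exact_mod_cast h.ne'
  have hpi' : (Real.pi : ℂ) ≠ 0 := by exact_mod_cast hpi.ne'
  push_cast
  rw [Complex.I_sq]
  field_simp

/-- The phases `0` and `-π/2` yield the real and imaginary parts, so the cosine identities for all
phases determine the characteristic function. -/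
theorem charFun_eq_integral_cos (ν : Measure (EuclideanSpace ℝ (Fin d))) [IsFiniteMeasure ν]
    (ξ : EuclideanSpace ℝ (Fin d)) :
    charFun ν ξ = (∫ x, Real.cos (inner ℝ ξ x + 0) ∂ν : ℝ) +
      (∫ x, Real.cos (inner ℝ ξ x + -(Real.pi / 2)) ∂ν : ℝ) * Complex.I := by
  have hi : ∀ θ : ℝ, Integrable (fun x => ((Real.cos (inner ℝ ξ x + θ) : ℝ) : ℂ)) ν := fun θ =>
    Integrable.of_bound (C := 1) (by fun_prop) (Eventually.of_forall fun x => by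
      rw [Complex.norm_real]
      exact Real.abs_cos_le_one _)
  rw [charFun_apply, ← integral_complex_ofReal, ← integral_complex_ofReal, ← integral_mul_const,
    ← integral_add (hi _) ((hi _).mul_const _)]
  refine integral_congr_ae (Eventually.of_forall fun x => ?_)
  simp only
  rw [Complex.exp_mul_I, real_inner_comm ξ x, add_zero, ← sub_eq_add_neg, Real.cos_sub_pi_div_two,
    Complex.ofReal_cos, Complex.ofReal_sin]

/-- Uniqueness of nonnegative solutions: they are given by the heat kernel. -/
theorem IsHeatSolution.ofReal_ae_eq {σ : ℝ} {μ : Measure (EuclideanSpace ℝ (Fin d))}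
    [IsFiniteMeasure μ] {u : ℝ → EuclideanSpace ℝ (Fin d) → ℝ} (h : IsHeatSolution σ μ u)
    (hσ : 0 < σ) {t : ℝ} (ht : 0 < t) :
    (fun x => ENNReal.ofReal (u t x)) =ᵐ[volume] heatDensity σ t μ := by
  have hσt : 0 < σ * t := mul_pos hσ ht
  have hum : Measurable (u t) := (h.continuous hσ.ne' ht).measurable
  rw [← withDensity_eq_iff_of_sigmaFinite hum.ennreal_ofReal.aemeasurable
    (measurable_heatDensity σ t μ).aemeasurable, withDensity_heatDensity hσt]
  have : IsFiniteMeasure (volume.withDensity fun x => ENNReal.ofReal (u t x)) :=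
    isFiniteMeasure_withDensity_ofReal (h.integrable t ht).2
  have : IsFiniteMeasure (volume.withDensity fun x : EuclideanSpace ℝ (Fin d) =>
      ENNReal.ofReal ((σ * t) ^ (-(d / 2 : ℝ)) * Real.exp (-(Real.pi / (σ * t)) * ‖x‖ ^ 2))) :=
    isFiniteMeasure_withDensity (by rw [lintegral_heatKernel hσt]; simp)
  refine Measure.ext_of_charFun (funext fun ξ => ?_)
  have hint : ∀ θ : ℝ, ∫ x, Real.cos (inner ℝ ξ x + θ) ∂(volume.withDensity fun x =>
      ENNReal.ofReal (u t x)) = Real.exp (-(σ / (4 * Real.pi) * ‖ξ‖ ^ 2 * t)) *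
        ∫ x, Real.cos (inner ℝ ξ x + θ) ∂μ := by
    intro θ
    rw [← h.integral_cos_eq hσ θ ξ ht, integral_withDensity_eq_integral_toReal_smul
      hum.ennreal_ofReal (Eventually.of_forall fun x => ENNReal.ofReal_lt_top)]
    refine integral_congr_ae (Eventually.of_forall fun x => ?_)
    simp only [ENNReal.toReal_ofReal (h.nonneg t ht x), smul_eq_mul]
  rw [charFun_conv, charFun_heatKernel hσt, charFun_eq_integral_cos, charFun_eq_integral_cos, hint,
    hint]
  push_cast
  ring

theorem IsHeatSolution.eq_of_zero {μ : Measure (EuclideanSpace ℝ (Fin d))}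
    {u : ℝ → EuclideanSpace ℝ (Fin d) → ℝ} (h : IsHeatSolution 0 μ u) {s t : ℝ} (hs : 0 < s)
    (ht : 0 < t) : u s = u t := by
  funext x
  have hd : ∀ r ∈ Ioi (0 : ℝ), HasDerivAt (fun s => u s x) 0 r := fun r hr => by
    simpa using h.heat_equation r hr x
  exact (convex_Ioi (0 : ℝ)).is_const_of_fderivWithin_eq_zero (𝕜 := ℝ) (f := fun s => u s x)
    (fun r hr => (hd r hr).differentiableAt.differentiableWithinAt) (fun r hr => by
      rw [fderivWithin_of_isOpen isOpen_Ioi hr]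
      have := (hd r hr).hasFDerivAt.fderiv
      rw [this]
      ext
      simp) hs ht

/-- The solution is constant in time, so its weak limit is itself, and bounded continuous functions
separate finite measures. -/
theorem IsHeatSolution.withDensity_of_zero {μ : Measure (EuclideanSpace ℝ (Fin d))}
    [IsFiniteMeasure μ] {u : ℝ → EuclideanSpace ℝ (Fin d) → ℝ} (h : IsHeatSolution 0 μ u) {t : ℝ}
    (ht : 0 < t) : volume.withDensity (fun x => ENNReal.ofReal (u t x)) = μ := by
  have : IsFiniteMeasure (volume.withDensity fun x => ENNReal.ofReal (u t x)) :=
    isFiniteMeasure_withDensity_ofReal (h.integrable t ht).2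
  refine ext_of_forall_integral_eq_of_IsFiniteMeasure fun f => ?_
  rw [integral_withDensity_eq_integral_toReal_smul₀
    (h.integrable t ht).aestronglyMeasurable.aemeasurable.ennreal_ofReal
    (Eventually.of_forall fun x => ENNReal.ofReal_lt_top)]
  refine tendsto_nhds_unique (tendsto_const_nhds.congr' ?_) (h.initial_data f)
  filter_upwards [self_mem_nhdsWithin] with s hs
  rw [h.eq_of_zero hs ht]
  refine integral_congr_ae (Eventually.of_forall fun x => ?_)
  simp only [ENNReal.toReal_ofReal (h.nonneg t ht x), smul_eq_mul, mul_comm]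

end HeatDensity

/-! ### Minkowski's integral inequality -/

section Minkowski

theorem lintegral_pos_of_forall_pos {X : Type*} [MeasurableSpace X] {ν : Measure X}
    {f : X → ENNReal} (hν : ν ≠ 0) (hf : Measurable f) (hpos : ∀ x, 0 < f x) :
    0 < ∫⁻ x, f x ∂ν := by
  rw [lintegral_pos_iff_support hf]
  have : Function.support f = univ := by ext x; simp [(hpos x).ne']
  rw [this]
  exact Measure.measure_univ_pos.2 hν

/-- Minkowski's integral inequality. -/
theorem lintegral_lintegral_rpow_le {X Y : Type*} [MeasurableSpace X] [MeasurableSpace Y]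
    {ν : Measure X} {μ : Measure Y} [SigmaFinite ν] [SFinite μ] {f : X → Y → ENNReal}
    (hf : Measurable (Function.uncurry f)) {p : ℝ} (hp : 1 ≤ p) :
    (∫⁻ x, (∫⁻ y, f x y ∂μ) ^ p ∂ν) ^ (1 / p) ≤ ∫⁻ y, (∫⁻ x, f x y ^ p ∂ν) ^ (1 / p) ∂μ := by
  rcases hp.eq_or_lt with rfl | hp'
  · simp only [ENNReal.rpow_one, div_one]
    exact (lintegral_lintegral_swap hf.aemeasurable).le
  refine lintegral_rpow_le_of_forall_lintegral_mul_le
    (Measurable.lintegral_prod_right' hf) hp fun h hm => ?_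
  have hm1 : ∀ x, Measurable fun y => f x y := fun x => hf.comp measurable_prodMk_left
  have hm2 : ∀ y, Measurable fun x => f x y := fun y => hf.comp measurable_prodMk_right
  have hm3 : Measurable fun y => (∫⁻ x, f x y ^ p ∂ν) ^ (1 / p) :=
    (Measurable.lintegral_prod_left' (f := fun w : X × Y => f w.1 w.2 ^ p)
      (hf.pow_const p)).pow_const _
  calc ∫⁻ x, (∫⁻ y, f x y ∂μ) * h x ^ (1 - 1 / p) ∂ν
      = ∫⁻ x, ∫⁻ y, f x y * h x ^ (1 - 1 / p) ∂μ ∂ν :=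
        lintegral_congr fun x => (lintegral_mul_const _ (hm1 x)).symm
    _ = ∫⁻ y, ∫⁻ x, f x y * h x ^ (1 - 1 / p) ∂ν ∂μ := by
        refine lintegral_lintegral_swap (Measurable.aemeasurable ?_)
        exact hf.mul ((hm.comp measurable_fst).pow_const _)
    _ ≤ ∫⁻ y, (∫⁻ x, f x y ^ p ∂ν) ^ (1 / p) * (∫⁻ x, h x ∂ν) ^ (1 - 1 / p) ∂μ :=
        lintegral_mono fun y => lintegral_mul_rpow_le (hm2 y) hm hp'
    _ = _ := lintegral_mul_const _ hm3

end Minkowski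

/-! ### A fixed measure convolved with a power of a heat flow -/

section FixedMeasure

variable {d : ℕ}

theorem lintegral_kernel_rpow_mul {σ s r m : ℝ} (hσ : 0 < σ) (hs : 0 < s) (hr : 0 < r)
    (hm : 0 < m) (y a : EuclideanSpace ℝ (Fin d)) :
    ∫⁻ x, ENNReal.ofReal (Real.exp (-(Real.pi / (σ * s)) * ‖x - a‖ ^ 2)) ^ m *
      ENNReal.ofReal ((σ / m * r) ^ (-(d / 2 : ℝ)) *
        Real.exp (-(Real.pi / (σ / m * r)) * ‖y - x‖ ^ 2)) =
    ENNReal.ofReal ((s / (s + r)) ^ (d / 2 : ℝ)) *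
      ENNReal.ofReal (Real.exp (-(Real.pi / (σ * (s + r))) * ‖y - a‖ ^ 2)) ^ m := by
  have hpi := Real.pi_pos
  set A := m * Real.pi / σ * (1 / s + 1 / r) with hA
  have pA : 0 < A := by positivity
  set D := (σ / m * r) ^ (-(d / 2 : ℝ)) * Real.exp (-(m * Real.pi / (σ * (s + r))) * ‖y - a‖ ^ 2)
    with hD
  have hDp : 0 < D := by positivity
  have hpt : ∀ x, ENNReal.ofReal (Real.exp (-(Real.pi / (σ * s)) * ‖x - a‖ ^ 2)) ^ m *
      ENNReal.ofReal ((σ / m * r) ^ (-(d / 2 : ℝ)) *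
        Real.exp (-(Real.pi / (σ / m * r)) * ‖y - x‖ ^ 2)) =
      ENNReal.ofReal D *
        ENNReal.ofReal (Real.exp (-A * ‖x - (a + (s / (s + r)) • (y - a))‖ ^ 2)) := by
    intro x
    rw [ENNReal.ofReal_rpow_of_pos (Real.exp_pos _), ← Real.exp_mul,
      ← ENNReal.ofReal_mul (Real.exp_pos _).le, ← ENNReal.ofReal_mul hDp.le, hD, mul_left_comm,
      ← Real.exp_add, mul_assoc ((σ / m * r) ^ (-(d / 2 : ℝ))), ← Real.exp_add]
    congr 3
    have := norm_sq_div_add_norm_sq_div hs hr x a y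
    rw [hA]
    have e : -(Real.pi / (σ * s)) * ‖x - a‖ ^ 2 * m + -(Real.pi / (σ / m * r)) * ‖y - x‖ ^ 2 =
      -(m * Real.pi / σ) * (‖x - a‖ ^ 2 / s + ‖y - x‖ ^ 2 / r) := by field_simp; ring
    rw [e, this]
    field_simp
    ring
  simp only [hpt]
  rw [lintegral_const_mul _ (by fun_prop), lintegral_sub_right_eq_self (fun x =>
    ENNReal.ofReal (Real.exp (-A * ‖x‖ ^ 2))), lintegral_exp_neg_mul_norm_sq pA,
    finrank_euclideanSpace_fin, ENNReal.ofReal_rpow_of_pos (Real.exp_pos _), ← Real.exp_mul,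
    ← ENNReal.ofReal_mul hDp.le, ← ENNReal.ofReal_mul (by positivity)]
  congr 1
  have e1 : Real.pi / A = (σ / m * r) * (s / (s + r)) := by
    rw [hA]; field_simp; ring
  rw [e1, Real.mul_rpow (by positivity) (by positivity), hD]
  have e2 : (σ / m * r) ^ (-(d / 2 : ℝ)) * (σ / m * r) ^ (d / 2 : ℝ) = 1 := by
    rw [← Real.rpow_add (by positivity)]; simp
  have e3 : Real.exp (-(Real.pi / (σ * (s + r))) * ‖y - a‖ ^ 2 * m) =
      Real.exp (-(m * Real.pi / (σ * (s + r))) * ‖y - a‖ ^ 2) := by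
    congr 1; ring
  rw [e3]
  linear_combination (Real.exp (-(m * Real.pi / (σ * (s + r))) * ‖y - a‖ ^ 2) *
    (s / (s + r)) ^ (d / 2 : ℝ)) * e2

/-- Powers `m ≥ 1` of a heat flow are, up to a power of time, supersolutions of a heat equation. -/
theorem lintegral_heatDensity_rpow_mul_le {σ s r m : ℝ} (hσ : 0 < σ) (hs : 0 < s) (hr : 0 < r)
    (hm : 1 ≤ m) (μ : Measure (EuclideanSpace ℝ (Fin d))) [IsFiniteMeasure μ]
    (y : EuclideanSpace ℝ (Fin d)) :
    (∫⁻ x, heatDensity σ s μ x ^ m * ENNReal.ofReal ((σ / m * r) ^ (-(d / 2 : ℝ)) *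
        Real.exp (-(Real.pi / (σ / m * r)) * ‖y - x‖ ^ 2))) ^ (1 / m) ≤
      ENNReal.ofReal (((s + r) / s) ^ (d / 2 * (1 - 1 / m))) * heatDensity σ (s + r) μ y := by
  have hm0 : 0 < m := by linarith
  have hsr : 0 < s + r := by linarith
  set k : EuclideanSpace ℝ (Fin d) → ENNReal := fun x => ENNReal.ofReal
    ((σ / m * r) ^ (-(d / 2 : ℝ)) * Real.exp (-(Real.pi / (σ / m * r)) * ‖y - x‖ ^ 2)) with hk
  have hkm : Measurable k := by fun_prop
  have hkf : SigmaFinite (volume.withDensity k) := SigmaFinite.withDensity_of_ne_top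
    (Eventually.of_forall fun x => ENNReal.ofReal_ne_top)
  set c := ENNReal.ofReal ((σ * s) ^ (-(d / 2 : ℝ))) with hc
  -- Minkowski in `Lᵐ` of the kernel measure reduces the bound to a single Gaussian, for which
  -- `lintegral_kernel_rpow_mul` is an exact identity. Diffusivity `σ / m` is the right one because
  -- the `m`-th power of a Gaussian of diffusivity `σ` has that width.
  have hmink := lintegral_lintegral_rpow_le (ν := volume.withDensity k) (μ := μ) (p := m)
    (f := fun x a => c * ENNReal.ofReal (Real.exp (-(Real.pi / (σ * s)) * ‖x - a‖ ^ 2)))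
    (by unfold Function.uncurry; fun_prop) hm
  have hleft : ∫⁻ x, heatDensity σ s μ x ^ m * k x = ∫⁻ x, (∫⁻ a, c *
      ENNReal.ofReal (Real.exp (-(Real.pi / (σ * s)) * ‖x - a‖ ^ 2)) ∂μ) ^ m
        ∂(volume.withDensity k) := by
    have hmeas : Measurable fun x => ∫⁻ a, c *
      ENNReal.ofReal (Real.exp (-(Real.pi / (σ * s)) * ‖x - a‖ ^ 2)) ∂μ :=
      Measurable.lintegral_prod_right' (f := fun w : _ × _ => c *
        ENNReal.ofReal (Real.exp (-(Real.pi / (σ * s)) * ‖w.1 - w.2‖ ^ 2))) (by fun_prop)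
    rw [lintegral_withDensity_eq_lintegral_mul _ hkm (hmeas.pow_const m)]
    refine lintegral_congr fun x => ?_
    rw [Pi.mul_apply, mul_comm, lintegral_const_mul _ (by fun_prop)]
    rfl
  rw [← hleft] at hmink
  refine hmink.trans_eq ?_
  rw [heatDensity, superpose, ← mul_assoc, ← lintegral_const_mul _ (by fun_prop)]
  refine lintegral_congr fun a => ?_
  rw [lintegral_withDensity_eq_lintegral_mul _ hkm (by fun_prop)]
  have h1 : ∀ x, (k * fun x => (c * ENNReal.ofReal
      (Real.exp (-(Real.pi / (σ * s)) * ‖x - a‖ ^ 2))) ^ m) x = c ^ m *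
      (ENNReal.ofReal (Real.exp (-(Real.pi / (σ * s)) * ‖x - a‖ ^ 2)) ^ m * k x) := by
    intro x
    rw [Pi.mul_apply, ENNReal.mul_rpow_of_nonneg _ _ hm0.le]
    ring
  simp only [h1]
  rw [lintegral_const_mul _ (by fun_prop), lintegral_kernel_rpow_mul hσ hs hr hm0,
    ← mul_assoc, ENNReal.mul_rpow_of_nonneg _ _ (by positivity), ← ENNReal.rpow_mul,
    mul_one_div_cancel hm0.ne', ENNReal.rpow_one, ENNReal.mul_rpow_of_nonneg _ _ (by positivity),
    ← ENNReal.rpow_mul, mul_one_div_cancel hm0.ne', ENNReal.rpow_one]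
  congr 1
  rw [ENNReal.ofReal_rpow_of_pos (by positivity), hc, ← ENNReal.ofReal_mul (by positivity),
    ← ENNReal.ofReal_mul (by positivity)]
  congr 1
  have e1 : s / (s + r) = ((s + r) / s)⁻¹ := by rw [inv_div]
  have e2 : σ * (s + r) = σ * s * ((s + r) / s) := by field_simp
  have hq : 0 < (s + r) / s := by positivity
  rw [e1, e2]
  generalize (s + r) / s = q at hq
  rw [Real.mul_rpow (by positivity) hq.le, Real.inv_rpow hq.le, ← Real.rpow_neg hq.le,
    ← Real.rpow_mul hq.le, mul_left_comm, ← Real.rpow_add hq]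
  congr 2
  ring

/-- The `Lᵖ` norm of `μ₁ * v^α`, where `v` is the heat flow of `μ₂`. -/
noncomputable def fixedNorm (σ α p t : ℝ) (μ₁ μ₂ : Measure (EuclideanSpace ℝ (Fin d))) : ENNReal :=
  (∫⁻ z, (∫⁻ a, heatDensity σ t μ₂ (z - a) ^ α ∂μ₁) ^ p) ^ (1 / p)

/-- With `m = α p ≥ 1`, the `p`-th power of the convolution at time `s` is averaged against a kernel
of diffusivity `σ / m` and unit mass, which leaves its integral unchanged. For each centre `z`,
Minkowski over `μ₁` and the supersolution bound for `m`-th powers dominate the average by the `p`-th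
power of the convolution at time `s + r`, up to a constant. -/
theorem fixedNorm_le {σ α p s r : ℝ} (hσ : 0 < σ) (hp : 1 ≤ p) (hα : 1 / p ≤ α) (hs : 0 < s)
    (hr : 0 < r) (μ₁ μ₂ : Measure (EuclideanSpace ℝ (Fin d))) [IsFiniteMeasure μ₁]
    [IsFiniteMeasure μ₂] : fixedNorm σ α p s μ₁ μ₂ ≤
      ENNReal.ofReal (((s + r) / s) ^ (d * (α - 1 / p) / 2)) * fixedNorm σ α p (s + r) μ₁ μ₂ := by
  have hp0 : 0 < p := by linarith
  have hα0 : 0 < α := lt_of_lt_of_le (by positivity) hα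
  have hm : 1 ≤ α * p := by rwa [div_le_iff₀ hp0] at hα
  have hm0 : 0 < α * p := by linarith
  set m := α * p with hmdef
  let k : EuclideanSpace ℝ (Fin d) → ENNReal := fun x => ENNReal.ofReal
    ((σ / m * r) ^ (-(d / 2 : ℝ)) * Real.exp (-(Real.pi / (σ / m * r)) * ‖x‖ ^ 2))
  have hkm : Measurable k := by fun_prop
  have hk1 : ∫⁻ x, k x = 1 := lintegral_heatKernel (by positivity)
  have hv := measurable_heatDensity σ s μ₂
  have hv' := measurable_heatDensity σ (s + r) μ₂
  set c := ENNReal.ofReal (((s + r) / s) ^ (d * (α - 1 / p) / 2)) with hc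
  have hcα : ENNReal.ofReal (((s + r) / s) ^ (d / 2 * (1 - 1 / m))) ^ α = c := by
    rw [hc, ENNReal.ofReal_rpow_of_pos (by positivity), ← Real.rpow_mul (by positivity), hmdef]
    congr 2
    field_simp
  have hG : Measurable fun w => ∫⁻ a, heatDensity σ s μ₂ (w - a) ^ α ∂μ₁ :=
    Measurable.lintegral_prod_right' (f := fun z : _ × _ => heatDensity σ s μ₂ (z.1 - z.2) ^ α)
      ((hv.comp (measurable_fst.sub measurable_snd)).pow_const α)
  have hpt : ∀ z a, (∫⁻ w, (heatDensity σ s μ₂ (w - a) ^ α) ^ p * k (z - w)) ^ (1 / p) ≤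
      c * heatDensity σ (s + r) μ₂ (z - a) ^ α := by
    intro z a
    have h1 : ∫⁻ w, (heatDensity σ s μ₂ (w - a) ^ α) ^ p * k (z - w) =
        ∫⁻ x, heatDensity σ s μ₂ x ^ m * k (z - a - x) := by
      rw [← lintegral_add_right_eq_self _ a]
      refine lintegral_congr fun x => ?_
      rw [add_sub_cancel_right, ← ENNReal.rpow_mul, sub_sub, add_comm x a]
    have h2 := lintegral_heatDensity_rpow_mul_le hσ hs hr hm μ₂ (z - a)
    rw [h1, show 1 / p = 1 / m * α by rw [hmdef]; field_simp, ENNReal.rpow_mul, ← hcα,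
      ← ENNReal.mul_rpow_of_nonneg _ _ hα0.le]
    exact ENNReal.rpow_le_rpow h2 hα0.le
  have hmain : ∫⁻ w, (∫⁻ a, heatDensity σ s μ₂ (w - a) ^ α ∂μ₁) ^ p ≤
      ∫⁻ z, (c * ∫⁻ a, heatDensity σ (s + r) μ₂ (z - a) ^ α ∂μ₁) ^ p := by
    calc ∫⁻ w, (∫⁻ a, heatDensity σ s μ₂ (w - a) ^ α ∂μ₁) ^ p
        = ∫⁻ w, ∫⁻ z, (∫⁻ a, heatDensity σ s μ₂ (w - a) ^ α ∂μ₁) ^ p * k (z - w) := by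
          refine lintegral_congr fun w => ?_
          rw [lintegral_const_mul _ (by fun_prop), lintegral_sub_right_eq_self k, hk1, mul_one]
      _ = ∫⁻ z, ∫⁻ w, (∫⁻ a, heatDensity σ s μ₂ (w - a) ^ α ∂μ₁) ^ p * k (z - w) := by
          refine lintegral_lintegral_swap (Measurable.aemeasurable ?_)
          exact ((hG.comp measurable_fst).pow_const p).mul
            (hkm.comp (measurable_snd.sub measurable_fst))
      _ ≤ _ := by
          refine lintegral_mono fun z => ?_
          have hkz : Measurable fun w => k (z - w) := by fun_prop
          have hsf : SigmaFinite (volume.withDensity fun w => k (z - w)) :=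
            SigmaFinite.withDensity_of_ne_top
              (Eventually.of_forall fun x => ENNReal.ofReal_ne_top)
          have hmink := lintegral_lintegral_rpow_le (ν := volume.withDensity fun w => k (z - w))
            (μ := μ₁) (f := fun w a => heatDensity σ s μ₂ (w - a) ^ α)
            ((hv.comp (measurable_fst.sub measurable_snd)).pow_const α) hp
          rw [lintegral_withDensity_eq_lintegral_mul _ hkz (hG.pow_const p)] at hmink
          have h2 : ∀ a, ∫⁻ w, (heatDensity σ s μ₂ (w - a) ^ α) ^ p
              ∂(volume.withDensity fun w => k (z - w)) =
              ∫⁻ w, (heatDensity σ s μ₂ (w - a) ^ α) ^ p * k (z - w) := by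
            intro a
            have hma : Measurable fun w => (heatDensity σ s μ₂ (w - a) ^ α) ^ p :=
              ((hv.comp (measurable_id.sub_const a)).pow_const α).pow_const p
            rw [lintegral_withDensity_eq_lintegral_mul _ hkz hma]
            exact lintegral_congr fun w => mul_comm _ _
          simp only [h2] at hmink
          have h3 := hmink.trans (lintegral_mono fun a => hpt z a)
          have hmz : Measurable fun a => heatDensity σ (s + r) μ₂ (z - a) ^ α :=
            (hv'.comp (measurable_const.sub measurable_id)).pow_const α
          rw [lintegral_const_mul _ hmz] at h3
          have h4 := ENNReal.rpow_le_rpow h3 hp0.le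
          rw [← ENNReal.rpow_mul, one_div_mul_cancel hp0.ne', ENNReal.rpow_one] at h4
          refine le_of_eq_of_le (lintegral_congr fun w => ?_) h4
          rw [Pi.mul_apply, mul_comm]
  unfold fixedNorm
  calc _ ≤ (∫⁻ z, (c * ∫⁻ a, heatDensity σ (s + r) μ₂ (z - a) ^ α ∂μ₁) ^ p) ^ (1 / p) := by
        gcongr
    _ = _ := by
        simp_rw [ENNReal.mul_rpow_of_nonneg _ _ hp0.le]
        rw [lintegral_const_mul' _ _ (by finiteness [hp0.le]),
          ENNReal.mul_rpow_of_nonneg _ _ (by positivity), ← ENNReal.rpow_mul,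
          mul_one_div_cancel hp0.ne', ENNReal.rpow_one]

theorem lintegral_heatDensity_rpow_lt_top {σ t m : ℝ} (hσ : 0 < σ) (ht : 0 < t) (hm : 1 ≤ m)
    (μ : Measure (EuclideanSpace ℝ (Fin d))) [IsFiniteMeasure μ] :
    ∫⁻ x, heatDensity σ t μ x ^ m < ⊤ := by
  have hm0 : 0 < m := by linarith
  have hpi := Real.pi_pos
  have hmink := lintegral_lintegral_rpow_le (ν := (volume : Measure (EuclideanSpace ℝ (Fin d))))
    (μ := μ) (f := fun x a => ENNReal.ofReal (Real.exp (-(Real.pi / (σ * t)) * ‖x - a‖ ^ 2)))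
    (by unfold Function.uncurry; fun_prop) hm
  have h1 : ∀ a : EuclideanSpace ℝ (Fin d), ∫⁻ x, ENNReal.ofReal
      (Real.exp (-(Real.pi / (σ * t)) * ‖x - a‖ ^ 2)) ^ m =
      ENNReal.ofReal ((Real.pi / (Real.pi / (σ * t) * m)) ^ (d / 2 : ℝ)) := by
    intro a
    have := lintegral_exp_neg_mul_norm_sq (E := EuclideanSpace ℝ (Fin d))
      (c := Real.pi / (σ * t) * m) (by positivity)
    rw [finrank_euclideanSpace_fin] at this
    rw [← this, ← lintegral_sub_right_eq_self (fun x : EuclideanSpace ℝ (Fin d) =>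
      ENNReal.ofReal (Real.exp (-(Real.pi / (σ * t) * m) * ‖x‖ ^ 2))) a]
    refine lintegral_congr fun x => ?_
    rw [ENNReal.ofReal_rpow_of_pos (Real.exp_pos _), ← Real.exp_mul]
    congr 2
    ring
  simp only [h1] at hmink
  have h2 : (∫⁻ x, superpose (fun x => ‖x‖ ^ 2) (Real.pi / (σ * t)) μ x ^ m) ^ (1 / m) < ⊤ := by
    refine lt_of_le_of_lt hmink ?_
    rw [lintegral_const]
    finiteness [hm0.le, one_div_nonneg.2 hm0.le]
  have h3 : ∫⁻ x, superpose (fun x => ‖x‖ ^ 2) (Real.pi / (σ * t)) μ x ^ m < ⊤ :=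
    (ENNReal.rpow_lt_top_iff_of_pos (by positivity)).1 h2
  unfold heatDensity
  simp_rw [ENNReal.mul_rpow_of_nonneg _ _ hm0.le]
  rw [lintegral_const_mul' _ _ (by finiteness [hm0.le])]
  exact ENNReal.mul_lt_top (by finiteness [hm0.le]) h3

theorem fixedNorm_lt_top {σ α p t : ℝ} (hσ : 0 < σ) (hp : 1 ≤ p) (hα : 1 / p ≤ α) (ht : 0 < t)
    (μ₁ μ₂ : Measure (EuclideanSpace ℝ (Fin d))) [IsFiniteMeasure μ₁] [IsFiniteMeasure μ₂] :
    fixedNorm σ α p t μ₁ μ₂ < ⊤ := by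
  have hp0 : 0 < p := by linarith
  have hv := measurable_heatDensity σ t μ₂
  have hm : 1 ≤ α * p := by rwa [div_le_iff₀ hp0] at hα
  have hmink := lintegral_lintegral_rpow_le (ν := (volume : Measure (EuclideanSpace ℝ (Fin d))))
    (μ := μ₁) (f := fun z a => heatDensity σ t μ₂ (z - a) ^ α)
    ((hv.comp (measurable_fst.sub measurable_snd)).pow_const α) hp
  refine lt_of_le_of_lt hmink ?_
  have h1 : ∀ a : EuclideanSpace ℝ (Fin d), ∫⁻ z, (heatDensity σ t μ₂ (z - a) ^ α) ^ p =
      ∫⁻ x, heatDensity σ t μ₂ x ^ (α * p) := by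
    intro a
    simp_rw [← ENNReal.rpow_mul]
    exact lintegral_sub_right_eq_self (fun x => heatDensity σ t μ₂ x ^ (α * p)) a
  simp only [h1, lintegral_const]
  have := (lintegral_heatDensity_rpow_lt_top hσ ht hm μ₂).ne
  finiteness [one_div_nonneg.2 hp0.le]

theorem fixedNorm_pos {σ α p t : ℝ} (hσ : 0 < σ) (hp : 0 < p) (hα : 0 < α) (ht : 0 < t)
    {μ₁ μ₂ : Measure (EuclideanSpace ℝ (Fin d))} [IsFiniteMeasure μ₁] [IsFiniteMeasure μ₂]
    (h₁ : μ₁ ≠ 0) (h₂ : μ₂ ≠ 0) : 0 < fixedNorm σ α p t μ₁ μ₂ := by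
  have hv := measurable_heatDensity σ t μ₂
  have hpos := heatDensity_pos (mul_pos hσ ht) h₂
  have hG : Measurable fun w => ∫⁻ a, heatDensity σ t μ₂ (w - a) ^ α ∂μ₁ :=
    Measurable.lintegral_prod_right' (f := fun z : _ × _ => heatDensity σ t μ₂ (z.1 - z.2) ^ α)
      ((hv.comp (measurable_fst.sub measurable_snd)).pow_const α)
  have hin : ∀ z, 0 < ∫⁻ a, heatDensity σ t μ₂ (z - a) ^ α ∂μ₁ := fun z =>
    lintegral_pos_of_forall_pos h₁ ((hv.comp (measurable_const.sub measurable_id)).pow_const α)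
      fun a => ENNReal.rpow_pos_of_nonneg (hpos _) hα.le
  refine ENNReal.rpow_pos_of_nonneg (lintegral_pos_of_forall_pos (NeZero.ne _)
    (hG.pow_const p) fun z => ENNReal.rpow_pos_of_nonneg (hin z) hp.le) (by positivity)

end FixedMeasure

/-! ### Passage between real-valued norms and lower integrals -/

section Norms

/-- The real-valued function is zero where `F` is infinite; finiteness of the norm makes this set
null. -/
theorem eLpNorm_eq_lintegral_of_ae_eq_toReal {X : Type*} [MeasurableSpace X] {ν : Measure X}
    {f : X → ℝ} {F : X → ENNReal} {p : ℝ} (hp : 0 < p) (hF : Measurable F)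
    (hfin : (∫⁻ z, F z ^ p ∂ν) ^ (1 / p) < ⊤) (h : ∀ᵐ z ∂ν, f z = (F z).toReal) :
    eLpNorm f (ENNReal.ofReal p) ν = (∫⁻ z, F z ^ p ∂ν) ^ (1 / p) := by
  have hfin' : ∫⁻ z, F z ^ p ∂ν < ⊤ := (ENNReal.rpow_lt_top_iff_of_pos (by positivity)).1 hfin
  rw [eLpNorm_eq_lintegral_rpow_enorm_toReal (by simpa using hp) ENNReal.ofReal_ne_top,
    ENNReal.toReal_ofReal hp.le]
  congr 1
  refine lintegral_congr_ae ?_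
  filter_upwards [h, ae_lt_top (hF.pow_const p) hfin'.ne] with z h1 h2
  have h3 : F z < ⊤ := (ENNReal.rpow_lt_top_iff_of_pos hp).1 h2
  rw [h1, Real.enorm_eq_ofReal ENNReal.toReal_nonneg, ENNReal.ofReal_toReal h3.ne]

variable {d : ℕ}

theorem convolution_rpow_eq_toReal {f₁ f₂ : EuclideanSpace ℝ (Fin d) → ℝ}
    {g₁ g₂ : EuclideanSpace ℝ (Fin d) → ENNReal} {α₁ α₂ : ℝ} (hα₁ : 0 ≤ α₁) (hα₂ : 0 ≤ α₂)
    (hf₁ : ∀ x, 0 ≤ f₁ x) (hf₂ : ∀ x, 0 ≤ f₂ x) (hm₁ : AEMeasurable f₁) (hm₂ : AEMeasurable f₂)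
    (h₁ : (fun x => ENNReal.ofReal (f₁ x)) =ᵐ[volume] g₁)
    (h₂ : (fun x => ENNReal.ofReal (f₂ x)) =ᵐ[volume] g₂) (z : EuclideanSpace ℝ (Fin d)) :
    ((fun x => f₁ x ^ α₁) ⋆[ContinuousLinearMap.mul ℝ ℝ, volume] (fun x => f₂ x ^ α₂)) z =
      (∫⁻ x, g₁ x ^ α₁ * g₂ (z - x) ^ α₂).toReal := by
  have hq := (Measure.measurePreserving_sub_left volume z).quasiMeasurePreserving
  have hm₂' : AEMeasurable fun x => f₂ (z - x) := hm₂.comp_quasiMeasurePreserving hq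
  have h₂' := hq.ae h₂
  change ∫ x, f₁ x ^ α₁ * f₂ (z - x) ^ α₂ = _
  rw [integral_eq_lintegral_of_nonneg_ae
    (Eventually.of_forall fun x => mul_nonneg (Real.rpow_nonneg (hf₁ x) _)
      (Real.rpow_nonneg (hf₂ _) _))
    ((hm₁.pow_const α₁).mul (hm₂'.pow_const α₂)).aestronglyMeasurable]
  congr 1
  refine lintegral_congr_ae ?_
  filter_upwards [h₁, h₂'] with x e₁ e₂
  rw [← e₁, ← e₂, ENNReal.ofReal_mul (Real.rpow_nonneg (hf₁ x) _),
    ENNReal.ofReal_rpow_of_nonneg (hf₁ x) hα₁, ENNReal.ofReal_rpow_of_nonneg (hf₂ _) hα₂]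

theorem Q_comm (α₁ α₂ p : ℝ) (u₁ u₂ : ℝ → EuclideanSpace ℝ (Fin d) → ℝ) :
    Q α₁ α₂ p u₁ u₂ = Q α₂ α₁ p u₂ u₁ := by
  funext t
  have h : (ContinuousLinearMap.mul ℝ ℝ).flip = ContinuousLinearMap.mul ℝ ℝ := by
    ext; simp
  unfold Q weight
  rw [← convolution_flip, h, add_comm α₁ α₂]

theorem weight_mono {α₁ α₂ p : ℝ} (hα : 1 + 1 / p ≤ α₁ + α₂) {s t : ℝ} (hs : 0 < s)
    (hst : s ≤ t) : weight d α₁ α₂ p s ≤ weight d α₁ α₂ p t := by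
  refine Real.rpow_le_rpow hs.le hst ?_
  have : 0 ≤ α₁ + α₂ - 1 - 1 / p := by linarith
  positivity

theorem weight_pos {α₁ α₂ p t : ℝ} (ht : 0 < t) : 0 < weight d α₁ α₂ p t :=
  Real.rpow_pos_of_pos ht _

variable {α₁ α₂ p σ σ₁ σ₂ t : ℝ} {μ₁ μ₂ : Measure (EuclideanSpace ℝ (Fin d))}
  {u₁ u₂ : ℝ → EuclideanSpace ℝ (Fin d) → ℝ}

theorem monotoneOn_Q_of_zero (hα : 1 + 1 / p ≤ α₁ + α₂) (h₁ : IsHeatSolution 0 μ₁ u₁)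
    (h₂ : IsHeatSolution 0 μ₂ u₂) : MonotoneOn (Q α₁ α₂ p u₁ u₂) (Ioi 0) := by
  intro s hs t ht hst
  unfold Q
  rw [h₁.eq_of_zero hs ht, h₂.eq_of_zero hs ht]
  have := weight_mono (d := d) hα hs hst
  gcongr

theorem monotoneOn_QMeasure_of_zero {α : ℝ} (hα : 1 / p ≤ α)
    (h : IsHeatSolution 0 μ₁ u₁) : MonotoneOn (QMeasure α p μ₂ u₁) (Ioi 0) := by
  intro s hs t ht hst
  unfold QMeasure
  rw [h.eq_of_zero hs ht]
  have := weight_mono (d := d) (α₁ := 1) (α₂ := α) (p := p) (by linarith) hs hst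
  gcongr

theorem monotoneOn_weight_mul_fixedNorm {α : ℝ} [IsFiniteMeasure μ₁] [IsFiniteMeasure μ₂]
    (hσ : 0 < σ) (hp : 1 ≤ p) (hα : 1 / p ≤ α) :
    MonotoneOn (fun t => ENNReal.ofReal (weight d 1 α p t) * fixedNorm σ α p t μ₁ μ₂)
      (Ioi 0) := by
  intro s hs t ht hst
  have hs' : 0 < s := hs
  have ht' : 0 < t := ht
  rcases hst.eq_or_lt with rfl | hlt
  · rfl
  have h := fixedNorm_le hσ hp hα hs' (sub_pos.2 hlt) μ₁ μ₂
  rw [add_sub_cancel] at h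
  refine (mul_le_mul_right h _).trans_eq ?_
  rw [← mul_assoc, ← ENNReal.ofReal_mul (weight_pos hs').le]
  congr 2
  unfold weight
  rw [add_sub_cancel_left, ← Real.mul_rpow hs'.le (by positivity), mul_div_cancel₀ _ hs'.ne']

theorem measurable_lintegral_heatDensity_rpow (α : ℝ) [IsFiniteMeasure μ₁] [IsFiniteMeasure μ₂] :
    Measurable fun z => ∫⁻ a, heatDensity σ t μ₂ (z - a) ^ α ∂μ₁ :=
  Measurable.lintegral_prod_right' (f := fun z : _ × _ => heatDensity σ t μ₂ (z.1 - z.2) ^ α)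
    (((measurable_heatDensity σ t μ₂).comp (measurable_fst.sub measurable_snd)).pow_const α)

theorem Q_eq_weight_mul_fixedNorm {α : ℝ} [IsFiniteMeasure μ₁] [IsFiniteMeasure μ₂]
    (hσ : 0 < σ) (hp : 1 ≤ p) (hα : 1 / p ≤ α) (h₁ : IsHeatSolution 0 μ₁ u₁)
    (h₂ : IsHeatSolution σ μ₂ u₂) (ht : 0 < t) :
    Q 1 α p u₁ u₂ t = ENNReal.ofReal (weight d 1 α p t) * fixedNorm σ α p t μ₁ μ₂ := by
  have hp0 : 0 < p := by linarith
  have hα0 : 0 < α := lt_of_lt_of_le (by positivity) hα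
  unfold Q fixedNorm
  congr 1
  refine eLpNorm_eq_lintegral_of_ae_eq_toReal hp0 (measurable_lintegral_heatDensity_rpow α)
    (fixedNorm_lt_top hσ hp hα ht μ₁ μ₂) (Eventually.of_forall fun z => ?_)
  rw [convolution_rpow_eq_toReal zero_le_one hα0.le (h₁.nonneg t ht) (h₂.nonneg t ht)
    (h₁.integrable t ht).aemeasurable (h₂.integrable t ht).aemeasurable ae_eq_rfl
    (h₂.ofReal_ae_eq hσ ht)]
  congr 1
  conv_rhs => rw [← h₁.withDensity_of_zero ht]
  have hm : Measurable fun a => heatDensity σ t μ₂ (z - a) ^ α :=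
    ((measurable_heatDensity σ t μ₂).comp (measurable_const.sub measurable_id)).pow_const α
  rw [lintegral_withDensity_eq_lintegral_mul₀ (h₁.integrable t ht).aemeasurable.ennreal_ofReal
    hm.aemeasurable]
  simp only [ENNReal.rpow_one, Pi.mul_apply]

theorem QMeasure_eq_weight_mul_fixedNorm {α : ℝ} [IsFiniteMeasure μ₁] [IsFiniteMeasure μ₂]
    (hσ : 0 < σ) (hp : 1 ≤ p) (hα : 1 / p ≤ α) (h₂ : IsHeatSolution σ μ₂ u₂) (ht : 0 < t) :
    QMeasure α p μ₁ u₂ t = ENNReal.ofReal (weight d 1 α p t) * fixedNorm σ α p t μ₁ μ₂ := by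
  have hp0 : 0 < p := by linarith
  have hα0 : 0 < α := lt_of_lt_of_le (by positivity) hα
  unfold QMeasure fixedNorm
  congr 1
  refine eLpNorm_eq_lintegral_of_ae_eq_toReal hp0 (measurable_lintegral_heatDensity_rpow α)
    (fixedNorm_lt_top hσ hp hα ht μ₁ μ₂) ?_
  have hu : Measurable (u₂ t) := (h₂.continuous hσ.ne' ht).measurable
  have hv := measurable_heatDensity σ t μ₂
  -- As `μ₁` may be singular, an identity valid Lebesgue almost everywhere need not hold `μ₁`-almost
  -- everywhere along a given translate. Fubini gives it for almost every `z`, which suffices for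
  -- the norm.
  have hae : ∀ᵐ z, ∀ᵐ a ∂μ₁, ENNReal.ofReal (u₂ t (z - a)) = heatDensity σ t μ₂ (z - a) := by
    have hms : MeasurableSet {w : EuclideanSpace ℝ (Fin d) × EuclideanSpace ℝ (Fin d) |
        ENNReal.ofReal (u₂ t (w.1 - w.2)) = heatDensity σ t μ₂ (w.1 - w.2)} :=
      measurableSet_eq_fun ((hu.comp (measurable_fst.sub measurable_snd)).ennreal_ofReal)
        (hv.comp (measurable_fst.sub measurable_snd))
    rw [Measure.ae_ae_comm hms]
    exact Eventually.of_forall fun a =>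
      (measurePreserving_sub_right volume a).quasiMeasurePreserving.ae (h₂.ofReal_ae_eq hσ ht)
  filter_upwards [hae] with z hz
  have huz : Measurable fun a => u₂ t (z - a) ^ α :=
    (hu.comp (measurable_const.sub measurable_id)).pow_const α
  rw [integral_eq_lintegral_of_nonneg_ae
    (Eventually.of_forall fun a => Real.rpow_nonneg (h₂.nonneg t ht _) _)
    huz.aestronglyMeasurable]
  congr 1
  refine lintegral_congr_ae ?_
  filter_upwards [hz] with a ha
  rw [← ENNReal.ofReal_rpow_of_nonneg (h₂.nonneg t ht _) hα0.le, ha]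

end Norms

/-! ### Both factors diffusing -/

section BothDiffusing

variable {d : ℕ} {α₁ α₂ p σ₁ σ₂ t : ℝ} {μ₁ μ₂ : Measure (EuclideanSpace ℝ (Fin d))}
  {u₁ u₂ : ℝ → EuclideanSpace ℝ (Fin d) → ℝ}

/-- The convolution of powers of two heat flows. -/
noncomputable def heatConv (σ₁ σ₂ α₁ α₂ t : ℝ) (μ₁ μ₂ : Measure (EuclideanSpace ℝ (Fin d)))
    (z : EuclideanSpace ℝ (Fin d)) : ENNReal :=
  ∫⁻ x, heatDensity σ₁ t μ₁ x ^ α₁ * heatDensity σ₂ t μ₂ (z - x) ^ α₂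

theorem measurable_heatConv [IsFiniteMeasure μ₁] [IsFiniteMeasure μ₂] :
    Measurable (heatConv σ₁ σ₂ α₁ α₂ t μ₁ μ₂) :=
  Measurable.lintegral_prod_right'
    (f := fun w : _ × _ => heatDensity σ₁ t μ₁ w.2 ^ α₁ * heatDensity σ₂ t μ₂ (w.1 - w.2) ^ α₂)
    ((((measurable_heatDensity σ₁ t μ₁).comp measurable_snd).pow_const α₁).mul
      (((measurable_heatDensity σ₂ t μ₂).comp (measurable_fst.sub measurable_snd)).pow_const α₂))

theorem heatConv_eq [IsFiniteMeasure μ₁] [IsFiniteMeasure μ₂] (hσ₁ : 0 < σ₁) (hσ₂ : 0 < σ₂)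
    (ht : 0 < t) (hα₁ : 0 ≤ α₁) (hα₂ : 0 ≤ α₂) (z : EuclideanSpace ℝ (Fin d)) :
    heatConv σ₁ σ₂ α₁ α₂ t μ₁ μ₂ z =
      ENNReal.ofReal (((σ₁ * t) ^ (-(d / 2 : ℝ))) ^ α₁ * ((σ₂ * t) ^ (-(d / 2 : ℝ))) ^ α₂) *
        superposeConv (Real.pi / (σ₁ * t)) (Real.pi / (σ₂ * t)) α₁ α₂ μ₁ μ₂ z := by
  unfold heatConv superposeConv heatDensity
  rw [← lintegral_const_mul' _ _ ENNReal.ofReal_ne_top]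
  refine lintegral_congr fun x => ?_
  rw [ENNReal.mul_rpow_of_nonneg _ _ hα₁, ENNReal.mul_rpow_of_nonneg _ _ hα₂,
    ENNReal.ofReal_rpow_of_pos (by positivity), ENNReal.ofReal_rpow_of_pos (by positivity),
    ENNReal.ofReal_mul (by positivity)]
  ring

theorem lintegral_heatConv_rpow_eq [IsFiniteMeasure μ₁] [IsFiniteMeasure μ₂] (hσ₁ : 0 < σ₁)
    (hσ₂ : 0 < σ₂) (ht : 0 < t) (hα₁ : 0 ≤ α₁) (hα₂ : 0 ≤ α₂) (hp : 0 < p) :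
    (∫⁻ z, heatConv σ₁ σ₂ α₁ α₂ t μ₁ μ₂ z ^ p) ^ (1 / p) =
      ENNReal.ofReal (((σ₁ * t) ^ (-(d / 2 : ℝ))) ^ α₁ * ((σ₂ * t) ^ (-(d / 2 : ℝ))) ^ α₂) *
        (∫⁻ z, superposeConv (Real.pi / (σ₁ * t)) (Real.pi / (σ₂ * t)) α₁ α₂ μ₁ μ₂ z ^ p) ^
          (1 / p) := by
  simp_rw [heatConv_eq hσ₁ hσ₂ ht hα₁ hα₂, ENNReal.mul_rpow_of_nonneg _ _ hp.le]
  rw [lintegral_const_mul' _ _ (by finiteness [hp.le]),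
    ENNReal.mul_rpow_of_nonneg _ _ (by positivity), ← ENNReal.rpow_mul,
    mul_one_div_cancel hp.ne', ENNReal.rpow_one]

theorem lintegral_heatConv_rpow_pos [IsFiniteMeasure μ₁] [IsFiniteMeasure μ₂] (hσ₁ : 0 < σ₁)
    (hσ₂ : 0 < σ₂) (ht : 0 < t) (hα₁ : 0 ≤ α₁) (hα₂ : 0 ≤ α₂) (hp : 0 < p) (h₁ : μ₁ ≠ 0)
    (h₂ : μ₂ ≠ 0) : 0 < (∫⁻ z, heatConv σ₁ σ₂ α₁ α₂ t μ₁ μ₂ z ^ p) ^ (1 / p) := by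
  have hin : ∀ z, 0 < heatConv σ₁ σ₂ α₁ α₂ t μ₁ μ₂ z := fun z =>
    lintegral_pos_of_forall_pos (NeZero.ne _)
      (((measurable_heatDensity σ₁ t μ₁).pow_const α₁).mul
        (((measurable_heatDensity σ₂ t μ₂).comp
          (measurable_const.sub measurable_id)).pow_const α₂))
      fun x => ENNReal.mul_pos
        (ENNReal.rpow_pos_of_nonneg (heatDensity_pos (mul_pos hσ₁ ht) h₁ _) hα₁).ne'
        (ENNReal.rpow_pos_of_nonneg (heatDensity_pos (mul_pos hσ₂ ht) h₂ _) hα₂).ne'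
  exact ENNReal.rpow_pos_of_nonneg (lintegral_pos_of_forall_pos (NeZero.ne _)
    (measurable_heatConv.pow_const p) fun z => ENNReal.rpow_pos_of_nonneg (hin z) hp.le)
    (by positivity)

theorem Q_eq_weight_mul_lintegral [IsFiniteMeasure μ₁] [IsFiniteMeasure μ₂] (hσ₁ : 0 < σ₁)
    (hσ₂ : 0 < σ₂) (ht : 0 < t) (hα₁ : 0 ≤ α₁) (hα₂ : 0 ≤ α₂) (hp : 0 < p)
    (h₁ : IsHeatSolution σ₁ μ₁ u₁) (h₂ : IsHeatSolution σ₂ μ₂ u₂)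
    (hfin : (∫⁻ z, heatConv σ₁ σ₂ α₁ α₂ t μ₁ μ₂ z ^ p) ^ (1 / p) < ⊤) :
    Q α₁ α₂ p u₁ u₂ t = ENNReal.ofReal (weight d α₁ α₂ p t) *
      (∫⁻ z, heatConv σ₁ σ₂ α₁ α₂ t μ₁ μ₂ z ^ p) ^ (1 / p) := by
  unfold Q
  congr 1
  refine eLpNorm_eq_lintegral_of_ae_eq_toReal hp measurable_heatConv hfin
    (Eventually.of_forall fun z => ?_)
  exact convolution_rpow_eq_toReal hα₁ hα₂ (h₁.nonneg t ht) (h₂.nonneg t ht)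
    (h₁.integrable t ht).aemeasurable (h₂.integrable t ht).aemeasurable
    (h₁.ofReal_ae_eq hσ₁ ht) (h₂.ofReal_ae_eq hσ₂ ht) z

theorem lintegral_heatConv_one [IsFiniteMeasure μ₁] [IsFiniteMeasure μ₂] (hσ₁ : 0 < σ₁)
    (hσ₂ : 0 < σ₂) (ht : 0 < t) :
    ∫⁻ z, heatConv σ₁ σ₂ 1 1 t μ₁ μ₂ z = μ₁ univ * μ₂ univ := by
  have hm₁ := measurable_heatDensity σ₁ t μ₁
  have hm₂ := measurable_heatDensity σ₂ t μ₂
  unfold heatConv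
  simp only [ENNReal.rpow_one]
  rw [lintegral_lintegral_swap ((hm₁.comp measurable_snd).mul
    (hm₂.comp (measurable_fst.sub measurable_snd))).aemeasurable]
  calc ∫⁻ x, ∫⁻ z, heatDensity σ₁ t μ₁ x * heatDensity σ₂ t μ₂ (z - x)
      = ∫⁻ x, heatDensity σ₁ t μ₁ x * μ₂ univ := by
        refine lintegral_congr fun x => ?_
        have : Measurable fun z => heatDensity σ₂ t μ₂ (z - x) :=
          hm₂.comp (measurable_id.sub_const x)
        rw [lintegral_const_mul _ this, lintegral_sub_right_eq_self,
          lintegral_heatDensity (mul_pos hσ₂ ht)]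
    _ = _ := by rw [lintegral_mul_const _ hm₁, lintegral_heatDensity (mul_pos hσ₁ ht)]

theorem monotoneOn_Q_and_pos_of_one [IsFiniteMeasure μ₁] [IsFiniteMeasure μ₂] (hσ₁ : 0 < σ₁)
    (hσ₂ : 0 < σ₂) (h₁ : IsHeatSolution σ₁ μ₁ u₁) (h₂ : IsHeatSolution σ₂ μ₂ u₂) :
    MonotoneOn (Q 1 1 1 u₁ u₂) (Ioi 0) ∧ (μ₁ ≠ 0 → μ₂ ≠ 0 → ∀ t, 0 < t →
      0 < Q 1 1 1 u₁ u₂ t ∧ Q 1 1 1 u₁ u₂ t < ⊤) := by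
  have hQ : ∀ t, 0 < t → Q 1 1 1 u₁ u₂ t = μ₁ univ * μ₂ univ := by
    intro t ht
    have e : (∫⁻ z, heatConv σ₁ σ₂ 1 1 t μ₁ μ₂ z ^ (1 : ℝ)) ^ (1 / (1 : ℝ)) =
        μ₁ univ * μ₂ univ := by
      simp only [ENNReal.rpow_one, div_one]
      exact lintegral_heatConv_one hσ₁ hσ₂ ht
    rw [Q_eq_weight_mul_lintegral hσ₁ hσ₂ ht zero_le_one zero_le_one one_pos h₁ h₂
      (by rw [e]; finiteness), e]
    simp [weight]
  refine ⟨fun s hs t ht _ => by rw [hQ s hs, hQ t ht], fun n₁ n₂ t ht => ?_⟩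
  rw [hQ t ht]
  exact ⟨ENNReal.mul_pos (Measure.measure_univ_ne_zero.2 n₁) (Measure.measure_univ_ne_zero.2 n₂),
    by finiteness⟩

theorem monotoneOn_Q_and_pos_of_one_lt [IsFiniteMeasure μ₁] [IsFiniteMeasure μ₂]
    {b₁ b₂ : ℝ} (hp : 1 < p) (hb₁ : 0 < b₁) (hb₂ : 0 < b₂) (hb : b₁ + b₂ + 1 / p = 1)
    (hα₁ : 0 < α₁) (hα₂ : 0 < α₂) (hαb₁ : 1 - b₁ ≤ α₁) (hαb₂ : 1 - b₂ ≤ α₂) (hσ₁ : 0 < σ₁)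
    (hσ₂ : 0 < σ₂) (hσ : α₁ * b₁ * σ₂ = α₂ * b₂ * σ₁)
    (h₁ : IsHeatSolution σ₁ μ₁ u₁) (h₂ : IsHeatSolution σ₂ μ₂ u₂) :
    MonotoneOn (Q α₁ α₂ p u₁ u₂) (Ioi 0) ∧ (μ₁ ≠ 0 → μ₂ ≠ 0 → ∀ t, 0 < t →
      0 < Q α₁ α₂ p u₁ u₂ t ∧ Q α₁ α₂ p u₁ u₂ t < ⊤) := by
  have hp0 : 0 < p := by linarith
  have hpi := Real.pi_pos
  -- The relation `hσ` says precisely that this `c` equals the same expression with index `2`, so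
  -- both flows have rates `c / (α_j b_j) / t`.
  set c := Real.pi * α₁ * b₁ / σ₁ with hc
  have hc0 : 0 < c := by positivity
  have e₁ : ∀ t, Real.pi / (σ₁ * t) = c / (α₁ * b₁) / t := by
    intro t
    rw [hc]; field_simp
  have e₂ : ∀ t, Real.pi / (σ₂ * t) = c / (α₂ * b₂) / t := by
    intro t
    have : c = Real.pi * α₂ * b₂ / σ₂ := by
      rw [hc, div_eq_div_iff hσ₁.ne' hσ₂.ne']
      linear_combination Real.pi * hσ
    rw [this]; field_simp
  have hfin : ∀ t, 0 < t → (∫⁻ z, heatConv σ₁ σ₂ α₁ α₂ t μ₁ μ₂ z ^ p) ^ (1 / p) < ⊤ := by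
    intro t ht
    rw [lintegral_heatConv_rpow_eq hσ₁ hσ₂ ht hα₁.le hα₂.le hp0]
    refine ENNReal.mul_lt_top ENNReal.ofReal_lt_top ?_
    have := lintegral_superposeConv_lt_top hp hb₁ hb₂ hb (div_pos hc0 ht) hαb₁ hαb₂ μ₁ μ₂
    rwa [e₁, e₂, div_right_comm c (α₁ * b₁), div_right_comm c (α₂ * b₂)]
  have hQ := fun t (ht : 0 < t) =>
    Q_eq_weight_mul_lintegral hσ₁ hσ₂ ht hα₁.le hα₂.le hp0 h₁ h₂ (hfin t ht)
  refine ⟨fun s hs t ht hst => ?_, fun n₁ n₂ t ht => ?_⟩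
  · have hs' : 0 < s := hs
    have ht' : 0 < t := ht
    rcases hst.eq_or_lt with rfl | hlt
    · rfl
    have h := lintegral_superposeConv_le hp hb₁ hb₂ hb hc0 hαb₁ hαb₂ hs' (sub_pos.2 hlt) μ₁ μ₂
    rw [add_sub_cancel, ← e₁, ← e₂, ← e₁, ← e₂] at h
    rw [hQ s hs, hQ t ht, lintegral_heatConv_rpow_eq hσ₁ hσ₂ hs' hα₁.le hα₂.le hp0,
      lintegral_heatConv_rpow_eq hσ₁ hσ₂ ht' hα₁.le hα₂.le hp0, ← mul_assoc, ← mul_assoc]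
    refine (mul_le_mul_right h _).trans_eq ?_
    rw [← mul_assoc, ← ENNReal.ofReal_mul (weight_pos hs').le,
      ← ENNReal.ofReal_mul (weight_pos ht').le,
      ← ENNReal.ofReal_mul (mul_nonneg (weight_pos hs').le (by positivity))]
    congr 2
    -- The weight and the heat kernel normalisations combine to `r ^ (-(d (1 + 1/p) / 2))` up to a
    -- constant, which cancels the power of `s / t` in `lintegral_superposeConv_le`.
    have key : ∀ r, 0 < r → weight d α₁ α₂ p r * (((σ₁ * r) ^ (-(d / 2 : ℝ))) ^ α₁ *
        ((σ₂ * r) ^ (-(d / 2 : ℝ))) ^ α₂) = (σ₁ ^ (-(d / 2 : ℝ))) ^ α₁ *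
        (σ₂ ^ (-(d / 2 : ℝ))) ^ α₂ * r ^ (-(d * (1 + 1 / p) / 2)) := by
      intro r hr
      have e : -(d * (1 + 1 / p) / 2) = (d : ℝ) * (α₁ + α₂ - 1 - 1 / p) / 2 +
        (-(d / 2 : ℝ)) * α₁ + (-(d / 2 : ℝ)) * α₂ := by ring
      rw [e, Real.rpow_add hr, Real.rpow_add hr, Real.rpow_mul hr.le, Real.rpow_mul hr.le,
        Real.mul_rpow hσ₁.le hr.le, Real.mul_rpow hσ₂.le hr.le,
        Real.mul_rpow (by positivity) (by positivity),
        Real.mul_rpow (by positivity) (by positivity), weight]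
      ring
    rw [key s hs', key t ht', mul_assoc, Real.div_rpow hs'.le ht'.le, Real.rpow_neg hs'.le,
      Real.rpow_neg ht'.le]
    field_simp
  · rw [hQ t ht]
    refine ⟨ENNReal.mul_pos (by simpa using weight_pos ht)
      (lintegral_heatConv_rpow_pos hσ₁ hσ₂ ht hα₁.le hα₂.le hp0 n₁ n₂).ne',
      ENNReal.mul_lt_top ENNReal.ofReal_lt_top (hfin t ht)⟩

theorem monotoneOn_Q_and_pos {ρ₁ ρ₂ : ℝ} [IsFiniteMeasure μ₁] [IsFiniteMeasure μ₂]
    (hα₁ : 0 < α₁) (hα₁' : α₁ ≤ 1) (hα₂ : 0 < α₂) (hα₂' : α₂ ≤ 1) (hp : 1 ≤ p)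
    (hρ₁' : ρ₁ ≤ 1) (hρ₂' : ρ₂ ≤ 1) (hρ : ρ₁ * α₁ + ρ₂ * α₂ = 1 + 1 / p)
    (hσ₁ : 0 < σ₁) (hσ₂ : 0 < σ₂)
    (hσ : α₁ * (1 - ρ₁ * α₁) * σ₂ = α₂ * (1 - ρ₂ * α₂) * σ₁)
    (h₁ : IsHeatSolution σ₁ μ₁ u₁) (h₂ : IsHeatSolution σ₂ μ₂ u₂) :
    MonotoneOn (Q α₁ α₂ p u₁ u₂) (Ioi 0) ∧ (μ₁ ≠ 0 → μ₂ ≠ 0 → ∀ t, 0 < t →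
      0 < Q α₁ α₂ p u₁ u₂ t ∧ Q α₁ α₂ p u₁ u₂ t < ⊤) := by
  have hl₁ : ρ₁ * α₁ ≤ α₁ := mul_le_of_le_one_left hα₁.le hρ₁'
  have hl₂ : ρ₂ * α₂ ≤ α₂ := mul_le_of_le_one_left hα₂.le hρ₂'
  rcases hp.eq_or_lt with rfl | hp1
  · obtain rfl : α₁ = 1 := by linarith
    obtain rfl : α₂ = 1 := by linarith
    exact monotoneOn_Q_and_pos_of_one hσ₁ hσ₂ h₁ h₂
  have hp' : 1 / p < 1 := by rw [div_lt_one (by linarith)]; exact hp1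
  -- With both diffusivities positive, `b₁` and `b₂` vanish only together. That would contradict `b₁
  -- + b₂ = 1 - 1 / p > 0`, so both are positive.
  have hz : 1 - ρ₁ * α₁ = 0 ↔ 1 - ρ₂ * α₂ = 0 := by
    constructor <;> intro h <;> rw [h] at hσ <;>
      simpa [hα₁.ne', hα₂.ne', hσ₁.ne', hσ₂.ne', eq_comm] using hσ
  have hb₁ : 0 < 1 - ρ₁ * α₁ := by
    refine lt_of_le_of_ne (by linarith) fun h => ?_
    have := hz.1 h.symm
    linarith
  have hb₂ : 0 < 1 - ρ₂ * α₂ := by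
    refine lt_of_le_of_ne (by linarith) fun h => ?_
    have := hz.2 h.symm
    linarith
  exact monotoneOn_Q_and_pos_of_one_lt hp1 hb₁ hb₂ (by linarith) hα₁ hα₂ (by linarith)
    (by linarith) hσ₁ hσ₂ hσ h₁ h₂

end BothDiffusing

/-! ### One factor constant in time -/

section OneStatic

variable {d : ℕ} {α₁ α₂ p ρ₁ ρ₂ σ σ₁ σ₂ : ℝ} {μ₁ μ₂ : Measure (EuclideanSpace ℝ (Fin d))}
  {u₁ u₂ : ℝ → EuclideanSpace ℝ (Fin d) → ℝ}

theorem weight_mul_fixedNorm_pos_and_lt_top {α t : ℝ} [IsFiniteMeasure μ₁] [IsFiniteMeasure μ₂]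
    (hσ : 0 < σ) (hp : 1 ≤ p) (hα : 1 / p ≤ α) (ht : 0 < t) (n₁ : μ₁ ≠ 0) (n₂ : μ₂ ≠ 0) :
    0 < ENNReal.ofReal (weight d 1 α p t) * fixedNorm σ α p t μ₁ μ₂ ∧
      ENNReal.ofReal (weight d 1 α p t) * fixedNorm σ α p t μ₁ μ₂ < ⊤ :=
  ⟨ENNReal.mul_pos (by simpa using weight_pos ht)
    (fixedNorm_pos hσ (by linarith) (lt_of_lt_of_le (by positivity) hα) ht n₁ n₂).ne',
    ENNReal.mul_lt_top ENNReal.ofReal_lt_top (fixedNorm_lt_top hσ hp hα ht μ₁ μ₂)⟩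

theorem monotoneOn_QMeasure_and_pos {α : ℝ} [IsFiniteMeasure μ₁] [IsFiniteMeasure μ₂]
    (hp : 1 ≤ p) (hα : 1 / p ≤ α) (hσ : 0 ≤ σ) (h₂ : IsHeatSolution σ μ₂ u₂) :
    MonotoneOn (QMeasure α p μ₁ u₂) (Ioi 0) ∧ (μ₁ ≠ 0 → μ₂ ≠ 0 → σ ≠ 0 → ∀ t, 0 < t →
      0 < QMeasure α p μ₁ u₂ t ∧ QMeasure α p μ₁ u₂ t < ⊤) := by
  rcases hσ.eq_or_lt with rfl | hσ'
  · exact ⟨monotoneOn_QMeasure_of_zero hα h₂, fun _ _ h => absurd rfl h⟩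
  refine ⟨(monotoneOn_weight_mul_fixedNorm hσ' hp hα).congr fun t ht =>
    (QMeasure_eq_weight_mul_fixedNorm hσ' hp hα h₂ ht).symm, fun n₁ n₂ _ t ht => ?_⟩
  rw [QMeasure_eq_weight_mul_fixedNorm hσ' hp hα h₂ ht]
  exact weight_mul_fixedNorm_pos_and_lt_top hσ' hp hα ht n₁ n₂

/-- The relation between the diffusivities forces `ρ₁ α₁ = 1`, hence `α₁ = 1`. The static factor
then enters linearly, and the fixed-measure estimates apply to it. -/
theorem monotoneOn_Q_and_pos_of_left_zero [IsFiniteMeasure μ₁] [IsFiniteMeasure μ₂]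
    (hα₁ : 0 < α₁) (hα₁' : α₁ ≤ 1) (hα₂ : 0 < α₂) (hp : 1 ≤ p)
    (hρ₁' : ρ₁ ≤ 1) (hρ₂' : ρ₂ ≤ 1) (hρ : ρ₁ * α₁ + ρ₂ * α₂ = 1 + 1 / p) (hσ₂ : 0 < σ₂)
    (hσ : α₁ * (1 - ρ₁ * α₁) * σ₂ = 0)
    (h₁ : IsHeatSolution 0 μ₁ u₁) (h₂ : IsHeatSolution σ₂ μ₂ u₂) :
    MonotoneOn (Q α₁ α₂ p u₁ u₂) (Ioi 0) ∧ (μ₁ ≠ 0 → μ₂ ≠ 0 → ∀ t, 0 < t →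
      0 < Q α₁ α₂ p u₁ u₂ t ∧ Q α₁ α₂ p u₁ u₂ t < ⊤) := by
  have hl₁ : ρ₁ * α₁ ≤ α₁ := mul_le_of_le_one_left hα₁.le hρ₁'
  have hl₂ : ρ₂ * α₂ ≤ α₂ := mul_le_of_le_one_left hα₂.le hρ₂'
  have hb : 1 - ρ₁ * α₁ = 0 := by simpa [hα₁.ne', hσ₂.ne'] using hσ
  obtain rfl : α₁ = 1 := by linarith
  have hα : 1 / p ≤ α₂ := by linarith
  refine ⟨(monotoneOn_weight_mul_fixedNorm hσ₂ hp hα).congr fun t ht =>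
    (Q_eq_weight_mul_fixedNorm hσ₂ hp hα h₁ h₂ ht).symm, fun n₁ n₂ t ht => ?_⟩
  rw [Q_eq_weight_mul_fixedNorm hσ₂ hp hα h₁ h₂ ht]
  exact weight_mul_fixedNorm_pos_and_lt_top hσ₂ hp hα ht n₁ n₂

end OneStatic

end HeatYoung

/-! ### Assembly of the cases -/

theorem corollary1p7
    (d : ℕ) (hd : 1 ≤ d)
    (α₁ α₂ p ρ₁ ρ₂ σ₁ σ₂ : ℝ)
    (hα₁ : 0 < α₁) (hα₁' : α₁ ≤ 1) (hα₂ : 0 < α₂) (hα₂' : α₂ ≤ 1)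
    (hp : 1 ≤ p) (hα : 1 + 1 / p ≤ α₁ + α₂)
    (hρ₁ : 0 ≤ ρ₁) (hρ₁' : ρ₁ ≤ 1) (hρ₂ : 0 ≤ ρ₂) (hρ₂' : ρ₂ ≤ 1)
    (hρ : ρ₁ * α₁ + ρ₂ * α₂ = 1 + 1 / p)
    (hσ₁ : 0 ≤ σ₁) (hσ₂ : 0 ≤ σ₂)
    (hσ : α₁ * (1 - ρ₁ * α₁) * σ₂ = α₂ * (1 - ρ₂ * α₂) * σ₁)
    (μ₁ μ₂ : Measure (EuclideanSpace ℝ (Fin d)))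
    [IsFiniteMeasure μ₁] [IsFiniteMeasure μ₂]
    (hμ₁ : IsCompact μ₁.support) (hμ₂ : IsCompact μ₂.support) :
    (∀ u₁ u₂ : ℝ → EuclideanSpace ℝ (Fin d) → ℝ,
      HeatYoung.IsHeatSolution σ₁ μ₁ u₁ → HeatYoung.IsHeatSolution σ₂ μ₂ u₂ →
        MonotoneOn (HeatYoung.Q α₁ α₂ p u₁ u₂) (Ioi 0) ∧
        (μ₁ ≠ 0 → μ₂ ≠ 0 → (σ₁ ≠ 0 ∨ σ₂ ≠ 0) → ∀ t, 0 < t →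
          0 < HeatYoung.Q α₁ α₂ p u₁ u₂ t ∧ HeatYoung.Q α₁ α₂ p u₁ u₂ t < ⊤)) ∧
    (σ₁ = 0 → α₁ = 1 → ∀ u₂ : ℝ → EuclideanSpace ℝ (Fin d) → ℝ,
      HeatYoung.IsHeatSolution σ₂ μ₂ u₂ →
        MonotoneOn (HeatYoung.QMeasure α₂ p μ₁ u₂) (Ioi 0) ∧
        (μ₁ ≠ 0 → μ₂ ≠ 0 → σ₂ ≠ 0 → ∀ t, 0 < t →
          0 < HeatYoung.QMeasure α₂ p μ₁ u₂ t ∧ HeatYoung.QMeasure α₂ p μ₁ u₂ t < ⊤)) ∧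
    (σ₂ = 0 → α₂ = 1 → ∀ u₁ : ℝ → EuclideanSpace ℝ (Fin d) → ℝ,
      HeatYoung.IsHeatSolution σ₁ μ₁ u₁ →
        MonotoneOn (HeatYoung.QMeasure α₁ p μ₂ u₁) (Ioi 0) ∧
        (μ₁ ≠ 0 → μ₂ ≠ 0 → σ₁ ≠ 0 → ∀ t, 0 < t →
          0 < HeatYoung.QMeasure α₁ p μ₂ u₁ t ∧ HeatYoung.QMeasure α₁ p μ₂ u₁ t < ⊤)) := by
  refine ⟨fun u₁ u₂ h₁ h₂ => ?_, fun _ e u₂ h₂ =>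
    HeatYoung.monotoneOn_QMeasure_and_pos hp (by linarith) hσ₂ h₂, fun _ e u₁ h₁ => ?_⟩
  · rcases hσ₁.eq_or_lt with rfl | pσ₁ <;> rcases hσ₂.eq_or_lt with rfl | pσ₂
    · exact ⟨HeatYoung.monotoneOn_Q_of_zero hα h₁ h₂, fun _ _ h => by simp at h⟩
    · have := HeatYoung.monotoneOn_Q_and_pos_of_left_zero hα₁ hα₁' hα₂ hp hρ₁' hρ₂' hρ pσ₂
        (by simpa using hσ) h₁ h₂
      exact ⟨this.1, fun n₁ n₂ _ => this.2 n₁ n₂⟩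
    · rw [HeatYoung.Q_comm]
      have := HeatYoung.monotoneOn_Q_and_pos_of_left_zero (ρ₁ := ρ₂) (ρ₂ := ρ₁) hα₂ hα₂' hα₁ hp
        hρ₂' hρ₁' (by linarith) pσ₁ (by simpa using hσ.symm) h₂ h₁
      exact ⟨this.1, fun n₁ n₂ _ => this.2 n₂ n₁⟩
    · have := HeatYoung.monotoneOn_Q_and_pos hα₁ hα₁' hα₂ hα₂' hp hρ₁' hρ₂' hρ pσ₁ pσ₂ hσ h₁ h₂
      exact ⟨this.1, fun n₁ n₂ _ => this.2 n₁ n₂⟩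
  · have := HeatYoung.monotoneOn_QMeasure_and_pos (μ₁ := μ₂) (α := α₁) hp (by linarith) hσ₁ h₁
    exact ⟨this.1, fun n₁ n₂ => this.2 n₂ n₁⟩
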